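/- Let $M_0$ be the rank one Heisenberg vertex operator algebra: its Fock space is spanned by the vectors $a_{-n_1}\cdots a_{-n_k}\mathbf 1$ ($n_i\ge 1$), where $[a_m,a_n]=m\,\delta_{m+n,0}$ and $a_n\mathbf 1=0$ for $n\ge 0$; it is generated by the field $Y(a,z)=\sum_{n\in\mathbb Z}a_nz^{-n-1}$, $a=a_{-1}\mathbf 1$, and has conformal vector $\omega=\tfrac12a_{-1}^2\mathbf 1$, central charge $c=1$ and $L_0$-grading $M_0=\bigoplus_n V_n$. For $\tau\in\mathfrak H$ put $q=e^{2\pi i\tau}$, and for $v\in M_0$ let $$Z^{(1)}(v,\tau)=\mathrm{Tr}_{M_0}\,o(v)\,q^{L_0-1/24}=\sum_{n}\mathrm{Tr}_{V_n}\big(o(v)\big)\,q^{n-1/24},$$ where the zero mode $o(v)$ is $v_{k-1}$ for $v\in V_k$ and is extended linearly. Let $Y[v,z]=Y(e^{zL_0}v,e^z-1)=\sum_n v[n]z^{-n-1}$ be the square bracket vertex operators, $\tilde\omega=\omega-\tfrac1{24}\mathbf 1$, $Y[\tilde\omega,z]=\sum_nL[n]z^{-n-2}$ and $V_{[r]}=\{u\in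 M_0: L[0]u=ru\}$. Let $\langle\ ,\ \rangle_{\mathrm{sq}}$ be the Li–Zamolodchikov metric of the vertex operator algebra $(M_0,Y[\ ,\ ],\mathbf 1,\tilde\omega)$, that is, its nondegenerate invariant bilinear form normalized by $\langle\mathbf 1,\mathbf 1\rangle_{\mathrm{sq}}=1$; invariance means that $\langle u[n]x,y\rangle_{\mathrm{sq}}=\langle x,u[n]^{\dagger}y\rangle_{\mathrm{sq}}$ for $u\in V_{[h]}$, $n\in\mathbb Z$ and $x,y\in M_0$, where $u[n]^{\dagger}=(-1)^h\sum_{k=0}^{h}\frac1{k!}\,(L[1]^ku)[2h-n-k-2]$. The genus two partition function obtained by sewing two tori with modular parameters $\tau_1,\tau_2\in\mathfrak H$ and sewing parameter $\epsilon$ is the formal power series $$Z^{(2)}_{M_0}(\tau_1,\tau_2,\epsilon)=\sum_{r\ge 0}\epsilon^r\sum_{u\in V_{[r]}}Z^{(1)}(u,\tau_1)\,Z^{(1)}(\bar u,\tau_2),$$ where, for each $r$, $u$ runs over any basis of $V_{[r]}$ and $\bar u$ over the dual basis with respect to $\langle\ ,\ \rangle_{\mathrm{sq}}$. Let $\eta(\tau)=q^{1/24}\prod_{n\ge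 1}(1-q^n)$. For even $k\ge 2$ let $E_k(\tau)=-\frac{B_k}{k!}+\frac{2}{(k-1)!}\sum_{n\ge 1}\sigma_{k-1}(n)q^n$, and for odd $k\ge 3$ let $E_k=0$. For $k,l\ge 1$ let $$C(k,l,\tau)=(-1)^{l+1}\frac{(k+l-1)!}{(k-1)!\,(l-1)!}\,E_{k+l}(\tau),\qquad A_a(k,l)=\frac{\epsilon^{(k+l)/2}}{\sqrt{kl}}\,C(k,l,\tau_a)\quad(a=1,2),$$ and define $\det(I-A_1A_2)$ by $$\log\det(I-A_1A_2)=-\sum_{n\ge 1}\frac1n\,\mathrm{Tr}\big((A_1A_2)^n\big).$$ **Theorem.** The series $Z^{(1)}(v,\tau)$ converge for all $v\in M_0$ and $\tau\in\mathfrak H$, and for all $\tau_1,\tau_2\in\mathfrak H$ $$Z^{(2)}_{M_0}(\tau_1,\tau_2,\epsilon)=\frac{1}{\eta(\tau_1)\,\eta(\tau_2)}\,\big(\det(I-A_1A_2)\big)^{-1/2}$$ as formal power series in $\epsilon$, where $(\cdot)^{-1/2}$ is the power of a series with constant term $1$, again with constant term $1$. -/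

import Mathlib

noncomputable section

namespace GenusTwoBoson

open MvPolynomial

/-! ## Fields on a vector space

`VertexOperator ℂ V` is the space of fields on `V`; the `n`-th mode `A_n` of a field
`A(z) = ∑ A_n z ^ (-n-1)` is `A.ncoeff n`. -/

section Fields

variable {V : Type*} [AddCommGroup V] [Module ℂ V]

/-- The endomorphism `∑ i, f i` for a family of endomorphisms such that, for every vector `x`, only
finitely many `f i x` are nonzero. -/
def locallyFiniteSum {ι : Type*} (f : ι → Module.End ℂ V)
    (hf : ∀ x, (Function.support fun i => f i x).Finite) : Module.End ℂ V where
  toFun x := ∑ᶠ i, f i x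
  map_add' x y := by
    simp only [map_add]
    exact finsum_add_distrib (hf x) (hf y)
  map_smul' c x := by
    simp only [map_smul, RingHom.id_apply]
    exact (smul_finsum' c (hf x)).symm

/-- The field with given modes, subject to the truncation condition. -/
def fieldOfModes (A : ℤ → Module.End ℂ V) (hA : ∀ x, ∃ N : ℤ, ∀ n, N < n → A n x = 0) :
    VertexOperator ℂ V :=
  VertexOperator.of_coeff (fun j => A (-j - 1)) fun x => by
    obtain ⟨N, hN⟩ := hA x
    refine ⟨-N - 1, fun j hj => ?_⟩
    by_contra hlt
    exact hj (hN _ (by omega))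

theorem ncoeff_fieldOfModes (A : ℤ → Module.End ℂ V)
    (hA : ∀ x, ∃ N : ℤ, ∀ n, N < n → A n x = 0) (n : ℤ) :
    (fieldOfModes A hA).ncoeff n = A n := by
  rw [fieldOfModes, VertexOperator.ncoeff_of_coeff]
  congr 1
  ring

theorem exists_truncation (W : VertexOperator ℂ V) (x : V) :
    ∃ N : ℤ, ∀ n, N < n → W.ncoeff n x = 0 :=
  ⟨-(HahnSeries.order ((HahnModule.of ℂ).symm (W x))) - 1, fun n hn =>
    VertexOperator.ncoeff_eq_zero_of_lt_order W n x (by omega)⟩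

/-- The identity field `Y(𝟏, z) = Id`. -/
def idField : VertexOperator ℂ V :=
  fieldOfModes (fun n => if n = -1 then LinearMap.id else 0) fun _ => ⟨-1, fun n hn => by
    rw [if_neg (by omega)]
    rfl⟩

/-! ## Virasoro modes, adjoint modes and the Li–Zamolodchikov metric

These notions depend only on a state-field correspondence `Y`, the vacuum and the conformal
vector. -/

/-- The Virasoro mode `L_n`, where `Y(ω, z) = ∑ L_n z ^ (-n-2)`. -/
def virasoroMode (Y : V →ₗ[ℂ] VertexOperator ℂ V) (ω : V) (n : ℤ) : Module.End ℂ V :=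
  (Y ω).ncoeff (n + 1)

/-- The space of vectors of weight `r`, that is, `{u | L_0 u = r u}`. -/
def weightSpace (Y : V →ₗ[ℂ] VertexOperator ℂ V) (ω : V) (r : ℕ) : Submodule ℂ V :=
  Module.End.eigenspace (virasoroMode Y ω 0) (r : ℂ)

/-- For `u` of weight `h`, the mode
`u_n† = (-1)^h ∑_{k=0}^{h} (1/k!) (L_1^k u)_{2h-n-k-2}` of the adjoint vertex operator
`Y†(u, z) = Y(exp(z L_1) (-z^2)^{-L_0} u, z^{-1})`. -/
def adjointMode (Y : V →ₗ[ℂ] VertexOperator ℂ V) (ω : V) (h : ℕ) (u : V) (n : ℤ) :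
    Module.End ℂ V :=
  (-1 : ℂ) ^ h • ∑ k ∈ Finset.range (h + 1), (1 / (k.factorial : ℂ)) •
    (Y (((virasoroMode Y ω 1) ^ k) u)).ncoeff (2 * h - n - k - 2)

/-- The Li–Zamolodchikov metric of a vertex operator algebra of strong CFT type (whose weights are
nonnegative): the nondegenerate invariant bilinear form, normalized by `⟨𝟏, 𝟏⟩ = 1`. -/
structure IsLiZMetric (Y : V →ₗ[ℂ] VertexOperator ℂ V) (vac ω : V)
    (B : LinearMap.BilinForm ℂ V) : Prop where
  invariant : ∀ (h : ℕ), ∀ u ∈ weightSpace Y ω h, ∀ (n : ℤ) (x y : V),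
    B ((Y u).ncoeff n x) y = B x (adjointMode Y ω h u n y)
  normalized : B vac vac = 1
  nondegenerate : B.Nondegenerate

end Fields

/-! ## Square bracket coefficients -/

/-- `q_z = e^z` as a formal Laurent series in `z`. -/
def qz : LaurentSeries ℂ := ((PowerSeries.exp ℂ : PowerSeries ℂ) : LaurentSeries ℂ)

/-- The coefficient of `z ^ j` in `q_z ^ k (q_z - 1) ^ i`. -/
def sqCoeff (k i j : ℤ) : ℂ := (qz ^ k * (qz - 1) ^ i).coeff j

theorem order_zpow_laurent {x : LaurentSeries ℂ} (hx : x ≠ 0) (n : ℤ) :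
    (x ^ n).order = n * x.order := by
  have hinv : ∀ y : LaurentSeries ℂ, y ≠ 0 → (y⁻¹).order = -y.order := fun y hy => by
    have h := HahnSeries.order_mul hy (inv_ne_zero hy)
    rw [mul_inv_cancel₀ hy, HahnSeries.order_one] at h
    omega
  cases n with
  | ofNat m => simp [HahnSeries.order_pow]
  | negSucc m =>
    rw [zpow_negSucc, hinv _ (pow_ne_zero _ hx), HahnSeries.order_pow, Int.negSucc_eq]
    push_cast [nsmul_eq_mul]
    ring

theorem qz_coeff (n : ℕ) : qz.coeff n = 1 / (n.factorial : ℂ) := by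
  simp [qz, PowerSeries.coeff_exp]

theorem qz_coeff_neg {n : ℤ} (h : n < 0) : qz.coeff n = 0 := by
  simp [qz, PowerSeries.coeff_coe, h]

theorem qz_ne_zero : qz ≠ 0 := fun h => by
  have := qz_coeff 0
  simp [h] at this

theorem qz_order : qz.order = 0 := by
  apply le_antisymm
  · exact HahnSeries.order_le_of_coeff_ne_zero (by simpa using (qz_coeff 0).trans_ne (by simp))
  · by_contra h
    push Not at h
    exact HahnSeries.coeff_order_eq_zero.not.mpr qz_ne_zero (qz_coeff_neg h)

theorem qz_sub_one_coeff_one : (qz - 1).coeff 1 = 1 := by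
  have := qz_coeff 1
  rw [HahnSeries.coeff_sub, HahnSeries.coeff_one]
  simpa using this

theorem qz_sub_one_ne_zero : qz - 1 ≠ 0 := fun h => by
  have := qz_sub_one_coeff_one
  simp [h] at this

theorem qz_sub_one_order : 1 ≤ (qz - 1).order := by
  by_contra h
  push Not at h
  apply HahnSeries.coeff_order_eq_zero.not.mpr qz_sub_one_ne_zero
  rw [HahnSeries.coeff_sub, HahnSeries.coeff_one]
  rcases lt_or_eq_of_le (Int.lt_add_one_iff.mp (by simpa using h) : (qz - 1).order ≤ 0) with h0 | h0
  · rw [qz_coeff_neg h0, if_neg h0.ne]; simp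
  · rw [h0]; simpa [sub_eq_zero] using qz_coeff 0

theorem qz_sub_one_order' : (qz - 1).order = 1 :=
  le_antisymm (HahnSeries.order_le_of_coeff_ne_zero (by simp [qz_sub_one_coeff_one]))
    qz_sub_one_order

theorem sqCoeff_eq_zero {k i j : ℤ} (h : j < i) : sqCoeff k i j = 0 := by
  apply HahnSeries.coeff_eq_zero_of_lt_order
  rw [HahnSeries.order_mul (zpow_ne_zero _ qz_ne_zero) (zpow_ne_zero _ qz_sub_one_ne_zero),
    order_zpow_laurent qz_ne_zero, order_zpow_laurent qz_sub_one_ne_zero, qz_order,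
    qz_sub_one_order']
  simpa using h

/-! ## Vertex operator algebra data -/

/-- The data `(V, Y, 𝟏, ω)` of a vertex operator algebra of central charge `c`, together with
its grading `V = ⨁ V_n`. -/
structure VOAData (V : Type*) [AddCommGroup V] [Module ℂ V] where
  grade : ℤ → Submodule ℂ V
  decomposition : DirectSum.Decomposition grade
  Y : V →ₗ[ℂ] VertexOperator ℂ V
  vac : V
  omega : V
  c : ℂ

namespace VOAData

variable {V : Type*} [AddCommGroup V] [Module ℂ V] (X : VOAData V)

/-- The projection of `V` onto its homogeneous subspace `V_n`. -/
def proj (n : ℤ) : V →ₗ[ℂ] X.grade n :=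
  letI := X.decomposition
  DirectSum.component ℂ ℤ (fun i => X.grade i) n ∘ₗ
    (DirectSum.decomposeLinearEquiv X.grade).toLinearMap

/-- The linear map `v ↦ ∑ₖ F k vₖ`, where `vₖ ∈ V_k` are the homogeneous components of `v`. -/
def sumHomogeneous {W : Type*} [AddCommGroup W] [Module ℂ W] (F : ℤ → V →ₗ[ℂ] W) : V →ₗ[ℂ] W :=
  letI := X.decomposition
  DirectSum.toModule ℂ ℤ W (fun k => F k ∘ₗ (X.grade k).subtype) ∘ₗ
    (DirectSum.decomposeLinearEquiv X.grade).toLinearMap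

/-- The zero mode `o(v)`: it is `v_{k-1}` for `v ∈ V_k`, and is extended additively to `V`. -/
def zeroMode : V →ₗ[ℂ] Module.End ℂ V :=
  X.sumHomogeneous fun k => (LinearMap.proj (k - 1)).comp (VertexOperator.ncoeff.comp X.Y)

/-- `Tr_{V_n} o(v)`. (The operator `o(v)` maps `V_n` to itself.) -/
def zeroModeTrace (v : V) (n : ℤ) : ℂ :=
  LinearMap.trace ℂ (X.grade n) (X.proj n ∘ₗ X.zeroMode v ∘ₗ (X.grade n).subtype)

/-- The `n`-th term `Tr_{V_n} o(v) q^{n - c/24}`, `q = e^{2 π i τ}`, of the genus one one-point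
function. -/
def onePointTerm (v : V) (τ : UpperHalfPlane) (n : ℤ) : ℂ :=
  X.zeroModeTrace v n * Complex.exp (2 * Real.pi * Complex.I * (τ : ℂ) * ((n : ℂ) - X.c / 24))

/-- The genus one one-point function `Z^{(1)}(v, τ) = Tr_V o(v) q^{L_0 - c/24}`. -/
def onePoint (v : V) (τ : UpperHalfPlane) : ℂ := ∑' n : ℤ, X.onePointTerm v τ n

/-- The field `q_z^k Y(v, q_z - 1)`, expanded in powers of `z`: if `Y(v, w) = ∑ v_i w^(-i-1)`, its
`m`-th mode is the coefficient of `z^(-m-1)` in `∑ v_i q_z^k (q_z - 1)^(-i-1)`. -/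
def sqFieldAux (k : ℤ) (v : V) : VertexOperator ℂ V :=
  fieldOfModes
    (fun m => locallyFiniteSum
      (fun i : ℤ => sqCoeff k (-i - 1) (-m - 1) • (X.Y v).ncoeff i)
      fun x => by
        obtain ⟨N, hN⟩ := exists_truncation (X.Y v) x
        refine (Set.finite_Icc m N).subset fun i hi => ?_
        rw [Function.mem_support] at hi
        constructor
        · by_contra hlt
          exact hi (by rw [sqCoeff_eq_zero (by omega), zero_smul, LinearMap.zero_apply])
        · by_contra hlt
          exact hi (by rw [LinearMap.smul_apply, hN i (by omega), smul_zero]))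
    fun x => by
      obtain ⟨N, hN⟩ := exists_truncation (X.Y v) x
      refine ⟨N, fun m hm => ?_⟩
      refine (finsum_congr fun i => ?_).trans finsum_zero
      rw [LinearMap.smul_apply]
      rcases lt_or_ge i m with hi | hi
      · rw [sqCoeff_eq_zero (by omega), zero_smul]
      · rw [hN i (by omega), smul_zero]

theorem ncoeff_sqFieldAux (k : ℤ) (v : V) (m : ℤ) (x : V) :
    (X.sqFieldAux k v).ncoeff m x =
      ∑ᶠ i : ℤ, sqCoeff k (-i - 1) (-m - 1) • (X.Y v).ncoeff i x := by
  rw [sqFieldAux, ncoeff_fieldOfModes]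
  rfl

theorem finite_sqFieldAux (k : ℤ) (v : V) (m : ℤ) (x : V) :
    (Function.support fun i : ℤ =>
      sqCoeff k (-i - 1) (-m - 1) • (X.Y v).ncoeff i x).Finite := by
  obtain ⟨N, hN⟩ := exists_truncation (X.Y v) x
  refine (Set.finite_Icc m N).subset fun i hi => ?_
  rw [Function.mem_support] at hi
  constructor
  · by_contra hlt
    exact hi (by rw [sqCoeff_eq_zero (by omega), zero_smul])
  · by_contra hlt
    exact hi (by rw [hN i (by omega), smul_zero])

theorem field_ext {A B : VertexOperator ℂ V} (h : ∀ n x, A.ncoeff n x = B.ncoeff n x) : A = B := by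
  apply HVertexOperator.coeff_inj
  funext n
  ext x
  rw [VertexOperator.coeff_eq_ncoeff, VertexOperator.coeff_eq_ncoeff]
  exact h _ _

/-- The field `q_z^k Y(v, q_z - 1)` as a linear function of `v`. -/
def sqFieldLinear (k : ℤ) : V →ₗ[ℂ] VertexOperator ℂ V where
  toFun v := X.sqFieldAux k v
  map_add' u v := by
    refine field_ext fun m x => ?_
    rw [map_add, Pi.add_apply, LinearMap.add_apply, ncoeff_sqFieldAux, ncoeff_sqFieldAux,
      ncoeff_sqFieldAux, ← finsum_add_distrib (X.finite_sqFieldAux k u m x)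
        (X.finite_sqFieldAux k v m x)]
    refine finsum_congr fun i => ?_
    rw [map_add, map_add, Pi.add_apply, LinearMap.add_apply, smul_add]
  map_smul' a v := by
    refine field_ext fun m x => ?_
    rw [map_smul, Pi.smul_apply, LinearMap.smul_apply, ncoeff_sqFieldAux, ncoeff_sqFieldAux,
      RingHom.id_apply, smul_finsum' a (X.finite_sqFieldAux k v m x)]
    refine finsum_congr fun i => ?_
    rw [map_smul, map_smul, Pi.smul_apply, LinearMap.smul_apply, smul_comm]

/-- The square bracket state-field correspondence `Y[v, z] = Y(q_z^{L_0} v, q_z - 1)`, so that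
`Y[v, z] = q_z^k Y(v, q_z - 1)` for `v ∈ V_k`. -/
def sqY : V →ₗ[ℂ] VertexOperator ℂ V := X.sumHomogeneous X.sqFieldLinear

/-- The square bracket conformal vector `ω̃ = ω - (c/24) 𝟏`. -/
def sqOmega : V := X.omega - (X.c / 24) • X.vac

/-- The space `V_[r] = {u | L[0] u = r u}` of vectors of square bracket weight `r`. -/
def sqWeightSpace (r : ℕ) : Submodule ℂ V := weightSpace X.sqY X.sqOmega r

/-- `B` is the Li–Zamolodchikov metric of the square bracket vertex operator algebra
`(V, Y[ , ], 𝟏, ω̃)`. -/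
def IsSqLiZMetric (B : LinearMap.BilinForm ℂ V) : Prop := IsLiZMetric X.sqY X.vac X.sqOmega B

/-- The genus two partition function, a formal power series in `ε`,
`Z^{(2)}(τ₁, τ₂, ε) = ∑_{r ≥ 0} ε^r ∑_{u ∈ V_[r]} Z^{(1)}(u, τ₁) Z^{(1)}(ū, τ₂)`,
where `u` runs over a basis of `V_[r]` and `ū` over the dual basis. -/
def genusTwoPartition {ι : ℕ → Type*} [∀ r, Fintype (ι r)]
    (u ubar : ∀ r, ι r → X.sqWeightSpace r) (τ₁ τ₂ : UpperHalfPlane) : PowerSeries ℂ :=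
  PowerSeries.mk fun r => ∑ i, X.onePoint (u r i : V) τ₁ * X.onePoint (ubar r i : V) τ₂

end VOAData

/-! ## The rank one Heisenberg vertex operator algebra

The Fock space `M_0` is realized as `ℂ[x_1, x_2, …]`, with `x_n` in the role of `a_{-n} 𝟏`; thus
the monomial `∏ x_i ^ e_i` is the Fock vector `∏ a_{-i} ^ e_i 𝟏`. -/

/-- The Fock space of the rank one Heisenberg algebra. -/
abbrev Fock : Type := MvPolynomial ℕ+ ℂ

/-- The Heisenberg mode `a_n`: multiplication by `x_{-n}` if `n < 0`, zero if `n = 0`, and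
`n ∂/∂x_n` if `n > 0`. Thus `[a_m, a_n] = m δ_{m+n,0}`. -/
def heisMode (n : ℤ) : Module.End ℂ Fock :=
  if n < 0 then LinearMap.mulLeft ℂ (X (-n).toNat.toPNat' : Fock)
  else if 0 < n then (n : ℂ) • ((pderiv n.toNat.toPNat').toLinearMap : Fock →ₗ[ℂ] Fock)
  else 0

theorem heisMode_truncation (g : Fock) : ∃ N : ℤ, ∀ n, N < n → heisMode n g = 0 := by
  refine ⟨((g.vars.sup fun i : ℕ+ => (i : ℕ)) : ℕ), fun n hn => ?_⟩
  rw [heisMode, if_neg (by omega), if_pos (by omega)]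
  have hv : n.toNat.toPNat' ∉ g.vars := fun hmem => by
    have h1 := Finset.le_sup (f := fun i : ℕ+ => (i : ℕ)) hmem
    have h2 := PNat.toPNat'_coe (n := n.toNat) (by omega)
    omega
  show (n : ℂ) • pderiv n.toNat.toPNat' g = 0
  rw [pderiv_eq_zero_of_notMem_vars hv, smul_zero]

/-- The `i`-th term of the associator formula for the `n`-th mode of `(a_{-m} w)(z)`, where `w` is a
state with field `W`. -/
def heisAssocTerm (m : ℕ+) (W : VertexOperator ℂ Fock) (n : ℤ) (i : ℕ) : Module.End ℂ Fock :=
  ((-1 : ℂ) ^ i * (Ring.choose (-(m : ℤ)) i : ℤ)) •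
    (heisMode (-(m : ℤ) - i) * W.ncoeff (n + i)
      - (-1 : ℂ) ^ (m : ℕ) • (W.ncoeff (n - (m : ℤ) - i) * heisMode i))

theorem heisAssocTerm_finite (m : ℕ+) (W : VertexOperator ℂ Fock) (n : ℤ) (g : Fock) :
    (Function.support fun i => heisAssocTerm m W n i g).Finite := by
  obtain ⟨N, hN⟩ := exists_truncation W g
  obtain ⟨M, hM⟩ := heisMode_truncation g
  refine (Set.finite_Iic (max (N - n).toNat M.toNat)).subset fun i hi => ?_
  rw [Set.mem_Iic]
  by_contra hlt
  refine hi ?_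
  show heisAssocTerm m W n i g = 0
  rw [heisAssocTerm, LinearMap.smul_apply, LinearMap.sub_apply, LinearMap.smul_apply,
    Module.End.mul_apply, Module.End.mul_apply, hN _ (by omega), hM _ (by omega), map_zero,
    map_zero, smul_zero, sub_zero, smul_zero]

theorem heisAssocTerm_truncation (m : ℕ+) (W : VertexOperator ℂ Fock) (g : Fock) :
    ∃ N : ℤ, ∀ n, N < n → ∀ i, heisAssocTerm m W n i g = 0 := by
  obtain ⟨N, hN⟩ := exists_truncation W g
  obtain ⟨M, hM⟩ := heisMode_truncation g
  choose K hK using fun i : ℕ => exists_truncation W (heisMode i g)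
  refine ⟨max N ((m : ℤ) + ∑ i ∈ Finset.range (M.toNat + 1), (|K i| + i)), fun n hn i => ?_⟩
  have h1 : W.ncoeff (n + i) g = 0 := hN _ (by omega)
  have h2 : W.ncoeff (n - (m : ℤ) - i) (heisMode i g) = 0 := by
    rcases le_or_gt i M.toNat with hi | hi
    · refine hK i _ ?_
      have := Finset.single_le_sum (f := fun i : ℕ => |K i| + (i : ℤ)) (fun j _ => by positivity)
        (Finset.mem_range.mpr (by omega : i < M.toNat + 1))
      have h3 := le_abs_self (K i)
      omega
    · rw [hM _ (by omega), map_zero]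
  rw [heisAssocTerm, LinearMap.smul_apply, LinearMap.sub_apply, LinearMap.smul_apply,
    Module.End.mul_apply, Module.End.mul_apply, h1, h2, map_zero, smul_zero, sub_zero, smul_zero]

/-- The field of `a_{-m} w`, where `w` is a state with field `W`. It is the normally ordered product
`(1/(m-1)!) :∂^{m-1} a(z) W(z):` of `W` with a derivative of the Heisenberg field
`a(z) = ∑ a_n z^(-n-1)`, and its modes are given by the associator formula
`(a_{-m} w)_n = ∑_{i ≥ 0} (-1)^i binom(-m, i) (a_{-m-i} w_{n+i} - (-1)^m w_{n-m-i} a_i)`. -/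
def heisNormalProduct (m : ℕ+) (W : VertexOperator ℂ Fock) : VertexOperator ℂ Fock :=
  fieldOfModes (fun n => locallyFiniteSum (heisAssocTerm m W n) (heisAssocTerm_finite m W n))
    fun g => by
      obtain ⟨N, hN⟩ := heisAssocTerm_truncation m W g
      exact ⟨N, fun n hn => (finsum_congr fun i => hN n hn i).trans finsum_zero⟩

/-- The Heisenberg state-field correspondence: for `m_1 ≤ … ≤ m_k`, the field of the Fock vector
`a_{-m_1} ⋯ a_{-m_k} 𝟏` is the normally ordered product of the fields
`(1/(m_j-1)!) ∂^{m_j-1} a(z)`. -/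
def heisY : Fock →ₗ[ℂ] VertexOperator ℂ Fock :=
  (basisMonomials ℕ+ ℂ).constr ℂ fun e => (e.toMultiset.sort (· ≤ ·)).foldr heisNormalProduct idField

/-- The rank one Heisenberg vertex operator algebra `M_0`: the vacuum is `1`, the conformal vector
is `ω = (1/2) a_{-1}^2 𝟏`, the central charge is `1`, and `a_{-i}` raises the weight by `i`. -/
def heisenberg : VOAData Fock where
  grade := weightedHomogeneousSubmodule ℂ fun i : ℕ+ => ((i : ℕ) : ℤ)
  decomposition := weightedDecomposition ℂ fun i : ℕ+ => ((i : ℕ) : ℤ)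
  Y := heisY
  vac := 1
  omega := (1 / 2 : ℂ) • (X 1) ^ 2
  c := 1

/-! ## The infinite matrices `A_a` and the determinant of `I - A_1 A_2` -/

/-- The Eisenstein series `E_k(τ) = -B_k/k! + (2/(k-1)!) ∑_{n ≥ 1} σ_{k-1}(n) q^n` for even
`k ≥ 2`; it is zero for odd `k`. -/
def eisenstein (k : ℕ) (τ : UpperHalfPlane) : ℂ :=
  if Even k then
    -((bernoulli k : ℚ) : ℂ) / (k.factorial : ℂ) + 2 / ((k - 1).factorial : ℂ) *
      ∑' n : ℕ+, (ArithmeticFunction.sigma (k - 1) (n : ℕ) : ℂ) *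
        Complex.exp (2 * Real.pi * Complex.I * (τ : ℂ) * ((n : ℕ) : ℂ))
  else 0

/-- `C(k, l, τ) = (-1)^{l+1} (k+l-1)! / ((k-1)! (l-1)!) E_{k+l}(τ)`. -/
def matC (k l : ℕ+) (τ : UpperHalfPlane) : ℂ :=
  (-1) ^ ((l : ℕ) + 1) * (((k + l - 1 : ℕ).factorial : ℂ) /
    (((k - 1 : ℕ).factorial : ℂ) * ((l - 1 : ℕ).factorial : ℂ))) * eisenstein (k + l) τ

/-- Matrices indexed by the positive integers over `ℂ[[s]]`, where `s = ε^{1/2}`. -/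
abbrev InfMatrix : Type := ℕ+ → ℕ+ → PowerSeries ℂ

namespace InfMatrix

/-- The product of two infinite matrices; the infinite sums of power series are formed
coefficientwise. -/
def mul (M N : InfMatrix) : InfMatrix := fun k l =>
  PowerSeries.mk fun d => ∑ᶠ j : ℕ+, PowerSeries.coeff d (M k j * N j l)

/-- The identity matrix. -/
def one : InfMatrix := fun k l => if k = l then 1 else 0

/-- Powers of an infinite matrix. -/
def pow (M : InfMatrix) : ℕ → InfMatrix
  | 0 => one
  | n + 1 => mul (pow M n) M

/-- The trace of an infinite matrix, formed coefficientwise. -/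
def trace (M : InfMatrix) : PowerSeries ℂ :=
  PowerSeries.mk fun d => ∑ᶠ k : ℕ+, PowerSeries.coeff d (M k k)

/-- `log det (I - M) = Tr log (I - M) = - ∑_{n ≥ 1} (1/n) Tr (M^n)`, formed coefficientwise. -/
def logDetOneSub (M : InfMatrix) : PowerSeries ℂ :=
  PowerSeries.mk fun d => -∑ᶠ n : ℕ+, (1 / ((n : ℕ) : ℂ)) * PowerSeries.coeff d (trace (pow M n))

/-- `det (I - M) = exp (log det (I - M))`. -/
def detOneSub (M : InfMatrix) : PowerSeries ℂ :=
  (PowerSeries.exp ℂ).subst (logDetOneSub M)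

end InfMatrix

/-- `D^{-1/2}` for a power series `D` with constant term `1`, by the binomial series
`(1 + x)^{-1/2}` at `x = D - 1`. -/
def invSqrt (D : PowerSeries ℂ) : PowerSeries ℂ :=
  (PowerSeries.binomialSeries ℂ (-1 / 2 : ℚ)).subst (D - 1)

/-- The matrix `A(k, l, τ, ε) = ε^{(k+l)/2} / √(k l) · C(k, l, τ)`, where `ε^{1/2}` is the
variable of the power series. -/
def matA (τ : UpperHalfPlane) : InfMatrix := fun k l =>
  PowerSeries.monomial ((k : ℕ) + l) ((1 / ((Real.sqrt ((k : ℝ) * (l : ℝ)) : ℝ) : ℂ)) * matC k l τ)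

end GenusTwoBoson

end

noncomputable section

namespace GenusTwoBoson

open MvPolynomial Filter

/-! ## Laurent series: the Euler operator and expansions in powers of `e^z - 1` -/

/-! In the square bracket algebra the vectors `a[-i_1] ⋯ a[-i_k] 𝟏` form an orthogonal basis, and
their one-point functions on a torus obey a Wick recursion. The genus two partition function is
therefore a Gaussian sum over occupation numbers, and such a sum equals a determinant to the power
`-1/2`.

Put `w = e^z - 1`. The mode `a[n]` is the combination of the `a_i` whose coefficients are those of
`z^n` expanded in powers of `w` (`modeCoeff_eq_expCoeff`). Facts about square bracket modes thus
become residue identities: the `a[n]` satisfy the Heisenberg relations (`sqMode_commutator`), `L[0]`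
grades them (`sqVirasoro_commutator`), and the adjoint of `a[n]` is `-a[-n]` (`sqMode_adjoint`).
Consequently the metric is diagonal on Fock vectors, with squares `∏ (-i)^{e_i} e_i!`
(`metric_monomial`), and any pair of dual bases may be replaced by these vectors
(`sum_dualBasis_eq`).

The Wick recursion is Zhu's (`traceSeries_sqMode_neg`). The zero mode of `a_{-m} v` is a sum of
products of one `a_k` with one mode of `v`. Moving `a_k` cyclically around the trace shifts the
degree by `k`, and the commutator formula measures the difference, which produces factors `q^k / (1
- q^k)`. Passing to square bracket modes turns the binomial coefficients into powers of `k`, whence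
the divisor sums of Eisenstein series; the annihilation part of `a[-n-1]` supplies their Bernoulli
constants. The recursion starts from the graded dimension, which gives `1 / η`, and also proves
convergence by induction on the weight.

For the Gaussian sum `g`, let `h` and `κ` be the suitably rescaled matrices of sums in which one
extra mode is inserted on each torus, respectively two on the second torus. Wick's recursion says `h
= -A₁ κ` and `κ = g A₂ - A₂ h`, so `h = -g ∑_{i ≥ 1} (A₁ A₂)^i` (`eq_neg_sum_pow`). The derivative
`ε dg/dε` is, up to sign, the trace of `h` against the weights; comparison with the derivative of
`log det (I - A₁ A₂)` gives `g' / g = -1/2 (log det)'` (`euler_expandTwo_amplitudeSeries`). Together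
with the constant term `1` this determines `g` (`eq_invSqrt_exp`). Infinite matrices are handled
modulo `s^(N+1)`, where their `N × N` blocks suffice. -/

theorem coeff_C_mul (c : ℂ) (f : LaurentSeries ℂ) (n : ℤ) :
    (HahnSeries.C c * f).coeff n = c * f.coeff n := by
  rw [HahnSeries.C_mul_eq_smul, HahnSeries.coeff_smul, smul_eq_mul]

/-- The Euler operator `z d/dz` on Laurent series. -/
def laurentEuler : LaurentSeries ℂ →+ LaurentSeries ℂ where
  toFun f :=
    { coeff := fun n => (n : ℂ) * f.coeff n
      isPWO_support' := f.isPWO_support.mono fun n hn => by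
        rw [Function.mem_support] at hn
        exact right_ne_zero_of_mul hn }
  map_zero' := by
    ext n
    simp
  map_add' f g := by
    ext n
    simp [mul_add]

theorem laurentEuler_coeff (f : LaurentSeries ℂ) (n : ℤ) :
    (laurentEuler f).coeff n = (n : ℂ) * f.coeff n := rfl

theorem laurentEuler_mul (f g : LaurentSeries ℂ) :
    laurentEuler (f * g) = laurentEuler f * g + f * laurentEuler g := by
  have hs : ∀ f : LaurentSeries ℂ, (laurentEuler f).support ⊆ f.support := fun f n hn => by
    rw [HahnSeries.mem_support, laurentEuler_coeff] at hn
    exact right_ne_zero_of_mul hn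
  ext n
  rw [HahnSeries.coeff_add, HahnSeries.coeff_mul_left' f.isPWO_support (hs f),
    HahnSeries.coeff_mul_right' g.isPWO_support (hs g), ← Finset.sum_add_distrib,
    laurentEuler_coeff, HahnSeries.coeff_mul, Finset.mul_sum]
  refine Finset.sum_congr rfl fun ij hij => ?_
  have h : ij.1 + ij.2 = n := (Finset.mem_antidiagonal.mp hij).2.2
  rw [laurentEuler_coeff, laurentEuler_coeff, ← h]
  push_cast
  ring

theorem laurentEuler_one : laurentEuler 1 = 0 := by
  ext n
  rw [laurentEuler_coeff, HahnSeries.coeff_one]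
  split_ifs with h
  · simp [h]
  · simp

theorem laurentEuler_zpow {f : LaurentSeries ℂ} (hf : f ≠ 0) (k : ℤ) :
    laurentEuler (f ^ k) = HahnSeries.C (k : ℂ) * (f ^ (k - 1) * laurentEuler f) := by
  have hstep : ∀ k : ℤ, laurentEuler (f ^ (k + 1)) = laurentEuler (f ^ k) * f +
      f ^ k * laurentEuler f := fun k => by rw [zpow_add_one₀ hf, laurentEuler_mul]
  have hf' : ∀ k : ℤ, f ^ (k - 1) * f = f ^ k := fun k => by
    rw [← zpow_add_one₀ hf, sub_add_cancel]
  induction k using Int.induction_on with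
  | zero => simp [laurentEuler_one]
  | succ i ih =>
    rw [hstep, ih, add_sub_cancel_right, ← hf' i]
    push_cast
    rw [map_add, map_one]
    ring
  | pred i ih =>
    have h := hstep (-(i : ℤ) - 1)
    rw [sub_add_cancel, ih] at h
    apply mul_right_cancel₀ hf
    rw [mul_assoc, mul_right_comm, hf', Int.cast_sub, map_sub, Int.cast_one, map_one]
    linear_combination -h

/-- `f = O(z^N)`. -/
def VanishBelow (N : ℤ) (f : LaurentSeries ℂ) : Prop := ∀ n < N, f.coeff n = 0

namespace VanishBelow

variable {M N : ℤ} {f g : LaurentSeries ℂ}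

theorem mono (hf : VanishBelow M f) (h : N ≤ M) : VanishBelow N f := fun n hn => hf n (by omega)

theorem sub (hf : VanishBelow N f) (hg : VanishBelow N g) : VanishBelow N (f - g) := fun n hn => by
  rw [HahnSeries.coeff_sub, hf n hn, hg n hn, sub_zero]

theorem C_mul (c : ℂ) (hf : VanishBelow N f) : VanishBelow N (HahnSeries.C c * f) := fun n hn => by
  rw [coeff_C_mul, hf n hn, mul_zero]

theorem mul (hf : VanishBelow M f) (hg : VanishBelow N g) : VanishBelow (M + N) (f * g) :=
  fun n hn => by
    rw [HahnSeries.coeff_mul]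
    refine Finset.sum_eq_zero fun ij hij => ?_
    have h : ij.1 + ij.2 = n := (Finset.mem_antidiagonal.mp hij).2.2
    rcases lt_or_ge ij.1 M with h1 | h1
    · rw [hf _ h1, zero_mul]
    · rw [hg _ (by omega), mul_zero]

theorem coeff_mul (hf : VanishBelow M f) (hg : VanishBelow N g) :
    (f * g).coeff (M + N) = f.coeff M * g.coeff N := by
  rw [HahnSeries.coeff_mul]
  refine Finset.sum_eq_single (M, N) (fun ij hij hne => ?_) fun hn => ?_
  · have h : ij.1 + ij.2 = M + N := (Finset.mem_antidiagonal.mp hij).2.2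
    rcases lt_trichotomy ij.1 M with h1 | h1 | h1
    · rw [hf _ h1, zero_mul]
    · exact absurd (Prod.ext h1 (by change ij.2 = N; omega)) hne
    · rw [hg _ (by omega), mul_zero]
  · by_contra hne
    exact hn (Finset.mem_antidiagonal.mpr
      ⟨left_ne_zero_of_mul hne, right_ne_zero_of_mul hne, rfl⟩)

theorem euler (hf : VanishBelow N f) : VanishBelow N (laurentEuler f) := fun n hn => by
  rw [laurentEuler_coeff, hf n hn, mul_zero]

theorem of_order (h : N ≤ f.order) : VanishBelow N f := fun n hn =>
  HahnSeries.coeff_eq_zero_of_lt_order (by omega)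

end VanishBelow

/-- `e^z - 1`. -/
def expSubOne : LaurentSeries ℂ := qz - 1

theorem expSubOne_ne_zero : expSubOne ≠ 0 := qz_sub_one_ne_zero

theorem qz_eq : qz = 1 + expSubOne := by rw [expSubOne]; ring

theorem vanishBelow_qz_zpow (k : ℤ) : VanishBelow 0 (qz ^ k) :=
  .of_order (by rw [order_zpow_laurent qz_ne_zero, qz_order, mul_zero])

theorem vanishBelow_expSubOne_zpow (k : ℤ) : VanishBelow k (expSubOne ^ k) :=
  .of_order (by rw [expSubOne, order_zpow_laurent qz_sub_one_ne_zero, qz_sub_one_order', mul_one])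

theorem expSubOne_zpow_coeff_self (k : ℤ) : (expSubOne ^ k).coeff k = 1 := by
  have h1 : expSubOne.coeff 1 = 1 := qz_sub_one_coeff_one
  have hstep : ∀ k : ℤ, (expSubOne ^ (k + 1)).coeff (k + 1) = (expSubOne ^ k).coeff k := fun k => by
    have := (vanishBelow_expSubOne_zpow k).coeff_mul (vanishBelow_expSubOne_zpow 1)
    rw [← zpow_add₀ expSubOne_ne_zero, zpow_one, h1, mul_one] at this
    exact this
  induction k using Int.induction_on with
  | zero => simp
  | succ i ih => rw [hstep, ih]
  | pred i ih => rw [← ih, ← hstep, sub_add_cancel]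

theorem euler_qz : laurentEuler qz = HahnSeries.single 1 1 * qz := by
  ext n
  rw [laurentEuler_coeff, HahnSeries.coeff_single_mul, one_mul]
  rcases lt_trichotomy n 0 with h | h | h
  · rw [qz_coeff_neg h, qz_coeff_neg (by omega), mul_zero]
  · subst h
    rw [qz_coeff_neg (n := 0 - 1) (by norm_num), Int.cast_zero, zero_mul]
  · obtain ⟨m, rfl⟩ : ∃ m : ℕ, n = ((m + 1 : ℕ) : ℤ) := ⟨(n - 1).toNat, by omega⟩
    rw [qz_coeff, show ((m + 1 : ℕ) : ℤ) - 1 = (m : ℤ) by push_cast; ring, qz_coeff,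
      Nat.factorial_succ]
    have : (m.factorial : ℂ) ≠ 0 := by exact_mod_cast m.factorial_ne_zero
    have h2 : ((m : ℂ) + 1) ≠ 0 := by exact_mod_cast m.succ_ne_zero
    push_cast
    field_simp

theorem euler_expSubOne : laurentEuler expSubOne = HahnSeries.single 1 1 * qz := by
  rw [expSubOne, map_sub, euler_qz, laurentEuler_one, sub_zero]

theorem vanishBelow_euler_expSubOne : VanishBelow 1 (laurentEuler expSubOne) := by
  have := (vanishBelow_expSubOne_zpow 1).euler
  rwa [zpow_one] at this

theorem euler_expSubOne_zpow (k : ℤ) : laurentEuler (expSubOne ^ k) =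
    HahnSeries.C (k : ℂ) * (expSubOne ^ (k - 1) * laurentEuler expSubOne) :=
  laurentEuler_zpow expSubOne_ne_zero k

/-- Constant terms stand in for residues: with `θ = z d/dz` and `w = e^z - 1`, the constant term of
`f · θw` is the residue of `f dw`. For `k ≠ 0` the form `w^(k-1) dw` is exact, as `θ(w^k)` has no
constant term; for `k = 0` it is `dw / w` at a simple zero of `w`. -/
theorem coeff_zero_zpow_mul_euler (k : ℤ) :
    (expSubOne ^ (k - 1) * laurentEuler expSubOne).coeff 0 = if k = 0 then 1 else 0 := by
  split_ifs with h
  · subst h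
    have := (vanishBelow_expSubOne_zpow (0 - 1)).coeff_mul vanishBelow_euler_expSubOne
    rw [expSubOne_zpow_coeff_self, one_mul, laurentEuler_coeff] at this
    simpa [expSubOne, qz_sub_one_coeff_one] using this
  · have := congrArg (fun f => f.coeff 0) (euler_expSubOne_zpow k)
    simp only [laurentEuler_coeff, Int.cast_zero, zero_mul, coeff_C_mul] at this
    exact (mul_eq_zero.mp this.symm).resolve_left (by exact_mod_cast h)

/-- The coefficient of `(e^z - 1)^i` in the expansion of `g` in powers of `e^z - 1`. -/
def expCoeff (g : LaurentSeries ℂ) (i : ℤ) : ℂ :=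
  (g * (expSubOne ^ (-i - 1) * laurentEuler expSubOne)).coeff 0

theorem vanishBelow_zpow_mul_euler (i : ℤ) :
    VanishBelow (i + 1) (expSubOne ^ i * laurentEuler expSubOne) :=
  (vanishBelow_expSubOne_zpow i).mul vanishBelow_euler_expSubOne

theorem expCoeff_eq_zero {g : LaurentSeries ℂ} {m i : ℤ} (hg : VanishBelow m g) (h : i < m) :
    expCoeff g i = 0 :=
  hg.mul (vanishBelow_zpow_mul_euler (-i - 1)) 0 (by omega)

/-- The residue pairing kills the powers of `w` already subtracted, so it reads off the leading
coefficient of the remainder. Since `w^(m+N)` has leading coefficient `1`, subtracting the next term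
raises the order by one. -/
theorem expCoeff_expansion {g : LaurentSeries ℂ} {m : ℤ} (hg : VanishBelow m g) (N : ℕ) :
    VanishBelow (m + N) (g - ∑ i ∈ Finset.Ico m (m + N), HahnSeries.C (expCoeff g i) * expSubOne ^ i) := by
  induction N with
  | zero => simpa using hg
  | succ N ih =>
    set r := g - ∑ i ∈ Finset.Ico m (m + N), HahnSeries.C (expCoeff g i) * expSubOne ^ i with hr
    have h1 : expCoeff r (m + N) = expCoeff g (m + N) := by
      rw [hr, expCoeff, sub_mul, HahnSeries.coeff_sub, ← expCoeff, Finset.sum_mul,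
        HahnSeries.coeff_sum, Finset.sum_eq_zero, sub_zero]
      intro i hi
      rw [mul_assoc, coeff_C_mul, ← mul_assoc, ← zpow_add₀ expSubOne_ne_zero,
        show i + (-(m + N) - 1) = (i - (m + N)) - 1 by ring, coeff_zero_zpow_mul_euler, if_neg,
        mul_zero]
      rw [Finset.mem_Ico] at hi
      omega
    have h2 : expCoeff r (m + N) = r.coeff (m + N) := by
      have := ih.coeff_mul (vanishBelow_zpow_mul_euler (-(m + N) - 1))
      rw [show m + (N : ℤ) + (-(m + N) - 1 + 1) = 0 by ring,
        (vanishBelow_expSubOne_zpow _).coeff_mul vanishBelow_euler_expSubOne,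
        expSubOne_zpow_coeff_self, laurentEuler_coeff, expSubOne, qz_sub_one_coeff_one, Int.cast_one,
        mul_one, mul_one, mul_one] at this
      exact this
    have h3 : g - ∑ i ∈ Finset.Ico m (m + (N + 1 : ℕ)), HahnSeries.C (expCoeff g i) * expSubOne ^ i =
        r - HahnSeries.C (r.coeff (m + N)) * expSubOne ^ (m + N : ℤ) := by
      rw [show m + ((N + 1 : ℕ) : ℤ) = m + N + 1 by push_cast; ring,
        ← Finset.insert_Ico_right_eq_Ico_add_one (by omega),
        Finset.sum_insert (by simp), ← h2, h1, hr]
      abel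
    rw [h3]
    intro n hn
    rcases lt_or_eq_of_le (show n ≤ m + N by push_cast at hn; omega) with h | h
    · exact (ih.sub ((vanishBelow_expSubOne_zpow _).C_mul _)) n h
    · subst h
      rw [HahnSeries.coeff_sub, coeff_C_mul, expSubOne_zpow_coeff_self]
      simp

/-- Only `m ≤ i ≤ -p` can contribute: `g` has no terms below `w^m`, and `w^i h` has positive order
for `i > -p`. Allowing any larger finite `s` lets several expansions share one index set. -/
theorem coeff_zero_mul_eq_sum {g h : LaurentSeries ℂ} {m p : ℤ} (hg : VanishBelow m g)
    (hh : VanishBelow p h) {s : Finset ℤ} (hs : Finset.Icc m (-p) ⊆ s) :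
    (g * h).coeff 0 = ∑ i ∈ s, expCoeff g i * (expSubOne ^ i * h).coeff 0 := by
  have h1 := expCoeff_expansion hg (1 - p - m).toNat
  have h2 := (h1.mul hh) 0 (by omega)
  rw [sub_mul, HahnSeries.coeff_sub, sub_eq_zero, Finset.sum_mul, HahnSeries.coeff_sum] at h2
  simp only [mul_assoc, coeff_C_mul] at h2
  rw [h2]
  have hz : ∀ i, i < m ∨ -p < i → expCoeff g i * (expSubOne ^ i * h).coeff 0 = 0 := by
    rintro i (hi | hi)
    · rw [expCoeff_eq_zero hg hi, zero_mul]
    · rw [(vanishBelow_expSubOne_zpow i).mul hh 0 (by omega), mul_zero]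
  rw [← Finset.sum_subset hs fun i _ hi => hz i (by rw [Finset.mem_Icc] at hi; omega)]
  symm
  apply Finset.sum_subset_zero_on_sdiff
  · intro i hi
    rw [Finset.mem_Icc] at hi
    rw [Finset.mem_Ico]
    omega
  · intro i hi
    rw [Finset.mem_sdiff, Finset.mem_Ico, Finset.mem_Icc] at hi
    exact hz i (by omega)
  · exact fun _ _ => rfl

/-- Integration by parts, used twice: `θ(gh)` and `θ(w^i h)` have no constant term, so `θ` is moved
onto `h`, `g` is expanded, and `θ` is moved back onto each `w^i`. -/
theorem coeff_zero_euler_mul_eq_sum {g h : LaurentSeries ℂ} {m p : ℤ} (hg : VanishBelow m g)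
    (hh : VanishBelow p h) {s : Finset ℤ} (hs : Finset.Icc m (-p) ⊆ s) :
    (laurentEuler g * h).coeff 0 =
      ∑ i ∈ s, expCoeff g i * i * (expSubOne ^ (i - 1) * laurentEuler expSubOne * h).coeff 0 := by
  have h1 : (laurentEuler g * h).coeff 0 = -(g * laurentEuler h).coeff 0 := by
    have := laurentEuler_coeff (g * h) 0
    rw [laurentEuler_mul, HahnSeries.coeff_add, Int.cast_zero, zero_mul] at this
    linear_combination this
  rw [h1, coeff_zero_mul_eq_sum hg hh.euler hs, ← Finset.sum_neg_distrib]
  refine Finset.sum_congr rfl fun i _ => ?_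
  have := laurentEuler_coeff (expSubOne ^ i * h) 0
  rw [laurentEuler_mul, HahnSeries.coeff_add, Int.cast_zero, zero_mul, euler_expSubOne_zpow,
    mul_assoc (HahnSeries.C _), coeff_C_mul] at this
  linear_combination (-expCoeff g i) * this

/-! ## The coefficients of the square bracket modes -/

/-- The coefficient of `a_i` in the square bracket mode `a[n]`. -/
def modeCoeff (n i : ℤ) : ℂ := sqCoeff 1 (-i - 1) (-n - 1)

theorem modeCoeff_eq_zero {n i : ℤ} (h : i < n) : modeCoeff n i = 0 :=
  sqCoeff_eq_zero (by omega)

theorem vanishBelow_single (n : ℤ) : VanishBelow n (HahnSeries.single n (1 : ℂ)) := fun m hm =>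
  HahnSeries.coeff_single_of_ne (by omega)

theorem expCoeff_def (g : LaurentSeries ℂ) (i : ℤ) : expCoeff g i =
    (g * (expSubOne ^ (-i - 1) * laurentEuler expSubOne)).coeff 0 := rfl

/-- Since `θw = z e^z`, the factor `e^z` in the field `e^z Y(a, e^z - 1)` is exactly what turns its
coefficients into residues of `z^n w^(-i-1) dw`. Formally `z^n = ∑ modeCoeff n i · w^i`. -/
theorem modeCoeff_eq_expCoeff (n i : ℤ) :
    modeCoeff n i = expCoeff (HahnSeries.single n (1 : ℂ)) i := by
  rw [modeCoeff, sqCoeff, expCoeff, euler_expSubOne, HahnSeries.coeff_single_mul, one_mul,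
    mul_left_comm, HahnSeries.coeff_single_mul, one_mul, zpow_one, mul_comm, expSubOne]
  congr 1
  ring

theorem modeCoeff_self (n : ℤ) : modeCoeff n n = 1 := by
  have := (vanishBelow_single n).coeff_mul (vanishBelow_zpow_mul_euler (-n - 1))
  rw [modeCoeff_eq_expCoeff, expCoeff]
  rw [(vanishBelow_expSubOne_zpow _).coeff_mul vanishBelow_euler_expSubOne,
    expSubOne_zpow_coeff_self, laurentEuler_coeff, expSubOne, qz_sub_one_coeff_one,
    HahnSeries.coeff_single_same, show n + (-n - 1 + 1) = 0 by ring] at this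
  simpa [expSubOne] using this

theorem euler_single (n : ℤ) : laurentEuler (HahnSeries.single n (1 : ℂ)) =
    HahnSeries.C (n : ℂ) * HahnSeries.single n (1 : ℂ) := by
  ext m
  rw [laurentEuler_coeff, coeff_C_mul]
  rcases eq_or_ne m n with rfl | h
  · rfl
  · rw [HahnSeries.coeff_single_of_ne h, mul_zero, mul_zero]

/-- The sum is the residue of `z^n d(z^m)` written in the coordinate `w`. The change of coordinate
preserves it, and this is why the `a[n]` satisfy the same commutation relations as the `a_n`. -/
theorem sum_modeCoeff_mul_modeCoeff (m n : ℤ) {s : Finset ℤ} (hs : Finset.Icc m (-n) ⊆ s) :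
    ∑ i ∈ s, modeCoeff m i * modeCoeff n (-i) * (i : ℂ) = if m + n = 0 then (m : ℂ) else 0 := by
  have h := coeff_zero_euler_mul_eq_sum (vanishBelow_single m) (vanishBelow_single n) hs
  rw [euler_single, mul_assoc, coeff_C_mul, HahnSeries.single_mul_single, one_mul] at h
  have h2 : (HahnSeries.single (m + n) (1 : ℂ)).coeff 0 = if m + n = 0 then 1 else 0 := by
    split_ifs with h0
    · rw [h0, HahnSeries.coeff_single_same]
    · exact HahnSeries.coeff_single_of_ne (Ne.symm h0)
  rw [h2, mul_ite, mul_one, mul_zero] at h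
  rw [h]
  refine Finset.sum_congr rfl fun i _ => ?_
  rw [modeCoeff_eq_expCoeff m, modeCoeff_eq_expCoeff n, expCoeff_def _ (-i), neg_neg,
    mul_comm (HahnSeries.single n 1)]
  ring

/-- The coefficient of `ω_i` in the square bracket mode `L[0]`. -/
def virasoroCoeff (i : ℤ) : ℂ := sqCoeff 2 (-i - 1) (-2)

theorem virasoroCoeff_eq_zero {i : ℤ} (h : i < 1) : virasoroCoeff i = 0 :=
  sqCoeff_eq_zero (by omega)

/-- Apply `θ` to `z^n = ∑ modeCoeff n j · w^j` and compare coefficients of `w^p`: the left side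
comes from `j w^(j-1) θw`, the right side from `θ z^n = n z^n`. This is the coefficient form of
`[L[0], a[n]] = -n a[n]`. -/
theorem sum_modeCoeff_mul_virasoroCoeff (n p : ℤ) {s : Finset ℤ} (hs : Finset.Icc n p ⊆ s) :
    ∑ j ∈ s, modeCoeff n j * (j : ℂ) * virasoroCoeff (p + 1 - j) = n * modeCoeff n p := by
  have h := coeff_zero_euler_mul_eq_sum (vanishBelow_single n) (vanishBelow_zpow_mul_euler (-p - 1))
    (s := s) (by rwa [show -(-p - 1 + 1) = p by ring])
  rw [euler_single, mul_assoc, coeff_C_mul] at h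
  rw [modeCoeff_eq_expCoeff n p, expCoeff, h]
  refine Finset.sum_congr rfl fun j _ => ?_
  rw [modeCoeff_eq_expCoeff, virasoroCoeff, sqCoeff, euler_expSubOne]
  congr 1
  rw [show expSubOne ^ (j - 1) * (HahnSeries.single 1 1 * qz) *
      (expSubOne ^ (-p - 1) * (HahnSeries.single 1 1 * qz)) =
      HahnSeries.single 1 1 * HahnSeries.single 1 1 * (qz * qz *
      (expSubOne ^ (j - 1) * expSubOne ^ (-p - 1))) by ring, HahnSeries.single_mul_single,
    HahnSeries.coeff_single_mul, ← zpow_add₀ expSubOne_ne_zero, expSubOne, one_mul, one_mul,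
    ← pow_two, show j - 1 + (-p - 1) = -(p + 1 - j) - 1 by ring]
  rfl

theorem VanishBelow.coeff_zero_mul {f g : LaurentSeries ℂ} {M N : ℤ} (hf : VanishBelow M f)
    (hg : VanishBelow N g) {s : Finset ℤ} (hs : Finset.Icc M (-N) ⊆ s) :
    (f * g).coeff 0 = ∑ n ∈ s, f.coeff n * g.coeff (-n) := by
  rw [HahnSeries.coeff_mul]
  have h2 : ∀ ij ∈ Finset.antidiagonal f.isPWO_support g.isPWO_support 0, -ij.1 = ij.2 :=
    fun ij hij => by
      have h : ij.1 + ij.2 = 0 := (Finset.mem_antidiagonal.mp hij).2.2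
      omega
  rw [Finset.sum_congr rfl fun ij hij => by rw [← h2 ij hij],
    ← Finset.sum_image (f := fun n => f.coeff n * g.coeff (-n)) (g := Prod.fst) fun a ha b hb hab =>
      Prod.ext hab (by rw [← h2 a ha, ← h2 b hb, hab])]
  refine Finset.sum_subset (fun n hn => ?_) fun n _ hn => ?_
  · obtain ⟨ij, hij, rfl⟩ := Finset.mem_image.mp hn
    refine hs (Finset.mem_Icc.mpr ?_)
    have h := Finset.mem_antidiagonal.mp hij
    constructor
    · by_contra hlt
      exact h.1 (hf _ (by omega))
    · by_contra hlt
      exact h.2.1 (hg _ (by rw [← h2 ij hij]; omega))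
  · by_contra hne
    exact hn (Finset.mem_image.mpr ⟨(n, -n), Finset.mem_antidiagonal.mpr
      ⟨left_ne_zero_of_mul hne, right_ne_zero_of_mul hne, by simp⟩, rfl⟩)

/-- Expanding `w^i` in powers of `z` and then back in powers of `w` returns `w^i`; this inverts the
passage from `a_i` to `a[n]`. -/
theorem sum_coeff_mul_modeCoeff (i j : ℤ) {s : Finset ℤ} (hs : Finset.Icc i j ⊆ s) :
    ∑ n ∈ s, (expSubOne ^ i).coeff n * modeCoeff n j = if i = j then 1 else 0 := by
  have h := coeff_zero_zpow_mul_euler (i - j)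
  rw [show i - j - 1 = i + (-j - 1) by ring, zpow_add₀ expSubOne_ne_zero, mul_assoc,
    (vanishBelow_expSubOne_zpow i).coeff_zero_mul (vanishBelow_zpow_mul_euler (-j - 1))
      (s := s) (by rwa [show -(-j - 1 + 1) = j by ring])] at h
  simp only [sub_eq_zero] at h
  rw [← h]
  refine Finset.sum_congr rfl fun n _ => ?_
  rw [modeCoeff_eq_expCoeff, expCoeff, HahnSeries.coeff_single_mul, one_mul, zero_sub]

/-! ### Powers of `e^z` as binomial series in `e^z - 1` -/

theorem coeff_qz_zpow (k : ℤ) (l : ℕ) : (qz ^ k).coeff l = (k : ℂ) ^ l / (l.factorial : ℂ) := by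
  induction l with
  | zero =>
    have hstep : ∀ k : ℤ, (qz ^ (k + 1)).coeff 0 = (qz ^ k).coeff 0 := fun k => by
      have := (vanishBelow_qz_zpow k).coeff_mul (vanishBelow_qz_zpow 1)
      have h0 := qz_coeff 0
      rw [← zpow_add₀ qz_ne_zero, zpow_one] at this
      simp at h0
      simpa [h0] using this
    suffices (qz ^ k).coeff 0 = 1 by simpa using this
    induction k using Int.induction_on with
    | zero => simp
    | succ i ih => rw [hstep, ih]
    | pred i ih => rw [← ih, ← hstep, sub_add_cancel]
  | succ l ih =>
    have h := laurentEuler_coeff (qz ^ k) (l + 1 : ℕ)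
    rw [laurentEuler_zpow qz_ne_zero, euler_qz, mul_left_comm (qz ^ (k - 1)), mul_comm (qz ^ (k - 1)),
      ← zpow_one_add₀ qz_ne_zero, add_sub_cancel, coeff_C_mul, HahnSeries.coeff_single_mul, one_mul,
      show ((l + 1 : ℕ) : ℤ) - 1 = (l : ℤ) by push_cast; ring, ih] at h
    have h1 : (l.factorial : ℂ) ≠ 0 := by exact_mod_cast l.factorial_ne_zero
    have h2 : ((l : ℂ) + 1) ≠ 0 := by exact_mod_cast l.succ_ne_zero
    rw [Nat.factorial_succ]
    push_cast at h ⊢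
    rw [eq_div_iff (mul_ne_zero h2 h1)]
    field_simp at h
    rw [pow_succ]
    linear_combination -h

/-- This is `(1 + w)^k = ∑ binom(k, i) w^i` for an integer `k` of either sign. Pascal's rule shows
that the error at `k + 1` is `e^z` times the error at `k`, up to a multiple of `w^N`. As `e^z` is
invertible of order zero, the recursion runs in both directions from `k = 0`. -/
theorem vanishBelow_binomial_sub_qz_zpow (k : ℤ) (N : ℕ) :
    VanishBelow N (∑ i ∈ Finset.range N, HahnSeries.C ((Ring.choose k i : ℤ) : ℂ) *
      expSubOne ^ i - qz ^ k) := by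
  rcases N with _ | N
  · intro n hn
    rw [Finset.range_zero, Finset.sum_empty, zero_sub, HahnSeries.coeff_neg,
      vanishBelow_qz_zpow k n (by simpa using hn), neg_zero]
  set D : ℤ → LaurentSeries ℂ := fun k => ∑ i ∈ Finset.range (N + 1),
    HahnSeries.C ((Ring.choose k i : ℤ) : ℂ) * expSubOne ^ i - qz ^ k with hD
  set R : ℤ → LaurentSeries ℂ := fun k => HahnSeries.C ((Ring.choose k N : ℤ) : ℂ) *
    expSubOne ^ (N + 1) with hR
  have hRv : ∀ k, VanishBelow ((N + 1 : ℕ) : ℤ) (R k) := fun k => by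
    have := (vanishBelow_expSubOne_zpow ((N + 1 : ℕ) : ℤ)).C_mul ((Ring.choose k N : ℤ) : ℂ)
    rwa [zpow_natCast] at this
  have hstep : ∀ k, D (k + 1) = qz * D k - R k := fun k => by
    have hN : ∀ N : ℕ, ∑ i ∈ Finset.range (N + 1),
        HahnSeries.C ((Ring.choose (k + 1) i : ℤ) : ℂ) * expSubOne ^ i =
        qz * ∑ i ∈ Finset.range (N + 1), HahnSeries.C ((Ring.choose k i : ℤ) : ℂ) * expSubOne ^ i -
          HahnSeries.C ((Ring.choose k N : ℤ) : ℂ) * expSubOne ^ (N + 1) := fun N => by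
      induction N with
      | zero =>
        rw [qz_eq]
        simp
      | succ N ih =>
        rw [Finset.sum_range_succ, ih, Finset.sum_range_succ _ (N + 1), Ring.choose_succ_succ, qz_eq]
        push_cast
        rw [map_add]
        ring
    simp only [hD, hR]
    rw [hN, zpow_add_one₀ qz_ne_zero]
    ring
  have hq := vanishBelow_qz_zpow 1
  have hq' := vanishBelow_qz_zpow (-1)
  rw [zpow_one] at hq
  rw [zpow_neg_one] at hq'
  change VanishBelow _ (D k)
  induction k using Int.induction_on with
  | zero =>
    have : D 0 = 0 := by
      simp only [hD]
      rw [Finset.sum_range_succ', Finset.sum_eq_zero fun i _ => by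
        rw [Ring.choose_zero_succ, Int.cast_zero, map_zero, zero_mul]]
      simp
    rw [this]
    exact fun n _ => rfl
  | succ i ih =>
    rw [hstep]
    exact ((hq.mul ih).mono (by omega)).sub (hRv _)
  | pred i ih =>
    have h := hstep (-(i : ℤ) - 1)
    rw [sub_add_cancel] at h
    have h2 : D (-(i : ℤ) - 1) = qz⁻¹ * (D (-(i : ℤ)) - HahnSeries.C (-1) * R (-(i : ℤ) - 1)) := by
      rw [h]
      rw [map_neg, map_one]
      field_simp [qz_ne_zero]
      ring
    rw [h2]
    exact (hq'.mul (ih.sub ((hRv _).C_mul _))).mono (by omega)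

theorem sum_choose_mul_coeff (k : ℤ) (f : LaurentSeries ℂ) (hf : VanishBelow 0 f) {l N : ℕ}
    (h : l < N) : ∑ i ∈ Finset.range N, ((Ring.choose k i : ℤ) : ℂ) * (f * expSubOne ^ i).coeff l =
      (f * qz ^ k).coeff l := by
  have := hf.mul (vanishBelow_binomial_sub_qz_zpow k N) l (by omega)
  rw [mul_sub, HahnSeries.coeff_sub, sub_eq_zero, Finset.mul_sum, HahnSeries.coeff_sum] at this
  rw [← this]
  refine Finset.sum_congr rfl fun i _ => ?_
  rw [mul_left_comm, coeff_C_mul]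

theorem sum_choose_mul_expSubOne_pow_coeff (k : ℤ) {l N : ℕ} (h : l < N) :
    ∑ i ∈ Finset.range N, ((Ring.choose k i : ℤ) : ℂ) * (expSubOne ^ (i : ℤ)).coeff l =
      (k : ℂ) ^ l / (l.factorial : ℂ) := by
  have := sum_choose_mul_coeff k 1 (fun n hn => by
    rw [HahnSeries.coeff_one, if_neg (by omega)]) h
  rw [one_mul, coeff_qz_zpow] at this
  simpa using this

/-- The creation part of `a[-n]`. -/
theorem sum_modeCoeff_mul_choose (k : ℤ) (n : ℕ) :
    ∑ i ∈ Finset.range (n + 1), modeCoeff (-(n + 1 : ℤ)) (-(i + 1 : ℤ)) *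
      ((Ring.choose (k - 1) i : ℤ) : ℂ) = (k : ℂ) ^ n / (n.factorial : ℂ) := by
  -- The factor `e^z` in the coefficients of `a[-n-1]` raises `e^((k-1)z)` to `e^(kz)`.
  have := sum_choose_mul_coeff (k - 1) qz (by simpa using vanishBelow_qz_zpow 1) (Nat.lt_succ_self n)
  rw [← zpow_one_add₀ qz_ne_zero, add_sub_cancel, coeff_qz_zpow] at this
  rw [← this]
  refine Finset.sum_congr rfl fun i _ => ?_
  rw [modeCoeff, sqCoeff, mul_comm, expSubOne, zpow_one]
  congr 2
  · rw [← zpow_natCast]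
    congr 2
    ring
  · ring

/-! ### Bernoulli numbers and polar parts -/

theorem coeff_expSubOne_inv (j : ℕ) : (expSubOne ^ (-1 : ℤ)).coeff (j - 1 : ℤ) =
    ((bernoulli j : ℚ) : ℂ) / (j.factorial : ℂ) := by
  have h := congrArg (HahnSeries.ofPowerSeries ℤ ℂ) (bernoulliPowerSeries_mul_exp_sub_one ℂ)
  have h1 : (HahnSeries.ofPowerSeries ℤ ℂ (bernoulliPowerSeries ℂ)) * expSubOne =
      HahnSeries.single 1 1 := by
    rw [map_mul, map_sub, map_one, HahnSeries.ofPowerSeries_X] at h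
    exact h
  have h2 : expSubOne ^ (-1 : ℤ) = HahnSeries.single (-1) 1 *
      HahnSeries.ofPowerSeries ℤ ℂ (bernoulliPowerSeries ℂ) := by
    rw [zpow_neg_one]
    refine inv_eq_of_mul_eq_one_left ?_
    rw [mul_assoc, h1, HahnSeries.single_mul_single]
    simp
  rw [h2, HahnSeries.coeff_single_mul, one_mul, sub_neg_eq_add, sub_add_cancel,
    HahnSeries.ofPowerSeries_apply_coeff, bernoulliPowerSeries, PowerSeries.coeff_mk]
  simp

/-- The polar part of the expansion of `z^(-n-1)` in powers of `e^z - 1`. -/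
def polarPart (n : ℕ) : LaurentSeries ℂ :=
  ∑ m ∈ Finset.range (n + 1), HahnSeries.C ((qz * expSubOne ^ m).coeff n) *
    expSubOne ^ (-(m + 1 : ℤ))

/-- Differentiate `e^z w^(m+1)` and use `e^(2z) w^m = e^z w^m + e^z w^(m+1)`. -/
theorem coeff_qz_mul_pow_succ (n m : ℕ) : ((n : ℂ) + 1) * (qz * expSubOne ^ (m + 1)).coeff (n + 1 : ℕ) =
    (m + 2) * (qz * expSubOne ^ (m + 1)).coeff n + (m + 1) * (qz * expSubOne ^ m).coeff n := by
  have h := laurentEuler_coeff (qz * expSubOne ^ (m + 1)) (n + 1 : ℕ)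
  have h2 := euler_expSubOne_zpow ((m + 1 : ℕ) : ℤ)
  rw [zpow_natCast, show ((m + 1 : ℕ) : ℤ) - 1 = (m : ℤ) by push_cast; ring, zpow_natCast] at h2
  rw [laurentEuler_mul, h2, euler_qz, euler_expSubOne,
    show HahnSeries.single 1 1 * qz * expSubOne ^ (m + 1) + qz * (HahnSeries.C (((m + 1 : ℕ) : ℤ) : ℂ) *
      (expSubOne ^ m * (HahnSeries.single 1 1 * qz))) = HahnSeries.single 1 1 *
      (qz * expSubOne ^ (m + 1) + HahnSeries.C (((m + 1 : ℕ) : ℤ) : ℂ) *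
        (qz * expSubOne ^ m * qz)) by ring, HahnSeries.coeff_single_mul, one_mul,
    show ((n + 1 : ℕ) : ℤ) - 1 = (n : ℤ) by push_cast; ring, HahnSeries.coeff_add, coeff_C_mul,
    show qz * expSubOne ^ m * qz = qz * expSubOne ^ m + qz * expSubOne ^ (m + 1) by
      nth_rw 2 [qz_eq]; ring, HahnSeries.coeff_add] at h
  push_cast at h ⊢
  linear_combination -h

theorem vanishBelow_qz_mul_pow (m : ℕ) : VanishBelow m (qz * expSubOne ^ m) := by
  have := (vanishBelow_qz_zpow 1).mul (vanishBelow_expSubOne_zpow m)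
  rwa [zpow_one, zpow_natCast, zero_add] at this

theorem laurentEuler_C_mul (c : ℂ) (f : LaurentSeries ℂ) :
    laurentEuler (HahnSeries.C c * f) = HahnSeries.C c * laurentEuler f := by
  ext n
  rw [laurentEuler_coeff, coeff_C_mul, coeff_C_mul, laurentEuler_coeff]
  ring

/-- The derivative of `z^(-n-1)` is `-(n+1) z^(-n-2)`, and taking the polar part in `w` commutes
with `d/dz`, because `dw/dz = 1 + w`. The successive polar parts are thus derivatives of `1/w`, up
to scalars. -/
theorem euler_polarPart (n : ℕ) : laurentEuler (polarPart n) =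
    HahnSeries.single 1 1 * (HahnSeries.C (-(n + 1 : ℂ)) * polarPart (n + 1)) := by
  set e : ℕ → ℂ := fun m => (qz * expSubOne ^ m).coeff n with he
  have h1 : laurentEuler (polarPart n) = HahnSeries.single 1 1 * -∑ m ∈ Finset.range (n + 1),
      HahnSeries.C ((m + 1) * e m) *
        (expSubOne ^ (-(m + 1 : ℤ)) + expSubOne ^ (-((m + 1 : ℕ) + 1 : ℤ))) := by
    rw [polarPart, map_sum, ← Finset.sum_neg_distrib, Finset.mul_sum]
    refine Finset.sum_congr rfl fun m _ => ?_
    change laurentEuler (HahnSeries.C (e m) * _) = _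
    rw [laurentEuler_C_mul, euler_expSubOne_zpow, euler_expSubOne, qz_eq,
      show -((m : ℤ) + 1) - 1 = -((m + 1 : ℕ) + 1 : ℤ) by push_cast; ring,
      show -((m : ℤ) + 1) = -((m + 1 : ℕ) + 1 : ℤ) + 1 by push_cast; ring,
      zpow_add_one₀ expSubOne_ne_zero, map_mul]
    push_cast
    rw [show -((m : ℂ) + 1 + 1) + 1 = -((m : ℂ) + 1) by ring, map_neg]
    ring
  have h2 : HahnSeries.C ((n : ℂ) + 1) * polarPart (n + 1) = ∑ m ∈ Finset.range (n + 1),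
      HahnSeries.C ((m + 1) * e m) *
        (expSubOne ^ (-(m + 1 : ℤ)) + expSubOne ^ (-((m + 1 : ℕ) + 1 : ℤ))) := by
    have h0 : ((n : ℂ) + 1) * (qz * expSubOne ^ 0).coeff (n + 1 : ℕ) = e 0 := by
      have := laurentEuler_coeff qz (n + 1 : ℕ)
      rw [euler_qz, HahnSeries.coeff_single_mul, one_mul,
        show ((n + 1 : ℕ) : ℤ) - 1 = (n : ℤ) by push_cast; ring] at this
      simp only [he, pow_zero, mul_one]
      rw [this]
      push_cast
      ring
    -- `polarPart (n + 1)` has one term more than `polarPart n`; the index shift is harmless since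
    -- `e^z w^(n+1)` vanishes to order `n + 1`.
    have hlast : e (n + 1) = 0 := vanishBelow_qz_mul_pow (n + 1) n (by push_cast; omega)
    have h3 : ∀ m : ℕ, HahnSeries.C ((n : ℂ) + 1) *
        (HahnSeries.C ((qz * expSubOne ^ (m + 1)).coeff (n + 1 : ℕ)) *
          expSubOne ^ (-((m + 1 : ℕ) + 1 : ℤ))) =
        HahnSeries.C (((m + 1 : ℕ) + 1) * e (m + 1)) * expSubOne ^ (-((m + 1 : ℕ) + 1 : ℤ)) +
        HahnSeries.C ((m + 1) * e m) * expSubOne ^ (-((m + 1 : ℕ) + 1 : ℤ)) := fun m => by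
      rw [← mul_assoc, ← map_mul, coeff_qz_mul_pow_succ, map_add, add_mul]
      congr 4
      push_cast
      ring
    simp only [mul_add, Finset.sum_add_distrib]
    rw [polarPart, Finset.mul_sum, Finset.sum_range_succ', Finset.sum_congr rfl fun m _ => h3 m,
      Finset.sum_add_distrib, add_right_comm, ← mul_assoc, ← map_mul, h0]
    congr 1
    have h4 := Finset.sum_range_succ' (fun m : ℕ => HahnSeries.C (((m : ℂ) + 1) * e m) *
      expSubOne ^ (-(m + 1 : ℤ))) (n + 1)
    rw [Finset.sum_range_succ, hlast, mul_zero, map_zero, zero_mul, add_zero] at h4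
    rw [h4]
    simp
  rw [h1, ← h2, map_neg]
  ring

/-- `polarPart n` is `(-1)^n / n!` times the `n`-th derivative of `1/w`, so its coefficients are
binomial multiples of those of `1/w`, which are Bernoulli numbers over factorials. -/
theorem polarPart_coeff (n l : ℕ) : (polarPart n).coeff l =
    (-1) ^ n * ((n + l).choose n : ℂ) * (expSubOne ^ (-1 : ℤ)).coeff (n + l : ℕ) := by
  induction n generalizing l with
  | zero =>
    rw [polarPart]
    have := qz_coeff 0
    simp at this
    simp [this]
  | succ n ih =>
    have h := congrArg (fun f => f.coeff ((l + 1 : ℕ) : ℤ)) (euler_polarPart n)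
    simp only [laurentEuler_coeff, HahnSeries.coeff_single_mul, one_mul, coeff_C_mul] at h
    rw [ih, show ((l + 1 : ℕ) : ℤ) - 1 = (l : ℤ) by push_cast; ring] at h
    have h1 : ((n : ℂ) + 1) ≠ 0 := by exact_mod_cast n.succ_ne_zero
    apply mul_left_cancel₀ h1
    have h3 := Nat.choose_succ_right_eq (n + (l + 1)) n
    rw [show n + (l + 1) - n = l + 1 by omega] at h3
    have h4 : ((n + 1 + l).choose (n + 1) : ℂ) * (n + 1) = ((n + (l + 1)).choose n : ℂ) * (l + 1) := by
      rw [show n + 1 + l = n + (l + 1) by ring]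
      exact_mod_cast h3
    rw [show n + 1 + l = n + (l + 1) by ring] at h4 ⊢
    push_cast at h h4 ⊢
    rw [pow_succ]
    linear_combination h + (-1) ^ n * (expSubOne ^ (-1 : ℤ)).coeff (n + (l + 1) : ℤ) * h4

/-- The annihilation part of `a[-n]`. -/
theorem sum_modeCoeff_mul_coeff (n l : ℕ) (hl : 0 < l) {s : Finset ℤ} (hs : Finset.Icc 1 (l : ℤ) ⊆ s)
    (hs' : ∀ i ∈ s, 1 ≤ i) :
    ∑ i ∈ s, modeCoeff (-(n + 1 : ℤ)) i * (expSubOne ^ i).coeff l =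
      (-1) ^ (n + 1) * ((n + l).choose l : ℂ) * ((bernoulli (n + 1 + l) : ℚ) : ℂ) /
        ((n + 1 + l).factorial : ℂ) := by
  -- `z^(-n-1)` has no `z^l` term, so in its expansion in powers of `w` the polar and regular parts
  -- have opposite coefficients of `z^l`. The chosen length includes all `i ≤ l`, hence all terms
  -- that reach `z^l`.
  have h1 := expCoeff_expansion (vanishBelow_single (-(n + 1 : ℤ))) (n + 1 + (l + 1)) l
    (by push_cast; omega)
  rw [HahnSeries.coeff_sub, HahnSeries.coeff_single_of_ne (by omega), zero_sub, neg_eq_zero,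
    HahnSeries.coeff_sum, show -((n : ℤ) + 1) + ((n + 1 + (l + 1) : ℕ) : ℤ) = l + 1 by push_cast; ring,
    ← Finset.Ico_union_Ico_eq_Ico (b := 0) (by omega) (by omega),
    Finset.sum_union (Finset.Ico_disjoint_Ico_consecutive _ _ _)] at h1
  have h2 : ∑ i ∈ Finset.Ico (-((n : ℤ) + 1)) 0,
      (HahnSeries.C (expCoeff (HahnSeries.single (-((n : ℤ) + 1)) 1) i) * expSubOne ^ i).coeff l =
      (polarPart n).coeff l := by
    rw [polarPart, HahnSeries.coeff_sum]
    refine Finset.sum_nbij' (fun i => (-i - 1).toNat) (fun m => -((m : ℤ) + 1)) ?_ ?_ ?_ ?_ ?_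
    · intro i hi
      rw [Finset.mem_Ico] at hi
      rw [Finset.mem_range]
      omega
    · intro m hm
      rw [Finset.mem_range] at hm
      rw [Finset.mem_Ico]
      omega
    · intro i hi
      rw [Finset.mem_Ico] at hi
      omega
    · intro m hm
      omega
    · intro i hi
      rw [Finset.mem_Ico] at hi
      obtain ⟨m, rfl⟩ : ∃ m : ℕ, i = -((m : ℤ) + 1) := ⟨(-i - 1).toNat, by omega⟩
      rw [show (-(-((m : ℤ) + 1)) - 1).toNat = m by omega, ← modeCoeff_eq_expCoeff, modeCoeff, sqCoeff,
        ← expSubOne, zpow_one, show -(-((m : ℤ) + 1)) - 1 = (m : ℤ) by ring, zpow_natCast,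
        show -(-((n : ℤ) + 1)) - 1 = (n : ℤ) by ring]
  have h3 : ∑ i ∈ Finset.Ico (0 : ℤ) (l + 1),
      (HahnSeries.C (expCoeff (HahnSeries.single (-((n : ℤ) + 1)) 1) i) * expSubOne ^ i).coeff l =
      ∑ i ∈ s, modeCoeff (-(n + 1 : ℤ)) i * (expSubOne ^ i).coeff l := by
    simp only [coeff_C_mul, modeCoeff_eq_expCoeff]
    rw [← Finset.sum_subset hs fun i hi hi' => ?_]
    · symm
      refine Finset.sum_subset (fun i hi => ?_) fun i hi hi' => ?_
      · rw [Finset.mem_Icc] at hi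
        rw [Finset.mem_Ico]
        omega
      · rw [Finset.mem_Ico] at hi
        rw [Finset.mem_Icc] at hi'
        obtain rfl : i = 0 := by omega
        rw [zpow_zero, HahnSeries.coeff_one, if_neg (by omega), mul_zero]
    · rw [Finset.mem_Icc] at hi'
      rw [vanishBelow_expSubOne_zpow i l (by have := hs' i hi; omega), mul_zero]
  rw [h2, h3, polarPart_coeff] at h1
  have h4 := coeff_expSubOne_inv (n + 1 + l)
  rw [show ((n + 1 + l : ℕ) : ℤ) - 1 = (n + l : ℕ) by push_cast; ring] at h4
  rw [h4, Nat.choose_symm_add] at h1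
  rw [eq_neg_of_add_eq_zero_right h1]
  ring

/-! ## The Heisenberg modes -/

theorem heisMode_neg (m : ℕ+) (p : Fock) : heisMode (-(m : ℤ)) p = X m * p := by
  rw [heisMode, if_pos (by have := m.pos; omega)]
  simp

theorem heisMode_pos (m : ℕ+) (p : Fock) : heisMode (m : ℤ) p = ((m : ℕ) : ℂ) • pderiv m p := by
  rw [heisMode, if_neg (by omega), if_pos (by have := m.pos; omega)]
  simp

theorem heisMode_zero : heisMode 0 = 0 := by
  rw [heisMode, if_neg (by omega), if_neg (by omega)]

theorem int_cases_pnat (n : ℤ) : n = 0 ∨ (∃ m : ℕ+, n = m) ∨ ∃ m : ℕ+, n = -m := by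
  rcases lt_trichotomy n 0 with h | h | h
  · exact .inr (.inr ⟨⟨(-n).toNat, by omega⟩, by simp; omega⟩)
  · exact .inl h
  · exact .inr (.inl ⟨⟨n.toNat, by omega⟩, by simp; omega⟩)

theorem heisMode_commutator (m n : ℤ) (x : Fock) :
    heisMode m (heisMode n x) = heisMode n (heisMode m x) + if m + n = 0 then (m : ℂ) • x else 0 := by
  have hpd : ∀ (k l : ℕ+) (x : Fock), pderiv k (pderiv l x) = pderiv l (pderiv k x) := fun k l x => by
    have : ⁅(pderiv k : Derivation ℂ Fock Fock), (pderiv l : Derivation ℂ Fock Fock)⁆ = 0 := by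
      refine derivation_ext fun i => ?_
      rw [Derivation.commutator_apply, pderiv_X, pderiv_X]
      by_cases h1 : l = i <;> by_cases h2 : k = i <;> simp [h1, h2]
    have := DFunLike.congr_fun this x
    rwa [Derivation.commutator_apply, Derivation.zero_apply, sub_eq_zero] at this
  rcases int_cases_pnat m with rfl | ⟨m, rfl⟩ | ⟨m, rfl⟩
  · simp [heisMode_zero]
  · rcases int_cases_pnat n with rfl | ⟨n, rfl⟩ | ⟨n, rfl⟩
    · simp [heisMode_zero]
    · rw [if_neg (by have := m.pos; omega), add_zero]
      simp only [heisMode_pos, map_smul]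
      rw [smul_comm, hpd]
    · simp only [heisMode_pos, heisMode_neg]
      rw [Derivation.leibniz, pderiv_X, smul_add, smul_eq_mul, smul_eq_mul, mul_smul_comm]
      congr 1
      by_cases h : m = n
      · subst h
        simp
      · rw [Pi.single_eq_of_ne (Ne.symm h), if_neg (by rw [← sub_eq_add_neg, sub_eq_zero]; simpa using h)]
        simp
  · rcases int_cases_pnat n with rfl | ⟨n, rfl⟩ | ⟨n, rfl⟩
    · simp [heisMode_zero]
    · simp only [heisMode_pos, heisMode_neg]
      rw [Derivation.leibniz, pderiv_X, smul_add, smul_eq_mul, smul_eq_mul, mul_smul_comm]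
      by_cases h : m = n
      · subst h
        simp
      · rw [Pi.single_eq_of_ne h, if_neg (by rw [neg_add_eq_zero]; simpa using h)]
        simp
    · rw [if_neg (by have := m.pos; have := n.pos; omega), add_zero]
      simp only [heisMode_neg]
      ring

/-! ## Normal ordered products -/

/-- The coefficient `(-1)^i binom(-m, i)` of the associator formula. -/
def assocCoeff (m : ℕ+) (i : ℕ) : ℂ := (-1 : ℂ) ^ i * (Ring.choose (-(m : ℤ)) i : ℤ)

theorem heisAssocTerm_apply (m : ℕ+) (W : VertexOperator ℂ Fock) (n : ℤ) (i : ℕ) (x : Fock) :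
    heisAssocTerm m W n i x = assocCoeff m i • (heisMode (-(m : ℤ) - i) (W.ncoeff (n + i) x) -
      (-1 : ℂ) ^ (m : ℕ) • W.ncoeff (n - m - i) (heisMode i x)) := rfl

theorem ncoeff_heisNormalProduct (m : ℕ+) (W : VertexOperator ℂ Fock) (n : ℤ) (x : Fock) :
    (heisNormalProduct m W).ncoeff n x = ∑ᶠ i, heisAssocTerm m W n i x := by
  rw [heisNormalProduct, ncoeff_fieldOfModes]
  rfl

theorem ncoeff_heisNormalProduct_eq_sum (m : ℕ+) (W : VertexOperator ℂ Fock) (n : ℤ) (x : Fock)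
    {K : ℕ} (hK : ∀ i, K ≤ i → heisAssocTerm m W n i x = 0) :
    (heisNormalProduct m W).ncoeff n x = ∑ i ∈ Finset.range K, heisAssocTerm m W n i x := by
  rw [ncoeff_heisNormalProduct]
  refine finsum_eq_sum_of_support_subset _ fun i hi => ?_
  rw [Finset.coe_range, Set.mem_Iio]
  by_contra h
  exact hi (hK i (by omega))

theorem eventually_heisAssocTerm_eq_zero (m : ℕ+) (W : VertexOperator ℂ Fock) (n : ℤ) (x : Fock) :
    ∀ᶠ K : ℕ in atTop, ∀ i, K ≤ i → heisAssocTerm m W n i x = 0 := by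
  obtain ⟨N, hN⟩ := (heisAssocTerm_finite m W n x).bddAbove
  refine eventually_atTop.mpr ⟨N + 1, fun K hK i hi => ?_⟩
  by_contra h
  have := hN (a := i) h
  omega

theorem eventually_ncoeff_heisNormalProduct (m : ℕ+) (W : VertexOperator ℂ Fock) (n : ℤ) (x : Fock) :
    ∀ᶠ K : ℕ in atTop, (heisNormalProduct m W).ncoeff n x =
      ∑ i ∈ Finset.range K, heisAssocTerm m W n i x :=
  (eventually_heisAssocTerm_eq_zero m W n x).mono fun _ hK =>
    ncoeff_heisNormalProduct_eq_sum m W n x hK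

/-- The normal ordered product as a linear map. -/
def heisNormalProductLinear (m : ℕ+) : VertexOperator ℂ Fock →ₗ[ℂ] VertexOperator ℂ Fock where
  toFun := heisNormalProduct m
  map_add' W W' := by
    refine VOAData.field_ext fun n x => ?_
    obtain ⟨K, h1, h2, h3⟩ := ((eventually_ncoeff_heisNormalProduct m W n x).and
      ((eventually_ncoeff_heisNormalProduct m W' n x).and
        (eventually_ncoeff_heisNormalProduct m (W + W') n x))).exists
    rw [map_add, Pi.add_apply, LinearMap.add_apply, h1, h2, h3, ← Finset.sum_add_distrib]
    refine Finset.sum_congr rfl fun i _ => ?_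
    simp only [heisAssocTerm_apply, map_add, Pi.add_apply, LinearMap.add_apply, smul_add, smul_sub]
    abel
  map_smul' c W := by
    refine VOAData.field_ext fun n x => ?_
    obtain ⟨K, h1, h2⟩ := ((eventually_ncoeff_heisNormalProduct m W n x).and
      (eventually_ncoeff_heisNormalProduct m (c • W) n x)).exists
    rw [map_smul, Pi.smul_apply, LinearMap.smul_apply, h1, h2, RingHom.id_apply, Finset.smul_sum]
    refine Finset.sum_congr rfl fun i _ => ?_
    simp only [heisAssocTerm_apply, map_smul, Pi.smul_apply, LinearMap.smul_apply, smul_sub]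
    simp only [smul_comm c]

theorem exists_forall_heisMode_eq_zero (x : Fock) : ∃ M : ℕ, ∀ i : ℤ, (M : ℤ) ≤ i → heisMode i x = 0 := by
  obtain ⟨N, hN⟩ := heisMode_truncation x
  exact ⟨(N + 1).toNat, fun i hi => hN i (by omega)⟩

/-- The terms of a twofold normal ordered product. -/
theorem eventually_ncoeff_heisNormalProduct_two (m n : ℕ+) (W : VertexOperator ℂ Fock) (p : ℤ)
    (x : Fock) : ∀ᶠ K : ℕ in atTop,
      (heisNormalProduct m (heisNormalProduct n W)).ncoeff p x =
        ∑ i ∈ Finset.range K, ∑ j ∈ Finset.range K, (assocCoeff m i * assocCoeff n j) •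
          (heisMode (-(m : ℤ) - i) (heisMode (-(n : ℤ) - j) (W.ncoeff (p + i + j) x)) -
            (-1 : ℂ) ^ (n : ℕ) • heisMode (-(m : ℤ) - i) (W.ncoeff (p + i - n - j) (heisMode j x)) -
            (-1 : ℂ) ^ (m : ℕ) • heisMode (-(n : ℤ) - j) (W.ncoeff (p - m - i + j) (heisMode i x)) +
            ((-1 : ℂ) ^ (m : ℕ) * (-1 : ℂ) ^ (n : ℕ)) •
              W.ncoeff (p - m - i - n - j) (heisMode j (heisMode i x))) := by
  obtain ⟨M, hM⟩ := exists_forall_heisMode_eq_zero x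
  obtain ⟨N, hN⟩ := exists_truncation W x
  have h1 : ∀ᶠ K : ℕ in atTop, ∀ j, K ≤ j → ∀ i : ℕ, heisAssocTerm n W (p + i) j x = 0 := by
    refine eventually_atTop.mpr ⟨M + (N - p + 1).toNat, fun K hK j hj i => ?_⟩
    rw [heisAssocTerm_apply, hN _ (by omega), hM j (by omega)]
    simp
  have h2 : ∀ᶠ K : ℕ in atTop, ∀ j, K ≤ j → ∀ i : ℕ,
      heisAssocTerm n W (p - m - i) j (heisMode i x) = 0 := by
    have : ∀ᶠ K : ℕ in atTop, ∀ i ∈ Finset.range M, ∀ j, K ≤ j →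
        heisAssocTerm n W (p - m - i) j (heisMode i x) = 0 :=
      (eventually_all_finset _).mpr fun i _ => eventually_heisAssocTerm_eq_zero _ _ _ _
    filter_upwards [this] with K hK j hj i
    rcases lt_or_ge i M with hi | hi
    · exact hK i (Finset.mem_range.mpr hi) j hj
    · rw [hM i (by omega), map_zero]
  filter_upwards [h1, h2, eventually_ncoeff_heisNormalProduct m (heisNormalProduct n W) p x]
    with K h1 h2 h3
  rw [h3]
  refine Finset.sum_congr rfl fun i _ => ?_
  rw [heisAssocTerm_apply, ncoeff_heisNormalProduct_eq_sum n W _ x fun j hj => h1 j hj i,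
    ncoeff_heisNormalProduct_eq_sum n W _ _ fun j hj => h2 j hj i, map_sum, Finset.smul_sum,
    ← Finset.sum_sub_distrib, Finset.smul_sum]
  refine Finset.sum_congr rfl fun j _ => ?_
  rw [heisAssocTerm_apply, heisAssocTerm_apply, map_smul, map_sub, map_smul]
  module

/-- Normal ordering puts creation modes on the left and annihilation modes on the right, and modes
within each group commute. The double sum is therefore symmetric in the two factors. -/
theorem heisNormalProduct_comm (m n : ℕ+) (W : VertexOperator ℂ Fock) :
    heisNormalProduct m (heisNormalProduct n W) = heisNormalProduct n (heisNormalProduct m W) := by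
  refine VOAData.field_ext fun p x => ?_
  obtain ⟨K, h1, h2⟩ := ((eventually_ncoeff_heisNormalProduct_two m n W p x).and
    (eventually_ncoeff_heisNormalProduct_two n m W p x)).exists
  rw [h1, h2, Finset.sum_comm]
  refine Finset.sum_congr rfl fun i _ => Finset.sum_congr rfl fun j _ => ?_
  rw [heisMode_commutator (-(m : ℤ) - j), if_neg (by have := m.pos; have := n.pos; omega), add_zero,
    heisMode_commutator i j]
  -- For `i, j ≥ 0` the central term needs `i = j = 0`, where its coefficient `i` is zero.
  have h3 : (if (i : ℤ) + j = 0 then ((i : ℤ) : ℂ) • x else 0) = 0 := by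
    split_ifs with h
    · rw [show (i : ℤ) = 0 by omega, Int.cast_zero, zero_smul]
    · rfl
  rw [h3, add_zero, show p + j + i = p + i + j by ring, show p + j - n - i = p - n - i + j by ring,
    show p - m - j + i = p + i - m - j by ring, show p - m - j - n - i = p - n - i - m - j by ring,
    mul_comm (assocCoeff m j)]
  module

instance : LeftCommutative heisNormalProduct := ⟨heisNormalProduct_comm⟩

/-! ## The state-field correspondence -/

/-- By commutativity of normal ordered products the sorting in the definition is immaterial, so any
factor `x_m` may be taken outermost. -/
theorem heisY_monomial (e : ℕ+ →₀ ℕ) :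
    heisY (monomial e 1) = e.toMultiset.foldr heisNormalProduct idField := by
  have h := (basisMonomials ℕ+ ℂ).constr_basis ℂ
    (fun e => (e.toMultiset.sort (· ≤ ·)).foldr heisNormalProduct idField) e
  rw [coe_basisMonomials] at h
  rw [heisY, h, ← Multiset.coe_foldr, Multiset.sort_eq]

theorem ncoeff_idField {V : Type*} [AddCommGroup V] [Module ℂ V] (n : ℤ) (x : V) :
    (idField (V := V)).ncoeff n x = if n = -1 then x else 0 := by
  rw [idField, ncoeff_fieldOfModes]
  split_ifs <;> rfl

theorem heisY_one : heisY 1 = idField := by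
  have := heisY_monomial 0
  simpa using this

theorem heisY_X_mul (m : ℕ+) (w : Fock) : heisY (X m * w) = heisNormalProduct m (heisY w) := by
  suffices heisY ∘ₗ LinearMap.mulLeft ℂ (X m) = heisNormalProductLinear m ∘ₗ heisY from
    LinearMap.congr_fun this w
  refine (basisMonomials ℕ+ ℂ).ext fun e => ?_
  rw [coe_basisMonomials, LinearMap.comp_apply, LinearMap.comp_apply, LinearMap.mulLeft_apply,
    X, monomial_mul, mul_one, heisY_monomial, heisY_monomial, Finsupp.toMultiset_add,
    Finsupp.toMultiset_single, one_nsmul, Multiset.singleton_add, Multiset.foldr_cons]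
  rfl

theorem assocCoeff_eq (m : ℕ+) (i : ℕ) : assocCoeff m i = ((m + i - 1 : ℕ).choose i : ℂ) := by
  rw [assocCoeff, Ring.choose_neg, show ((m : ℕ) : ℤ) + i - 1 = ((m + i - 1 : ℕ) : ℤ) by
    have := m.pos; omega, Ring.choose_natCast]
  rw [Units.smul_def, Int.coe_negOnePow_natCast, smul_eq_mul]
  push_cast
  rw [← mul_assoc, ← pow_add, ← two_mul, pow_mul]
  simp

/-- The identity field has only the mode `-1`, so a single term survives: `i = -1 - n` in the
creation half if `n < 0`, and `i = n` in the annihilation half otherwise. -/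
theorem heisY_X_one (n : ℤ) : (heisY (X 1)).ncoeff n = heisMode n := by
  refine LinearMap.ext fun x => ?_
  obtain ⟨K, h1, h2⟩ := ((eventually_ncoeff_heisNormalProduct 1 idField n x).and
    (eventually_gt_atTop n.natAbs)).exists
  rw [← mul_one (X 1), heisY_X_mul, heisY_one, h1]
  simp only [heisAssocTerm_apply, assocCoeff_eq, ncoeff_idField, PNat.one_coe, add_tsub_cancel_left,
    Nat.choose_self, Nat.cast_one, one_smul, pow_one, neg_one_smul]
  rcases lt_or_ge n 0 with hn | hn
  · rw [Finset.sum_eq_single (-1 - n).toNat]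
    · rw [if_pos (by omega), if_neg (by omega), neg_zero, sub_zero]
      congr 2
      omega
    · intro i _ hi
      rw [if_neg (by omega), if_neg (by omega), map_zero, neg_zero, sub_zero]
    · intro h
      rw [Finset.mem_range] at h
      omega
  · rw [Finset.sum_eq_single n.toNat]
    · rw [if_neg (by omega), if_pos (by omega), map_zero, zero_sub, neg_neg]
      congr 2
      omega
    · intro i _ hi
      rw [if_neg (by omega), if_neg (by omega), map_zero, neg_zero, sub_zero]
    · intro h
      rw [Finset.mem_range] at h
      omega

theorem fock_induction {P : Fock → Prop} (h1 : P 1) (hadd : ∀ p q, P p → P q → P (p + q))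
    (hsmul : ∀ (c : ℂ) p, P p → P (c • p)) (hX : ∀ (m : ℕ+) p, P p → P (X m * p)) (p : Fock) : P p := by
  induction p using MvPolynomial.induction_on with
  | C a => simpa [smul_eq_C_mul] using hsmul a 1 h1
  | add p q hp hq => exact hadd p q hp hq
  | mul_X p n hp => rw [mul_comm]; exact hX n p hp

/-! ## The commutator formula -/

/-- This is the total contraction of `a_k` with the modes of `∂^(m-1) a / (m-1)!`. At most one index
gives a nonzero term: `j = -k` in the second summand if `k < 0`, `j = k - m` in the first if `k ≥
m`. Both signs of `k` give the same formula `m binom(k, m)`. -/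
theorem sum_assocCoeff_smul (m : ℕ+) (k n : ℤ) (y : ℤ → Fock) {K : ℕ} (hK : k.natAbs < K) :
    ∑ j ∈ Finset.range K, assocCoeff m j • ((if k + (-(m : ℤ) - j) = 0 then (k : ℂ) • y (n + j) else 0) +
      (-1 : ℂ) ^ (m : ℕ) • if (j : ℤ) + k = 0 then ((j : ℤ) : ℂ) • y (n - m - j) else 0) =
      (((m : ℕ) : ℂ) * ((Ring.choose k (m : ℕ) : ℤ) : ℂ)) • y (n + k - m) := by
  have hm := m.pos
  rcases lt_trichotomy k 0 with hk | rfl | hk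
  · rw [Finset.sum_eq_single k.natAbs]
    · obtain ⟨j, rfl⟩ : ∃ j : ℕ, k = -((j + 1 : ℕ) : ℤ) := ⟨(-k - 1).toNat, by omega⟩
      rw [if_neg (by omega), if_pos (by omega), zero_add, Int.natAbs_neg, Int.natAbs_natCast,
        smul_smul, smul_smul, assocCoeff_eq, Ring.choose_neg,
        show ((j + 1 : ℕ) : ℤ) + (m : ℕ) - 1 = ((j + m : ℕ) : ℤ) by push_cast; ring,
        Ring.choose_natCast, Units.smul_def, Int.coe_negOnePow_natCast, smul_eq_mul,
        show (m : ℕ) + (j + 1) - 1 = j + m by omega, show n - (m : ℤ) - ((j + 1 : ℕ) : ℤ) =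
          n + -((j + 1 : ℕ) : ℤ) - m by ring]
      congr 1
      have h := Nat.choose_succ_right_eq (j + m) j
      rw [add_tsub_cancel_left, Nat.choose_symm_add] at h
      have h' : ((j + m).choose (j + 1) : ℂ) * (j + 1) = (j + m).choose m * m := by exact_mod_cast h
      push_cast
      linear_combination (-1) ^ (m : ℕ) * h'
    · intro j _ hj
      rw [if_neg (by omega), if_neg (by omega), smul_zero, add_zero, smul_zero]
    · intro h
      rw [Finset.mem_range] at h
      omega
  · rw [Ring.choose_zero_pos _ hm, Finset.sum_eq_zero]
    · simp
    · intro j _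
      rw [if_neg (by omega)]
      split_ifs with h
      · rw [show (j : ℤ) = 0 by omega]
        simp
      · simp
  · obtain ⟨l, rfl⟩ : ∃ l : ℕ, k = ((l + 1 : ℕ) : ℤ) := ⟨(k - 1).toNat, by omega⟩
    rw [Ring.choose_natCast]
    rcases lt_or_ge (l + 1) (m : ℕ) with h | h
    · rw [Nat.choose_eq_zero_of_lt h, Finset.sum_eq_zero]
      · simp
      · intro j _
        rw [if_neg (by omega), if_neg (by omega), smul_zero, add_zero, smul_zero]
    · rw [Finset.sum_eq_single (l + 1 - m)]
      · rw [if_pos (by omega), if_neg (by omega), smul_zero, add_zero, smul_smul, assocCoeff_eq,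
          show (m : ℕ) + (l + 1 - m) - 1 = l by omega,
          show n + ((l + 1 - (m : ℕ) : ℕ) : ℤ) = n + ((l + 1 : ℕ) : ℤ) - m by omega]
        congr 1
        obtain ⟨m', hm'⟩ : ∃ m', (m : ℕ) = m' + 1 := ⟨m - 1, by omega⟩
        rw [hm']
        have h1 := Nat.add_one_mul_choose_eq l m'
        rw [show l + 1 - (m' + 1) = l - m' by omega, Nat.choose_symm (by omega)]
        have h2 : ((l : ℂ) + 1) * (l.choose m' : ℂ) = ((l + 1).choose (m' + 1) : ℂ) * (m' + 1) := by
          exact_mod_cast h1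
        push_cast
        linear_combination h2
      · intro j _ hj
        rw [if_neg (by omega), if_neg (by omega), smul_zero, add_zero, smul_zero]
      · intro h'
        rw [Finset.mem_range] at h'
        omega

/-- The terms of the commutator formula. -/
def commTerm (k : ℤ) (w : Fock) (n : ℤ) (x : Fock) (i : ℕ) : Fock :=
  ((Ring.choose k i : ℤ) : ℂ) • (heisY (heisMode i w)).ncoeff (n + k - i) x

theorem finsum_commTerm_eq_sum (k : ℤ) (w : Fock) (n : ℤ) (x : Fock) {M : ℕ}
    (hM : ∀ i : ℤ, (M : ℤ) ≤ i → heisMode i w = 0) :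
    ∑ᶠ i, commTerm k w n x i = ∑ i ∈ Finset.range M, commTerm k w n x i := by
  refine finsum_eq_sum_of_support_subset _ fun i hi => ?_
  rw [Finset.coe_range, Set.mem_Iio]
  by_contra h
  refine hi ?_
  rw [commTerm, hM i (by omega)]
  simp

/-- Borcherds' commutator formula `[a_k, w_n] = ∑ binom(k, i) (a_i w)_{n+k-i}`, by induction on the
state. In the step from `w` to `a_{-m} w`, commuting `a_k` past the Heisenberg modes yields
contractions, which match the extra term of `a_i a_{-m} w` at `i = m`; commuting `a_k` past the
modes of `w` is the induction hypothesis. -/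
theorem heisMode_commutator_heisY (k : ℤ) (w : Fock) (n : ℤ) (x : Fock) :
    heisMode k ((heisY w).ncoeff n x) - (heisY w).ncoeff n (heisMode k x) =
      ∑ᶠ i, commTerm k w n x i := by
  induction w using fock_induction generalizing n x with
  | h1 =>
    rw [finsum_commTerm_eq_sum (M := 0), heisY_one, ncoeff_idField, ncoeff_idField]
    · split_ifs <;> simp
    · intro i hi
      rcases int_cases_pnat i with rfl | ⟨m, rfl⟩ | ⟨m, rfl⟩
      · rw [heisMode_zero, LinearMap.zero_apply]
      · rw [heisMode_pos, pderiv_one, smul_zero]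
      · have := m.pos
        omega
  | hadd p q hp hq =>
    obtain ⟨M, hM⟩ := exists_forall_heisMode_eq_zero p
    obtain ⟨N, hN⟩ := exists_forall_heisMode_eq_zero q
    have hp' := hp n x
    have hq' := hq n x
    rw [finsum_commTerm_eq_sum (M := max M N)] at hp' hq' ⊢
    · have : ∀ i, commTerm k (p + q) n x i = commTerm k p n x i + commTerm k q n x i := fun i => by
        simp only [commTerm, map_add, Pi.add_apply, LinearMap.add_apply, smul_add]
      rw [Finset.sum_congr rfl fun i _ => this i, Finset.sum_add_distrib, ← hp', ← hq']
      simp only [map_add, Pi.add_apply, LinearMap.add_apply]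
      abel
    · intro i hi
      rw [map_add, hM i (by omega), hN i (by omega), add_zero]
    · exact fun i hi => hN i (by omega)
    · exact fun i hi => hM i (by omega)
  | hsmul c p hp =>
    have : ∀ i, commTerm k (c • p) n x i = c • commTerm k p n x i := fun i => by
      simp only [commTerm, map_smul, Pi.smul_apply, LinearMap.smul_apply]
      rw [smul_comm]
    rw [finsum_congr this, ← smul_finsum, ← hp]
    simp only [map_smul, Pi.smul_apply, LinearMap.smul_apply, smul_sub]
  | hX m w ih =>
    obtain ⟨M, hM⟩ := exists_forall_heisMode_eq_zero w
    have hact : ∀ i : ℕ, heisMode i (X m * w) =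
        X m * heisMode i w + if i = (m : ℕ) then ((m : ℕ) : ℂ) • w else 0 := fun i => by
      rw [← heisMode_neg, heisMode_commutator, heisMode_neg]
      congr 1
      by_cases h : i = (m : ℕ)
      · rw [if_pos (by omega), if_pos h, h]
        simp
      · rw [if_neg (by omega), if_neg h]
    -- The range must contain both the indices with `a_i w ≠ 0` and the contraction index `i = m`.
    rw [finsum_commTerm_eq_sum (M := M + m + 1)]
    · have hK : ∀ᶠ K : ℕ in atTop, ∀ i ∈ Finset.range (M + m + 1),
          (heisNormalProduct m (heisY (heisMode i w))).ncoeff (n + k - i) x =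
            ∑ j ∈ Finset.range K, heisAssocTerm m (heisY (heisMode i w)) (n + k - i) j x :=
        (eventually_all_finset _).mpr fun i _ => eventually_ncoeff_heisNormalProduct _ _ _ _
      obtain ⟨K, h1, h2, h3, h4⟩ := ((eventually_ncoeff_heisNormalProduct m (heisY w) n x).and
        ((eventually_ncoeff_heisNormalProduct m (heisY w) n (heisMode k x)).and
          (hK.and (eventually_gt_atTop k.natAbs)))).exists
      have hcomm : ∀ n x, heisMode k ((heisY w).ncoeff n x) = (heisY w).ncoeff n (heisMode k x) +
          ∑ i ∈ Finset.range (M + m + 1), commTerm k w n x i := fun n x => by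
        rw [← finsum_commTerm_eq_sum k w n x fun i hi => hM i (by omega), ← ih, add_sub_cancel]
      have hterm : ∀ i ∈ Finset.range (M + m + 1), commTerm k (X m * w) n x i =
          ∑ j ∈ Finset.range K, ((Ring.choose k i : ℤ) : ℂ) •
            heisAssocTerm m (heisY (heisMode i w)) (n + k - i) j x +
          if i = (m : ℕ) then (((m : ℕ) : ℂ) * ((Ring.choose k (m : ℕ) : ℤ) : ℂ)) •
            (heisY w).ncoeff (n + k - m) x else 0 := fun i hi => by
        rw [commTerm, hact, map_add, heisY_X_mul, map_add, Pi.add_apply, LinearMap.add_apply, h3 i hi,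
          smul_add, Finset.smul_sum]
        congr 1
        split_ifs with h
        · rw [map_smul, map_smul, Pi.smul_apply, LinearMap.smul_apply, smul_smul, h, mul_comm]
        · simp
      rw [Finset.sum_congr rfl hterm, Finset.sum_add_distrib, Finset.sum_ite_eq',
        if_pos (Finset.mem_range.mpr (by omega)),
        ← sum_assocCoeff_smul m k n (fun n => (heisY w).ncoeff n x) h4, heisY_X_mul, h1, h2, map_sum,
        ← Finset.sum_sub_distrib, Finset.sum_comm, ← Finset.sum_add_distrib]
      refine Finset.sum_congr rfl fun j _ => ?_
      -- `e1` and `e2` give the contractions in the creation and annihilation halves, `e3` and `e4`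
      -- the commutators with the modes of `w`; `e6` collects the latter into normal ordered
      -- products.
      have e1 := heisMode_commutator k (-(m : ℤ) - j) ((heisY w).ncoeff (n + j) x)
      have e2 := heisMode_commutator j k x
      have e3 := hcomm (n + j) x
      have e4 := hcomm (n - m - j) (heisMode j x)
      have e5 : (heisY w).ncoeff (n - m - j) (if (j : ℤ) + k = 0 then ((j : ℤ) : ℂ) • x else 0) =
          if (j : ℤ) + k = 0 then ((j : ℤ) : ℂ) • (heisY w).ncoeff (n - m - j) x else 0 := by
        split_ifs
        · rw [map_smul]
        · rw [map_zero]
      have e6 : ∑ i ∈ Finset.range (M + m + 1), ((Ring.choose k i : ℤ) : ℂ) •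
          heisAssocTerm m (heisY (heisMode i w)) (n + k - i) j x = assocCoeff m j •
          (heisMode (-(m : ℤ) - j) (∑ i ∈ Finset.range (M + m + 1), commTerm k w (n + j) x i) -
            (-1 : ℂ) ^ (m : ℕ) • ∑ i ∈ Finset.range (M + m + 1),
              commTerm k w (n - m - j) (heisMode j x) i) := by
        rw [map_sum, Finset.smul_sum, ← Finset.sum_sub_distrib, Finset.smul_sum]
        refine Finset.sum_congr rfl fun i _ => ?_
        rw [heisAssocTerm_apply, commTerm, commTerm, map_smul,
          show n + k - i + j = n + j + k - i by ring, show n + k - i - m - j = n - m - j + k - i by ring]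
        module
      rw [e6, heisAssocTerm_apply, heisAssocTerm_apply, map_smul, map_sub, map_smul, e1, e3, e4, e2,
        map_add, map_add, e5]
      module
    · intro i hi
      obtain ⟨i', rfl⟩ : ∃ i' : ℕ, i = i' := ⟨i.toNat, by omega⟩
      rw [hact, hM _ (by omega), if_neg (by omega), mul_zero, add_zero]

/-! ## Degrees -/

/-- The homogeneous subspace `V_d` of the Fock space. -/
abbrev fockGrade (d : ℤ) : Submodule ℂ Fock :=
  weightedHomogeneousSubmodule ℂ (fun i : ℕ+ => ((i : ℕ) : ℤ)) d

theorem heisMode_mem_fockGrade (k : ℤ) {d : ℤ} {x : Fock} (hx : x ∈ fockGrade d) :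
    heisMode k x ∈ fockGrade (d - k) := by
  rcases int_cases_pnat k with rfl | ⟨m, rfl⟩ | ⟨m, rfl⟩
  · rw [heisMode_zero]
    exact Submodule.zero_mem _
  · rw [heisMode_pos]
    exact Submodule.smul_mem _ _ (IsWeightedHomogeneous.pderiv hx (by ring))
  · rw [heisMode_neg]
    have := (isWeightedHomogeneous_X ℂ (fun i : ℕ+ => ((i : ℕ) : ℤ)) m).mul hx
    rwa [show (((m : ℕ) : ℤ)) + d = d - -((m : ℕ) : ℤ) by ring] at this

theorem fockGrade_induction {P : Fock → ℤ → Prop} (h1 : P 1 0)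
    (hzero : ∀ h, P 0 h) (hadd : ∀ p q h, P p h → P q h → P (p + q) h)
    (hsmul : ∀ (c : ℂ) p h, P p h → P (c • p) h)
    (hX : ∀ (m : ℕ+) p h, p ∈ fockGrade h → P p h → P (X m * p) (m + h)) {p : Fock} {h : ℤ}
    (hp : p ∈ fockGrade h) : P p h := by
  have hmon : ∀ s : Multiset ℕ+, monomial (Multiset.toFinsupp s) (1 : ℂ) ∈
      fockGrade (Finsupp.weight (fun i : ℕ+ => ((i : ℕ) : ℤ)) (Multiset.toFinsupp s)) ∧
      P (monomial (Multiset.toFinsupp s) 1)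
        (Finsupp.weight (fun i : ℕ+ => ((i : ℕ) : ℤ)) (Multiset.toFinsupp s)) := fun s => by
    induction s using Multiset.induction_on with
    | empty => simpa using ⟨isWeightedHomogeneous_one _ _, h1⟩
    | cons m s ih =>
      refine ⟨isWeightedHomogeneous_monomial _ _ _ rfl, ?_⟩
      have := hX m _ _ ih.1 ih.2
      rw [← Multiset.singleton_add, Multiset.toFinsupp_add, Multiset.toFinsupp_singleton, map_add,
        Finsupp.weight_single]
      rw [X, monomial_mul, one_mul] at this
      simpa using this
  rw [← support_sum_monomial_coeff p]
  refine Finset.sum_induction _ (fun q => P q h) (fun a b ha hb => hadd a b h ha hb) (hzero h)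
    fun e he => ?_
  have he' := hp (mem_support_iff.mp he)
  have := (hmon (Finsupp.toMultiset e)).2
  rw [Finsupp.toMultiset_toFinsupp, he'] at this
  simpa [smul_monomial] using hsmul (coeff e p) _ _ this

theorem heisY_mem_fockGrade {h : ℤ} {w : Fock} (hw : w ∈ fockGrade h) (n : ℤ) {d : ℤ} {x : Fock}
    (hx : x ∈ fockGrade d) : (heisY w).ncoeff n x ∈ fockGrade (d + h - n - 1) := by
  refine fockGrade_induction (P := fun w h => ∀ (n d : ℤ) (x : Fock), x ∈ fockGrade d →
    (heisY w).ncoeff n x ∈ fockGrade (d + h - n - 1)) ?_ ?_ ?_ ?_ ?_ hw n d x hx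
  · intro n d x hx
    rw [heisY_one, ncoeff_idField]
    split_ifs with h
    · subst h
      convert hx using 2
      ring
    · exact Submodule.zero_mem _
  · simp
  · intro p q h hp hq n d x hx
    rw [map_add, map_add, Pi.add_apply, LinearMap.add_apply]
    exact Submodule.add_mem _ (hp n d x hx) (hq n d x hx)
  · intro c p h hp n d x hx
    rw [map_smul, map_smul, Pi.smul_apply, LinearMap.smul_apply]
    exact Submodule.smul_mem _ _ (hp n d x hx)
  · intro m p h _ hp n d x hx
    obtain ⟨K, hK⟩ := (eventually_ncoeff_heisNormalProduct m (heisY p) n x).exists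
    rw [heisY_X_mul, hK]
    refine Submodule.sum_mem _ fun i _ => ?_
    rw [heisAssocTerm_apply]
    have h1 := heisMode_mem_fockGrade (-(m : ℤ) - i) (hp (n + i) d x hx)
    have h2 := hp (n - m - i) _ _ (heisMode_mem_fockGrade i hx)
    rw [show d + h - (n + i) - 1 - (-(m : ℤ) - i) = d + (m + h) - n - 1 by ring] at h1
    rw [show d - i + h - (n - (m : ℤ) - i) - 1 = d + (m + h) - n - 1 by ring] at h2
    exact Submodule.smul_mem _ _ (Submodule.sub_mem _ h1 (Submodule.smul_mem _ _ h2))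

theorem fockGrade_eq_bot {d : ℤ} (hd : d < 0) {x : Fock} (hx : x ∈ fockGrade d) : x = 0 := by
  ext e
  rw [coeff_zero]
  by_contra h
  have h1 := hx h
  have h2 : 0 ≤ Finsupp.weight (fun i : ℕ+ => ((i : ℕ) : ℤ)) e := by
    rw [Finsupp.weight_apply]
    exact Finsupp.sum_nonneg fun i _ => by positivity
  omega

/-! ## Square bracket modes -/

theorem sumHomogeneous_of_mem {W : Type*} [AddCommGroup W] [Module ℂ W] (F : ℤ → Fock →ₗ[ℂ] W)
    {k : ℤ} {v : Fock} (hv : v ∈ fockGrade k) : heisenberg.sumHomogeneous F v = F k v := by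
  let := heisenberg.decomposition
  have h := DirectSum.decompose_of_mem heisenberg.grade (i := k) (x := v) hv
  rw [VOAData.sumHomogeneous, LinearMap.comp_apply]
  change (DirectSum.toModule ℂ ℤ W _) (DirectSum.decompose heisenberg.grade v) = _
  rw [h]
  exact DirectSum.toModule_lof ℂ k _

theorem X_mem_fockGrade (m : ℕ+) : (X m : Fock) ∈ fockGrade m :=
  isWeightedHomogeneous_X ℂ _ m

theorem one_mem_fockGrade : (1 : Fock) ∈ fockGrade 0 :=
  isWeightedHomogeneous_one ℂ _

theorem omega_mem_fockGrade : heisenberg.omega ∈ fockGrade 2 := by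
  refine Submodule.smul_mem _ _ ?_
  have := (X_mem_fockGrade 1).pow 2
  simpa using this

/-- The square bracket mode `a[n]`. -/
def sqMode (n : ℤ) : Module.End ℂ Fock := (heisenberg.sqY (X 1)).ncoeff n

theorem sqMode_apply (n : ℤ) (x : Fock) :
    sqMode n x = ∑ᶠ i : ℤ, modeCoeff n i • heisMode i x := by
  rw [sqMode, VOAData.sqY, sumHomogeneous_of_mem _ (X_mem_fockGrade 1)]
  refine (heisenberg.ncoeff_sqFieldAux 1 (X 1) n x).trans (finsum_congr fun i => ?_)
  change _ • (heisY (X 1)).ncoeff i x = _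
  rw [heisY_X_one, modeCoeff]

/-- The vector `x` is annihilated by all `a_i` with `i ≥ M`. -/
def Annihilated (M : ℤ) (x : Fock) : Prop := ∀ i, M ≤ i → heisMode i x = 0

theorem exists_annihilated (x : Fock) : ∃ M : ℕ, Annihilated M x := exists_forall_heisMode_eq_zero x

theorem Annihilated.mono {M N : ℤ} {x : Fock} (h : Annihilated M x) (hMN : M ≤ N) : Annihilated N x :=
  fun i hi => h i (by omega)

theorem Annihilated.heisMode {M j : ℤ} {x : Fock} (h : Annihilated M x) (hj : -M < j) :
    Annihilated M (heisMode j x) := fun i hi => by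
  rw [heisMode_commutator, h i hi, if_neg (by omega), map_zero, add_zero]

theorem annihilated_one : Annihilated 0 (1 : Fock) := fun i hi => by
  rcases int_cases_pnat i with rfl | ⟨m, rfl⟩ | ⟨m, rfl⟩
  · rw [heisMode_zero, LinearMap.zero_apply]
  · rw [heisMode_pos, pderiv_one, smul_zero]
  · have := m.pos
    omega

theorem sqMode_eq_sum {M n : ℤ} {x : Fock} (h : Annihilated M x) {s : Finset ℤ}
    (hs : Finset.Ico n M ⊆ s) : sqMode n x = ∑ i ∈ s, modeCoeff n i • heisMode i x := by
  rw [sqMode_apply]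
  refine finsum_eq_sum_of_support_subset _ fun i hi => hs ?_
  rw [Finset.mem_Ico]
  constructor
  · by_contra hlt
    exact hi (by simp only [modeCoeff_eq_zero (show i < n by omega), zero_smul])
  · by_contra hlt
    exact hi (by simp only [h i (show M ≤ i by omega), smul_zero])

theorem sqMode_eq_zero {M n : ℤ} {x : Fock} (h : Annihilated M x) (hn : M ≤ n) : sqMode n x = 0 := by
  rw [sqMode_eq_sum h (s := ∅) (by rw [Finset.Ico_eq_empty (by omega)]), Finset.sum_empty]

theorem Annihilated.sum {ι : Type*} {M : ℤ} {s : Finset ι} {f : ι → Fock}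
    (h : ∀ i ∈ s, Annihilated M (f i)) : Annihilated M (∑ i ∈ s, f i) := fun j hj => by
  rw [map_sum]
  exact Finset.sum_eq_zero fun i hi => h i hi j hj

theorem Annihilated.smul {M : ℤ} {x : Fock} (c : ℂ) (h : Annihilated M x) : Annihilated M (c • x) :=
  fun j hj => by rw [map_smul, h j hj, smul_zero]

/-- Both products are bilinear in the `a_i`; their difference is a central term with coefficient `∑
i · modeCoeff m i · modeCoeff n (-i)`, evaluated by residues. -/
theorem sqMode_commutator (m n : ℤ) (x : Fock) :
    sqMode m (sqMode n x) = sqMode n (sqMode m x) + if m + n = 0 then (m : ℂ) • x else 0 := by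
  obtain ⟨M, hM⟩ := exists_annihilated x
  -- The window `(-N, N)` contains every mode that occurs in either order of the product, and it is
  -- stable under `i ↦ -i`, where the contraction sits.
  set N : ℤ := M + m.natAbs + n.natAbs + 1 with hN
  have hx : Annihilated N x := hM.mono (by omega)
  have hexp : ∀ k l : ℤ, -N < k → -N < l → sqMode k (sqMode l x) =
      ∑ i ∈ Finset.Ioo (-N) N, ∑ j ∈ Finset.Ioo (-N) N,
        (modeCoeff k i * modeCoeff l j) • heisMode i (heisMode j x) := fun k l hk hl => by
    rw [sqMode_eq_sum hx (n := l) (s := Finset.Ioo (-N) N) fun i hi => by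
      rw [Finset.mem_Ico] at hi; rw [Finset.mem_Ioo]; omega, sqMode_eq_sum (n := k)
      (s := Finset.Ioo (-N) N) (.sum fun j hj => (hx.heisMode (Finset.mem_Ioo.mp hj).1).smul _)
      fun i hi => by rw [Finset.mem_Ico] at hi; rw [Finset.mem_Ioo]; omega]
    refine Finset.sum_congr rfl fun i _ => ?_
    rw [map_sum, Finset.smul_sum]
    refine Finset.sum_congr rfl fun j _ => ?_
    rw [map_smul, smul_smul]
  rw [hexp m n (by omega) (by omega), hexp n m (by omega) (by omega),
    Finset.sum_comm (s := Finset.Ioo (-N) N) (f := fun i j => (modeCoeff n i * modeCoeff m j) •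
      heisMode i (heisMode j x))]
  have h := congrArg (fun c : ℂ => c • x) (sum_modeCoeff_mul_modeCoeff m n
    (s := Finset.Ioo (-N) N) fun i hi => by
      rw [Finset.mem_Icc] at hi; rw [Finset.mem_Ioo]; omega)
  simp only [ite_smul, zero_smul] at h
  rw [← h, Finset.sum_smul, ← Finset.sum_add_distrib]
  refine Finset.sum_congr rfl fun i hi => ?_
  rw [Finset.sum_congr rfl fun j _ => by rw [heisMode_commutator i j, smul_add],
    Finset.sum_add_distrib]
  congr 1
  · exact Finset.sum_congr rfl fun j _ => by rw [mul_comm]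
  · rw [Finset.sum_eq_single (-i)]
    · rw [if_pos (by omega), smul_smul]
    · intro j _ hj
      rw [if_neg (by omega), smul_zero]
    · intro h
      rw [Finset.mem_Ioo] at h hi
      omega

theorem heisMode_eq_sum_sqMode {M : ℤ} {x : Fock} (hx : Annihilated M x) (i : ℤ) :
    heisMode i x = ∑ n ∈ Finset.Ico i M, (expSubOne ^ i).coeff n • sqMode n x := by
  rw [Finset.sum_congr rfl fun n hn => by
    rw [sqMode_eq_sum hx (n := n) (s := Finset.Ico i M)
      (Finset.Ico_subset_Ico_left (Finset.mem_Ico.mp hn).1), Finset.smul_sum], Finset.sum_comm]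
  rw [Finset.sum_congr rfl fun j hj => by
    rw [Finset.sum_congr rfl fun n _ => smul_smul _ _ _, ← Finset.sum_smul,
      sum_coeff_mul_modeCoeff i j (s := Finset.Ico i M) fun n hn => by
        rw [Finset.mem_Icc] at hn; rw [Finset.mem_Ico] at hj ⊢; omega]]
  rcases lt_or_ge i M with h | h
  · rw [Finset.sum_eq_single i]
    · rw [if_pos rfl, one_smul]
    · intro j _ hj
      rw [if_neg (Ne.symm hj), zero_smul]
    · intro h'
      rw [Finset.mem_Ico] at h'
      omega
  · rw [Finset.Ico_eq_empty (by omega), Finset.sum_empty, hx i h]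

/-- The operator form of `(1 + w)^k = e^(kz)`: binomial combinations of the `a_i` become exponential
combinations of the `a[l]`. This is the source of powers of `k` in Zhu's recursion. -/
theorem sum_choose_smul_heisMode (k : ℤ) {K : ℕ} {x : Fock} (hx : Annihilated K x) :
    ∑ i ∈ Finset.range K, ((Ring.choose k i : ℤ) : ℂ) • heisMode i x =
      ∑ l ∈ Finset.range K, ((k : ℂ) ^ l / (l.factorial : ℂ)) • sqMode l x := by
  have h : ∀ i : ℕ, heisMode i x =
      ∑ l ∈ Finset.range K, (expSubOne ^ (i : ℤ)).coeff l • sqMode l x := fun i => by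
    rw [heisMode_eq_sum_sqMode hx i]
    refine Eq.trans ?_ (Finset.sum_map (Finset.range K) Nat.castEmbedding
      fun n : ℤ => (expSubOne ^ (i : ℤ)).coeff n • sqMode n x)
    refine Finset.sum_subset (fun n hn => ?_) fun n hn hn' => ?_
    · rw [Finset.mem_Ico] at hn
      exact Finset.mem_map.mpr ⟨n.toNat, Finset.mem_range.mpr (by omega), by simp; omega⟩
    · obtain ⟨l, hl, rfl⟩ := Finset.mem_map.mp hn
      rw [Finset.mem_range] at hl
      rw [Finset.mem_Ico] at hn'
      rw [vanishBelow_expSubOne_zpow i _ (by simp at hn' ⊢; omega), zero_smul]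
  rw [Finset.sum_congr rfl fun i _ => by rw [h i, Finset.smul_sum], Finset.sum_comm]
  refine Finset.sum_congr rfl fun l hl => ?_
  rw [← sum_choose_mul_expSubOne_pow_coeff k (Finset.mem_range.mp hl), Finset.sum_smul]
  exact Finset.sum_congr rfl fun i _ => smul_smul _ _ _

/-! ## The square bracket Virasoro modes -/

theorem heisY_vacuum (w : Fock) {n : ℤ} (hn : 0 ≤ n) : (heisY w).ncoeff n 1 = 0 := by
  induction w using fock_induction generalizing n with
  | h1 => rw [heisY_one, ncoeff_idField, if_neg (by omega)]
  | hadd p q hp hq => rw [map_add, map_add, Pi.add_apply, LinearMap.add_apply, hp hn, hq hn, add_zero]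
  | hsmul c p hp => rw [map_smul, map_smul, Pi.smul_apply, LinearMap.smul_apply, hp hn, smul_zero]
  | hX m p hp =>
    rw [heisY_X_mul, ncoeff_heisNormalProduct]
    refine (finsum_congr fun i => ?_).trans finsum_zero
    rw [heisAssocTerm_apply, hp (by omega), annihilated_one i (by omega)]
    simp

/-- Among the nonnegative modes only `a_1` is nonzero on `ω`, with `a_1 ω = a`, so one term of the
commutator formula remains. -/
theorem heisMode_commutator_omega (k n : ℤ) (x : Fock) :
    heisMode k ((heisY heisenberg.omega).ncoeff n x) =
      (heisY heisenberg.omega).ncoeff n (heisMode k x) + (k : ℂ) • heisMode (n + k - 1) x := by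
  have h := heisMode_commutator_heisY k heisenberg.omega n x
  have hω : ∀ i : ℤ, 0 ≤ i → heisMode i heisenberg.omega = if i = 1 then X 1 else 0 := fun i hi => by
    rcases int_cases_pnat i with rfl | ⟨m, rfl⟩ | ⟨m, rfl⟩
    · rw [heisMode_zero]
      simp
    · rw [heisMode_pos]
      change _ • pderiv m ((1 / 2 : ℂ) • (X 1 : Fock) ^ 2) = _
      by_cases h : m = 1
      · subst h
        simp [smul_eq_C_mul]
        rw [← mul_assoc, ← map_ofNat C 2, ← C_mul]
        simp
      · rw [if_neg (by simpa using h), Derivation.map_smul, pderiv_pow, pderiv_X_of_ne (Ne.symm h)]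
        simp
    · have := m.pos
      omega
  rw [finsum_commTerm_eq_sum (M := 2)] at h
  · rw [Finset.sum_range_succ, Finset.sum_range_one, commTerm, commTerm, hω _ (by omega),
      hω _ (by omega), if_neg (by omega), if_pos (by omega), Ring.choose_one_right, heisY_X_one] at h
    rw [sub_eq_iff_eq_add'.mp h]
    simp
  · intro i hi
    rw [hω i (by omega), if_neg (by omega)]

/-- The square bracket Virasoro mode `L[n]`. -/
def sqVirasoro (n : ℤ) : Module.End ℂ Fock := virasoroMode heisenberg.sqY heisenberg.sqOmega n

/-- The correction `-(c/24) 𝟏` in the square bracket conformal vector affects only `L[-2]`, because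
the vacuum field has only its mode `-1`. -/
theorem sqVirasoro_apply {n : ℤ} (hn : 0 ≤ n) (x : Fock) : sqVirasoro n x =
    ∑ᶠ i : ℤ, sqCoeff 2 (-i - 1) (-(n + 1) - 1) • (heisY heisenberg.omega).ncoeff i x := by
  have h1 : (heisenberg.sqY 1).ncoeff (n + 1) x = 0 := by
    rw [VOAData.sqY, sumHomogeneous_of_mem _ one_mem_fockGrade]
    refine (heisenberg.ncoeff_sqFieldAux 0 1 (n + 1) x).trans
      ((finsum_congr fun i => ?_).trans finsum_zero)
    change _ • (heisY 1).ncoeff i x = _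
    rw [heisY_one, ncoeff_idField]
    split_ifs with h
    · rw [h, sqCoeff]
      simp only [neg_neg, sub_self, zpow_zero, mul_one]
      rw [HahnSeries.coeff_one, if_neg (by omega), zero_smul]
    · rw [smul_zero]
  rw [sqVirasoro, virasoroMode, VOAData.sqOmega, map_sub, map_smul, map_sub, map_smul]
  change (heisenberg.sqY heisenberg.omega).ncoeff (n + 1) x -
    (heisenberg.c / 24) • (heisenberg.sqY 1).ncoeff (n + 1) x = _
  rw [h1, smul_zero, sub_zero, VOAData.sqY, sumHomogeneous_of_mem _ omega_mem_fockGrade]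
  exact heisenberg.ncoeff_sqFieldAux 2 heisenberg.omega (n + 1) x

theorem sqVirasoro_zero_eq_sum {x : Fock} {M : ℤ}
    (hM : ∀ i, M ≤ i → (heisY heisenberg.omega).ncoeff i x = 0) : sqVirasoro 0 x =
      ∑ i ∈ Finset.Ico 1 M, virasoroCoeff i • (heisY heisenberg.omega).ncoeff i x := by
  rw [sqVirasoro_apply le_rfl]
  refine finsum_eq_sum_of_support_subset _ fun i hi => ?_
  rw [Finset.coe_Ico, Set.mem_Ico]
  constructor
  · by_contra hlt
    refine hi ?_
    have := virasoroCoeff_eq_zero (i := i) (by omega)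
    rw [virasoroCoeff] at this
    change sqCoeff 2 (-i - 1) (-(0 + 1) - 1) • _ = _
    rw [show (-(0 + 1) - 1 : ℤ) = -2 by norm_num, this, zero_smul]
  · by_contra hlt
    exact hi (by simp only [hM i (show M ≤ i by omega), smul_zero])

/-- Expand `L[0]` in the `ω_i` and `a[n]` in the `a_j`; the commutators `[ω_i, a_j] = -j a_{i+j-1}`
combine through `sum_modeCoeff_mul_virasoroCoeff`. -/
theorem sqVirasoro_commutator (n : ℤ) (x : Fock) :
    sqVirasoro 0 (sqMode n x) = sqMode n (sqVirasoro 0 x) - (n : ℂ) • sqMode n x := by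
  obtain ⟨M, hM⟩ := exists_annihilated x
  set N : ℤ := M + n.natAbs + 1 with hN
  have hx : Annihilated N x := hM.mono (by omega)
  have htr : ∀ᶠ M' : ℤ in atTop, (∀ i, M' ≤ i → (heisY heisenberg.omega).ncoeff i x = 0) ∧
      ∀ j ∈ Finset.Ico n N, ∀ i, M' ≤ i → (heisY heisenberg.omega).ncoeff i (heisMode j x) = 0 := by
    have : ∀ y : Fock, ∀ᶠ M' : ℤ in atTop, ∀ i, M' ≤ i →
        (heisY heisenberg.omega).ncoeff i y = 0 := fun y => by
      obtain ⟨K, hK⟩ := exists_truncation (heisY heisenberg.omega) y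
      exact eventually_atTop.mpr ⟨K + 1, fun M' hM' i hi => hK i (by omega)⟩
    exact (this x).and ((eventually_all_finset _).mpr fun j _ => this _)
  obtain ⟨M', ⟨h1, h2⟩, h3⟩ := (htr.and (eventually_ge_atTop (N - n + 1))).exists
  have hωx : ∀ i, 1 ≤ i → Annihilated N ((heisY heisenberg.omega).ncoeff i x) := fun i hi k hk => by
    rw [heisMode_commutator_omega, hx k hk, hx _ (by omega), map_zero, smul_zero, add_zero]
  have e1 : sqVirasoro 0 (sqMode n x) = ∑ j ∈ Finset.Ico n N, ∑ i ∈ Finset.Ico 1 M',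
      (modeCoeff n j * virasoroCoeff i) • (heisY heisenberg.omega).ncoeff i (heisMode j x) := by
    rw [sqMode_eq_sum hx le_rfl, map_sum]
    refine Finset.sum_congr rfl fun j hj => ?_
    rw [map_smul, sqVirasoro_zero_eq_sum (h2 j hj), Finset.smul_sum]
    exact Finset.sum_congr rfl fun i _ => smul_smul _ _ _
  have e2 : sqMode n (sqVirasoro 0 x) = ∑ j ∈ Finset.Ico n N, ∑ i ∈ Finset.Ico 1 M',
      (modeCoeff n j * virasoroCoeff i) • heisMode j ((heisY heisenberg.omega).ncoeff i x) := by
    rw [sqVirasoro_zero_eq_sum h1, sqMode_eq_sum (M := N) (.sum fun i hi =>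
      (hωx i (Finset.mem_Ico.mp hi).1).smul _) le_rfl]
    refine Finset.sum_congr rfl fun j hj => ?_
    rw [map_sum, Finset.smul_sum]
    exact Finset.sum_congr rfl fun i _ => by rw [map_smul, smul_smul]
  -- Reindexing by `i = p + 1 - j`: the discrepancies in range have `i < 1`, where `virasoroCoeff`
  -- vanishes, or `i + j - 1 ≥ N`, where the mode kills `x`. The bound `h3` keeps `i` below `M'`.
  have e3 : (n : ℂ) • sqMode n x = ∑ j ∈ Finset.Ico n N, ∑ i ∈ Finset.Ico 1 M',
      (modeCoeff n j * virasoroCoeff i) • (j : ℂ) • heisMode (i + j - 1) x := by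
    rw [sqMode_eq_sum hx le_rfl, Finset.smul_sum, Finset.sum_congr rfl fun p hp => by
      rw [smul_smul, ← sum_modeCoeff_mul_virasoroCoeff n p (s := Finset.Ico n N) fun j hj => by
        rw [Finset.mem_Icc] at hj; rw [Finset.mem_Ico] at hp ⊢; omega, Finset.sum_smul],
      Finset.sum_comm]
    refine Finset.sum_congr rfl fun j hj => ?_
    rw [Finset.mem_Ico] at hj
    refine Finset.sum_bij_ne_zero (fun p _ _ => p + 1 - j) ?_ ?_ ?_ ?_
    · intro p hp hne
      rw [Finset.mem_Ico] at hp ⊢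
      constructor
      · by_contra hlt
        exact hne (by rw [virasoroCoeff_eq_zero (by omega), mul_zero, zero_smul])
      · omega
    · intro p _ _ q _ _ h
      omega
    · intro i hi hne
      rw [Finset.mem_Ico] at hi
      have hlt : i + j - 1 < N := by
        by_contra hlt
        exact hne (by rw [hx _ (by omega), smul_zero, smul_zero])
      refine ⟨i + j - 1, Finset.mem_Ico.mpr (by omega), ?_, by ring⟩
      intro h0
      refine hne ?_
      rw [← h0, smul_smul, show i + j - 1 + 1 - j = i by ring]
      congr 1
      ring
    · intro p _ _
      rw [smul_smul, show p + 1 - j + j - 1 = p by ring]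
      congr 1
      ring
  rw [e1, e2, e3, ← Finset.sum_sub_distrib]
  refine Finset.sum_congr rfl fun j _ => ?_
  rw [← Finset.sum_sub_distrib]
  refine Finset.sum_congr rfl fun i _ => ?_
  rw [heisMode_commutator_omega, smul_add, add_sub_cancel_right]

theorem sqVirasoro_zero_one : sqVirasoro 0 1 = 0 := by
  rw [sqVirasoro_zero_eq_sum (M := 0) fun i hi => heisY_vacuum _ hi]
  simp

theorem sqMode_one {n : ℤ} (hn : 0 ≤ n) : sqMode n 1 = 0 :=
  sqMode_eq_zero annihilated_one hn

theorem sqMode_neg_one_one : sqMode (-1) 1 = X 1 := by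
  rw [sqMode_eq_sum annihilated_one (s := {-1}) fun i hi => by
    rw [Finset.mem_Ico] at hi; rw [Finset.mem_singleton]; omega, Finset.sum_singleton, modeCoeff_self,
    one_smul]
  simpa using heisMode_neg 1 1

theorem sqVirasoro_zero_X : sqVirasoro 0 (X 1) = X 1 := by
  rw [← sqMode_neg_one_one, sqVirasoro_commutator, sqVirasoro_zero_one]
  simp

/-- `L[1]` involves only `ω_i` with `i ≥ 2`, and these send `a_{-1} 𝟏` to `a_{i-2} 𝟏 = 0`. Hence `a`
is quasi-primary and its adjoint modes have only the `k = 0` term. -/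
theorem sqVirasoro_one_X : sqVirasoro 1 (X 1) = 0 := by
  rw [sqVirasoro_apply zero_le_one]
  refine (finsum_congr fun i => ?_).trans finsum_zero
  rcases lt_or_ge i 2 with hi | hi
  · rw [sqCoeff_eq_zero (by omega), zero_smul]
  · have h := heisMode_commutator_omega (-1) i 1
    have h2 : heisMode (-1) 1 = X 1 := by simpa using heisMode_neg 1 1
    rw [heisY_vacuum _ (by omega), map_zero, h2, annihilated_one _ (by omega), smul_zero,
      add_zero] at h
    rw [← h, smul_zero]

theorem sqMode_adjoint {B : LinearMap.BilinForm ℂ Fock} (hB : heisenberg.IsSqLiZMetric B) (n : ℤ)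
    (x y : Fock) : B (sqMode n x) y = -B x (sqMode (-n) y) := by
  have h := hB.invariant 1 (X 1) (Module.End.mem_eigenspace_iff.mpr (by
    rw [Nat.cast_one, one_smul]; exact sqVirasoro_zero_X)) n x y
  rw [sqMode, h]
  have h2 : virasoroMode heisenberg.sqY heisenberg.sqOmega 1 (X 1) = 0 := sqVirasoro_one_X
  rw [adjointMode, Finset.sum_range_succ, Finset.sum_range_one, pow_one, pow_one, pow_zero, h2]
  simp [sqMode]

/-! ## The square bracket Fock space -/

theorem sqMode_neg_comm (k l : ℕ+) (x : Fock) :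
    sqMode (-(k : ℤ)) (sqMode (-(l : ℤ)) x) = sqMode (-(l : ℤ)) (sqMode (-(k : ℤ)) x) := by
  rw [sqMode_commutator, if_neg (by have := k.pos; have := l.pos; omega), add_zero]

instance : LeftCommutative fun (k : ℕ+) (x : Fock) => sqMode (-(k : ℤ)) x := ⟨sqMode_neg_comm⟩

/-- The linear map that sends `∏ x_i ^ e_i` to `∏ a[-i] ^ e_i 𝟏`. -/
def sqFock : Fock →ₗ[ℂ] Fock :=
  (basisMonomials ℕ+ ℂ).constr ℂ fun e =>
    e.toMultiset.foldr (fun (k : ℕ+) (x : Fock) => sqMode (-(k : ℤ)) x) 1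

theorem sqFock_monomial (e : ℕ+ →₀ ℕ) : sqFock (monomial e 1) =
    e.toMultiset.foldr (fun (k : ℕ+) (x : Fock) => sqMode (-(k : ℤ)) x) 1 := by
  have h := (basisMonomials ℕ+ ℂ).constr_basis ℂ
    (fun e => e.toMultiset.foldr (fun (k : ℕ+) (x : Fock) => sqMode (-(k : ℤ)) x) 1) e
  rw [coe_basisMonomials] at h
  rw [sqFock, h]

theorem sqFock_one : sqFock 1 = 1 := by
  simpa using sqFock_monomial 0

theorem sqFock_X_mul (m : ℕ+) (p : Fock) : sqFock (X m * p) = sqMode (-(m : ℤ)) (sqFock p) := by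
  suffices sqFock ∘ₗ LinearMap.mulLeft ℂ (X m) = sqMode (-(m : ℤ)) ∘ₗ sqFock from
    LinearMap.congr_fun this p
  refine (basisMonomials ℕ+ ℂ).ext fun e => ?_
  rw [coe_basisMonomials, LinearMap.comp_apply, LinearMap.comp_apply, LinearMap.mulLeft_apply,
    X, monomial_mul, mul_one, sqFock_monomial, sqFock_monomial, Finsupp.toMultiset_add,
    Finsupp.toMultiset_single, one_nsmul, Multiset.singleton_add, Multiset.foldr_cons]

/-- Both families of modes satisfy the same relations and annihilate the vacuum for `n ≥ 0`, so
agreement on creation modes forces agreement on all modes. -/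
theorem sqFock_heisMode (n : ℤ) (p : Fock) : sqFock (heisMode n p) = sqMode n (sqFock p) := by
  have hneg : ∀ (m : ℕ+) (p : Fock), sqFock (heisMode (-(m : ℤ)) p) = sqMode (-(m : ℤ)) (sqFock p) :=
    fun m p => by rw [heisMode_neg, sqFock_X_mul]
  rcases lt_or_ge n 0 with hn | hn
  · obtain ⟨m, rfl⟩ : ∃ m : ℕ+, n = -m := by
      rcases int_cases_pnat n with h | ⟨m, h⟩ | h
      · omega
      · have := m.pos
        omega
      · exact h
    exact hneg m p
  · induction p using fock_induction with
    | h1 => rw [sqFock_one, sqMode_one hn, annihilated_one n hn, map_zero]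
    | hadd p q hp hq => rw [map_add, map_add, hp, hq, map_add, map_add]
    | hsmul c p hp => rw [map_smul, map_smul, hp, map_smul, map_smul]
    | hX m p hp =>
      rw [sqFock_X_mul, sqMode_commutator, ← hp, ← heisMode_neg, heisMode_commutator, map_add, hneg]
      congr 1
      split_ifs
      · rw [map_smul]
      · rw [map_zero]

/-- On each vector `a_{-m}` is a finite combination of the `a[n]`, so the image is stable under the
creation operators `a_{-m}` and contains the vacuum. -/
theorem sqFock_surjective : Function.Surjective sqFock := fun x => by
  induction x using fock_induction with
  | h1 => exact ⟨1, sqFock_one⟩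
  | hadd p q hp hq =>
    obtain ⟨p, rfl⟩ := hp
    obtain ⟨q, rfl⟩ := hq
    exact ⟨p + q, map_add _ _ _⟩
  | hsmul c p hp =>
    obtain ⟨p, rfl⟩ := hp
    exact ⟨c • p, map_smul _ _ _⟩
  | hX m p hp =>
    obtain ⟨p, rfl⟩ := hp
    obtain ⟨M, hM⟩ := exists_annihilated (sqFock p)
    rw [← heisMode_neg, heisMode_eq_sum_sqMode hM]
    exact ⟨∑ n ∈ Finset.Ico (-(m : ℤ)) M, (expSubOne ^ (-(m : ℤ))).coeff n • heisMode n p, by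
      simp only [map_sum, map_smul, sqFock_heisMode]⟩

/-- The weight `∑ i e_i` of the monomial `∏ x_i ^ e_i`. -/
def expWeight (e : ℕ+ →₀ ℕ) : ℕ := Finsupp.weight (fun i : ℕ+ => (i : ℕ)) e

theorem expWeight_add (e f : ℕ+ →₀ ℕ) : expWeight (e + f) = expWeight e + expWeight f :=
  map_add _ _ _

theorem expWeight_single (i : ℕ+) (k : ℕ) : expWeight (Finsupp.single i k) = k * i := by
  rw [expWeight, Finsupp.weight_single, smul_eq_mul]

theorem coe_expWeight (e : ℕ+ →₀ ℕ) :
    (expWeight e : ℤ) = Finsupp.weight (fun i : ℕ+ => ((i : ℕ) : ℤ)) e := by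
  rw [expWeight, Finsupp.weight_apply, Finsupp.weight_apply, Finsupp.sum, Finsupp.sum]
  push_cast
  simp

theorem monomial_induction {P : (ℕ+ →₀ ℕ) → Prop} (h0 : P 0)
    (hadd : ∀ m e, P e → P (Finsupp.single m 1 + e)) (e : ℕ+ →₀ ℕ) : P e := by
  suffices ∀ s : Multiset ℕ+, P (Multiset.toFinsupp s) by
    simpa [Finsupp.toMultiset_toFinsupp] using this (Finsupp.toMultiset e)
  intro s
  induction s using Multiset.induction_on with
  | empty => simpa using h0
  | cons m s ih =>
    rw [← Multiset.singleton_add, Multiset.toFinsupp_add, Multiset.toFinsupp_singleton]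
    exact hadd m _ ih

theorem monomial_single_add (m : ℕ+) (e : ℕ+ →₀ ℕ) :
    (monomial (Finsupp.single m 1 + e) 1 : Fock) = X m * monomial e 1 := by
  rw [X, monomial_mul, one_mul]

theorem sqVirasoro_sqFock_monomial (e : ℕ+ →₀ ℕ) : sqVirasoro 0 (sqFock (monomial e 1)) =
    (expWeight e : ℂ) • sqFock (monomial e 1) := by
  induction e using monomial_induction with
  | h0 =>
    change sqVirasoro 0 (sqFock 1) = _ • sqFock 1
    rw [sqFock_one, sqVirasoro_zero_one]
    simp [expWeight]
  | hadd m e ih =>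
    rw [monomial_single_add, sqFock_X_mul, sqVirasoro_commutator, ih, map_smul, expWeight_add,
      expWeight_single]
    push_cast
    module

/-- The square `⟨v, v⟩` of the Fock vector `v = ∏ a[-i] ^ e_i 𝟏`. -/
def fockNorm (e : ℕ+ →₀ ℕ) : ℂ := e.prod fun i k => (-((i : ℕ) : ℂ)) ^ k * (k.factorial : ℂ)

theorem fockNorm_ne_zero (e : ℕ+ →₀ ℕ) : fockNorm e ≠ 0 := by
  rw [fockNorm, Finsupp.prod, Finset.prod_ne_zero_iff]
  intro i _
  refine mul_ne_zero (pow_ne_zero _ (neg_ne_zero.mpr ?_)) ?_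
  · exact_mod_cast i.ne_zero
  · exact_mod_cast (e i).factorial_ne_zero

theorem fockNorm_single_add (m : ℕ+) (e : ℕ+ →₀ ℕ) :
    fockNorm (Finsupp.single m 1 + e) = -((m : ℕ) : ℂ) * (e m + 1) * fockNorm e := by
  have h : ∀ e : ℕ+ →₀ ℕ, ∀ s : Finset ℕ+, e.support ⊆ s →
      fockNorm e = ∏ i ∈ s, (-((i : ℕ) : ℂ)) ^ (e i) * ((e i).factorial : ℂ) := fun e s hs =>
    Finsupp.prod_of_support_subset _ hs _ fun i _ => by simp
  have h1 : e.support ⊆ insert m e.support := Finset.subset_insert _ _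
  have h2 : (Finsupp.single m 1 + e).support ⊆ insert m e.support := fun i hi => by
    rw [Finset.mem_insert]
    by_contra hne
    push Not at hne
    rw [Finsupp.mem_support_iff, Finsupp.add_apply, Finsupp.single_eq_of_ne hne.1,
      Finsupp.notMem_support_iff.mp hne.2] at hi
    exact hi rfl
  rw [h _ _ h1, h _ _ h2, ← Finset.mul_prod_erase _ _ (Finset.mem_insert_self m _),
    ← Finset.mul_prod_erase _ _ (Finset.mem_insert_self m _),
    Finset.prod_congr rfl fun i hi => by
      rw [Finsupp.add_apply, Finsupp.single_eq_of_ne (Finset.ne_of_mem_erase hi), zero_add],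
    Finsupp.add_apply, Finsupp.single_eq_same, add_comm 1, pow_succ, Nat.factorial_succ]
  push_cast
  ring

/-! ### Orthogonality of the Fock vectors and dual bases -/

section Metric

variable {B : LinearMap.BilinForm ℂ Fock}

theorem metric_X_mul (hB : heisenberg.IsSqLiZMetric B) (m : ℕ+) (p q : Fock) :
    B (sqFock (X m * p)) (sqFock q) = -((m : ℕ) : ℂ) * B (sqFock p) (sqFock (pderiv m q)) := by
  rw [sqFock_X_mul, sqMode_adjoint hB, neg_neg, ← sqFock_heisMode, heisMode_pos, map_smul, map_smul,
    smul_eq_mul, neg_mul]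

theorem metric_one_X_mul (hB : heisenberg.IsSqLiZMetric B) (m : ℕ+) (q : Fock) :
    B 1 (sqFock (X m * q)) = 0 := by
  have h := sqMode_adjoint hB (m : ℤ) 1 (sqFock q)
  rw [sqMode_one (by omega), map_zero, LinearMap.zero_apply, ← sqFock_X_mul] at h
  exact neg_eq_zero.mp h.symm

/-- Invariance makes multiplication by `x_m` adjoint to `-m ∂/∂x_m`. Stripping the factors of one
monomial differentiates the other, until only pairings with the vacuum remain. -/
theorem metric_monomial (hB : heisenberg.IsSqLiZMetric B) (e f : ℕ+ →₀ ℕ) :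
    B (sqFock (monomial e 1)) (sqFock (monomial f 1)) = if e = f then fockNorm e else 0 := by
  induction e using monomial_induction generalizing f with
  | h0 =>
    change B (sqFock 1) _ = _
    rw [sqFock_one]
    induction f using monomial_induction with
    | h0 =>
      change B 1 (sqFock 1) = _
      rw [sqFock_one, if_pos rfl, fockNorm, Finsupp.prod_zero_index]
      exact hB.normalized
    | hadd m f _ =>
      rw [monomial_single_add, metric_one_X_mul hB, if_neg]
      intro h
      have := DFunLike.congr_fun h m
      rw [Finsupp.add_apply, Finsupp.single_eq_same, Finsupp.zero_apply] at this
      omega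
  | hadd m e ih =>
    rw [monomial_single_add, metric_X_mul hB, pderiv_monomial]
    by_cases hf : f m = 0
    · rw [hf, Nat.cast_zero, mul_zero, monomial_zero, map_zero, map_zero, mul_zero, if_neg]
      rintro rfl
      simp at hf
    · obtain ⟨g, rfl⟩ : ∃ g, f = Finsupp.single m 1 + g := ⟨f - Finsupp.single m 1, by
        rw [add_tsub_cancel_of_le]
        exact Finsupp.single_le_iff.mpr (Nat.one_le_iff_ne_zero.mpr hf)⟩
      have hc : ∀ c : ℂ, (monomial g c : Fock) = c • monomial g 1 := fun c => by
        rw [smul_monomial, smul_eq_mul, mul_one]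
      rw [add_tsub_cancel_left, one_mul, hc, map_smul, map_smul, ih, fockNorm_single_add, smul_eq_mul]
      simp only [add_right_inj]
      split_ifs with h
      · subst h
        rw [Finsupp.add_apply, Finsupp.single_eq_same]
        push_cast
        ring
      · simp

/-- The finite set of exponents of weight `r`. -/
def expsOfWeight (r : ℕ) : Finset (ℕ+ →₀ ℕ) :=
  ((Finset.Icc (1 : ℕ+) r.succPNat).finsupp fun _ => Finset.range (r + 1)).filter
    fun e => expWeight e = r

theorem mul_le_expWeight (e : ℕ+ →₀ ℕ) (i : ℕ+) : e i * i ≤ expWeight e := by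
  rw [expWeight, Finsupp.weight_apply]
  by_cases h : e i = 0
  · rw [h, zero_mul]
    exact Nat.zero_le _
  · exact Finset.single_le_sum (f := fun i => e i • (i : ℕ)) (fun _ _ => Nat.zero_le _)
      (Finsupp.mem_support_iff.mpr h)

theorem mem_expsOfWeight {r : ℕ} {e : ℕ+ →₀ ℕ} : e ∈ expsOfWeight r ↔ expWeight e = r := by
  rw [expsOfWeight, Finset.mem_filter, and_iff_right_iff_imp]
  rintro rfl
  have h := mul_le_expWeight e
  rw [Finset.mem_finsupp_iff]
  constructor
  · intro i hi
    rw [Finset.mem_Icc]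
    refine ⟨one_le, ?_⟩
    rw [← PNat.coe_le_coe, Nat.succPNat_coe]
    have := Nat.le_mul_of_pos_left (i : ℕ) (Nat.pos_of_ne_zero (Finsupp.mem_support_iff.mp hi))
    have := h i
    omega
  · intro i _
    rw [Finset.mem_range]
    have := Nat.le_mul_of_pos_right (e i) i.pos
    have := h i
    omega

/-- Pairing with a Fock vector recovers a coefficient of `p`, since its norm is nonzero. This takes
the place of a separate proof that `sqFock` is injective. -/
theorem metric_sqFock_monomial (hB : heisenberg.IsSqLiZMetric B) (p : Fock) (f : ℕ+ →₀ ℕ) :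
    B (sqFock p) (sqFock (monomial f 1)) = coeff f p * fockNorm f := by
  conv_lhs => rw [← support_sum_monomial_coeff p]
  rw [map_sum, map_sum, LinearMap.sum_apply, Finset.sum_eq_single f]
  · rw [← mul_one (coeff f p), ← smul_eq_mul, ← smul_monomial, map_smul, map_smul,
      LinearMap.smul_apply, metric_monomial hB, if_pos rfl]
    simp
  · intro e _ he
    rw [← mul_one (coeff e p), ← smul_eq_mul, ← smul_monomial, map_smul, map_smul,
      LinearMap.smul_apply, metric_monomial hB, if_neg he, smul_zero]
  · intro h
    rw [notMem_support_iff.mp h, monomial_zero, map_zero, map_zero, LinearMap.zero_apply]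

theorem sqFock_monomial_mem (e : ℕ+ →₀ ℕ) :
    sqFock (monomial e 1) ∈ heisenberg.sqWeightSpace (expWeight e) :=
  Module.End.mem_eigenspace_iff.mpr (sqVirasoro_sqFock_monomial e)

theorem eq_sum_of_mem_sqWeightSpace (hB : heisenberg.IsSqLiZMetric B) {r : ℕ} {x : Fock}
    (hx : x ∈ heisenberg.sqWeightSpace r) : x = ∑ e ∈ expsOfWeight r,
      (B x (sqFock (monomial e 1)) / fockNorm e) • sqFock (monomial e 1) := by
  obtain ⟨p, rfl⟩ := sqFock_surjective x
  have hx' : sqVirasoro 0 (sqFock p) = (r : ℂ) • sqFock p := Module.End.mem_eigenspace_iff.mp hx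
  have hp : p = ∑ e ∈ p.support, coeff e p • monomial e 1 := by
    conv_lhs => rw [← support_sum_monomial_coeff p]
    simp only [smul_monomial, smul_eq_mul, mul_one]
  have hL : sqVirasoro 0 (sqFock p) =
      sqFock (∑ e ∈ p.support, (expWeight e * coeff e p : ℂ) • monomial e 1) := by
    conv_lhs => rw [hp]
    simp only [map_sum, map_smul, sqVirasoro_sqFock_monomial, smul_smul]
    exact Finset.sum_congr rfl fun e _ => by rw [mul_comm]
  -- Pairing the eigenvalue equation with the Fock vector of `f` gives `(wt f - r) · coeff f p = 0`.
  have hsupp : ∀ f, expWeight f ≠ r → coeff f p = 0 := fun f hf => by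
    have h := congrArg (fun y => B y (sqFock (monomial f 1))) (hL.symm.trans hx')
    simp only [map_smul, LinearMap.smul_apply, metric_sqFock_monomial hB, smul_eq_mul] at h
    rw [← mul_assoc] at h
    have h := mul_right_cancel₀ (fockNorm_ne_zero f) h
    rw [coeff_sum, Finset.sum_eq_single f] at h
    · rw [coeff_smul, coeff_monomial, if_pos rfl, smul_eq_mul, mul_one, ← sub_eq_zero, ← sub_mul] at h
      refine (mul_eq_zero.mp h).resolve_left ?_
      exact sub_ne_zero.mpr (by exact_mod_cast hf)
    · intro e _ he
      rw [coeff_smul, coeff_monomial, if_neg he, smul_zero]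
    · intro h
      rw [notMem_support_iff.mp h]
      simp
  have h2 : sqFock p = ∑ e ∈ p.support, coeff e p • sqFock (monomial e 1) := by
    conv_lhs => rw [hp]
    simp only [map_sum, map_smul]
  conv_lhs => rw [h2]
  have h3 : ∀ e ∈ expsOfWeight r, (B (sqFock p) (sqFock (monomial e 1)) / fockNorm e) •
      sqFock (monomial e 1) = coeff e p • sqFock (monomial e 1) := fun e _ => by
    rw [metric_sqFock_monomial hB, mul_div_cancel_right₀ _ (fockNorm_ne_zero e)]
  rw [Finset.sum_congr rfl h3]
  refine Finset.sum_subset (fun e he => ?_) fun e _ he => ?_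
  · rw [mem_expsOfWeight]
    by_contra h
    exact mem_support_iff.mp he (hsupp e h)
  · rw [notMem_support_iff.mp he, zero_smul]

/-- The canonical element of `V_[r] ⊗ V_[r]` in the basis of Fock vectors. -/
theorem sum_dualBasis_eq (hB : heisenberg.IsSqLiZMetric B) {r : ℕ} {ι : Type*} [Fintype ι]
    [DecidableEq ι] (u : Module.Basis ι ℂ (heisenberg.sqWeightSpace r))
    (ubar : ι → heisenberg.sqWeightSpace r)
    (hdual : ∀ i j, B (ubar i) (u j) = if i = j then 1 else 0) (F G : Fock →ₗ[ℂ] ℂ) :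
    ∑ i, F (u i) * G (ubar i) = ∑ e ∈ expsOfWeight r,
      F (sqFock (monomial e 1)) * G (sqFock (monomial e 1)) / fockNorm e := by
  -- The canonical element is independent of the basis: expand `ubar i` in Fock vectors, then resum
  -- over `i` by duality.
  have hexp : ∀ x : heisenberg.sqWeightSpace r, (x : Fock) = ∑ i, B (ubar i) x • (u i : Fock) :=
    fun x => by
      have h1 : (x : Fock) = ∑ i, u.repr x i • (u i : Fock) := by
        conv_lhs => rw [← u.sum_repr x]
        simp only [Submodule.coe_sum, Submodule.coe_smul]
      have h2 : ∀ i, B (ubar i) x = u.repr x i := fun i => by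
        rw [h1, map_sum]
        simp [hdual]
      simp only [h2]
      exact h1
  have hG : ∀ i, G (ubar i) = ∑ e ∈ expsOfWeight r,
      B (ubar i) (sqFock (monomial e 1)) / fockNorm e * G (sqFock (monomial e 1)) := fun i => by
    conv_lhs => rw [eq_sum_of_mem_sqWeightSpace hB (ubar i).2]
    simp
  simp only [hG, Finset.mul_sum]
  rw [Finset.sum_comm]
  refine Finset.sum_congr rfl fun e he => ?_
  have hmem : sqFock (monomial e 1) ∈ heisenberg.sqWeightSpace r := by
    rw [← mem_expsOfWeight.mp he]
    exact sqFock_monomial_mem e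
  have hF : F (sqFock (monomial e 1)) = ∑ i, B (ubar i) (sqFock (monomial e 1)) * F (u i) := by
    have := congrArg F (hexp ⟨_, hmem⟩)
    simpa using this
  rw [hF, Finset.sum_mul, Finset.sum_div]
  exact Finset.sum_congr rfl fun i _ => by ring

end Metric

/-! ## Graded traces -/

/-- Finite dimensionality ensures that `LinearMap.trace` is the genuine trace on each graded piece.
-/
instance (d : ℤ) : Module.Finite ℂ (fockGrade d) := by
  set S : Submodule ℂ Fock := Submodule.span ℂ
    ((expsOfWeight d.toNat).image fun e => (monomial e 1 : Fock)) with hS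
  have hle : fockGrade d ≤ S := fun p hp => by
    rw [← support_sum_monomial_coeff p]
    refine Submodule.sum_mem _ fun e he => ?_
    rw [← mul_one (coeff e p), ← smul_eq_mul, ← smul_monomial]
    refine Submodule.smul_mem _ _ (Submodule.subset_span ?_)
    refine Finset.mem_coe.mpr (Finset.mem_image_of_mem _ (mem_expsOfWeight.mpr ?_))
    have := hp (mem_support_iff.mp he)
    rw [← coe_expWeight] at this
    omega
  have : FiniteDimensional ℂ S := FiniteDimensional.span_finset ℂ _
  exact Submodule.finiteDimensional_of_le hle

/-- The projection of the Fock space onto `V_d`. -/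
def fockProj (d : ℤ) : Fock →ₗ[ℂ] fockGrade d := heisenberg.proj d

theorem fockProj_of_mem {d : ℤ} {x : Fock} (hx : x ∈ fockGrade d) : fockProj d x = ⟨x, hx⟩ := by
  let := heisenberg.decomposition
  have h := DirectSum.decompose_of_mem heisenberg.grade (i := d) (x := x) hx
  change DirectSum.component ℂ ℤ (fun i => heisenberg.grade i) d
    (DirectSum.decompose heisenberg.grade x) = _
  rw [h]
  exact DirectSum.component.lof_self ℂ d _

/-- The trace over `V_d` of the degree preserving part of an operator. -/
def gradeTrace (d : ℤ) : Module.End ℂ Fock →ₗ[ℂ] ℂ where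
  toFun A := LinearMap.trace ℂ (fockGrade d) (fockProj d ∘ₗ A ∘ₗ (fockGrade d).subtype)
  map_add' A A' := by rw [LinearMap.add_comp, LinearMap.comp_add, map_add]
  map_smul' c A := by rw [LinearMap.smul_comp, LinearMap.comp_smul, map_smul, RingHom.id_apply]

theorem gradeTrace_congr {d : ℤ} {A A' : Module.End ℂ Fock} (h : ∀ x ∈ fockGrade d, A x = A' x) :
    gradeTrace d A = gradeTrace d A' := by
  change LinearMap.trace _ _ _ = LinearMap.trace _ _ _
  congr 2
  ext1 x
  exact h x x.2

theorem gradeTrace_of_neg {d : ℤ} (hd : d < 0) (A : Module.End ℂ Fock) : gradeTrace d A = 0 := by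
  rw [gradeTrace_congr (A' := 0) fun x hx => by rw [fockGrade_eq_bot hd hx, map_zero, map_zero],
    map_zero]

/-- Cyclicity of the trace between two graded pieces; moving an operator of nonzero degree around
the trace changes the piece on which it is taken. -/
theorem gradeTrace_mul_comm {d d' : ℤ} {A A' : Module.End ℂ Fock}
    (hA : ∀ x ∈ fockGrade d', A x ∈ fockGrade d) (hA' : ∀ x ∈ fockGrade d, A' x ∈ fockGrade d') :
    gradeTrace d (A * A') = gradeTrace d' (A' * A) := by
  have key : ∀ (d d' : ℤ) (A A' : Module.End ℂ Fock), (∀ x ∈ fockGrade d, A' x ∈ fockGrade d') →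
      fockProj d ∘ₗ (A * A') ∘ₗ (fockGrade d).subtype =
      (fockProj d ∘ₗ A ∘ₗ (fockGrade d').subtype) ∘ₗ
        (fockProj d' ∘ₗ A' ∘ₗ (fockGrade d).subtype) := fun d d' A A' h => by
    ext1 x
    change fockProj d (A (A' x)) = fockProj d (A ((fockProj d' (A' x) : fockGrade d') : Fock))
    rw [fockProj_of_mem (h x x.2)]
  change LinearMap.trace ℂ (fockGrade d) _ = LinearMap.trace ℂ (fockGrade d') _
  rw [key d d' A A' hA', key d' d A' A hA]
  exact LinearMap.trace_comp_comm' _ _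

/-- The formal graded trace `∑ Tr_{V_n} o(v) q^n`. -/
def traceSeries : Fock →ₗ[ℂ] PowerSeries ℂ where
  toFun v := PowerSeries.mk fun n => gradeTrace n (heisenberg.zeroMode v)
  map_add' v w := by
    ext n
    simp
  map_smul' c v := by
    ext n
    simp

theorem coeff_traceSeries (v : Fock) (n : ℕ) :
    PowerSeries.coeff n (traceSeries v) = gradeTrace n (heisenberg.zeroMode v) := by
  simp [traceSeries]

theorem zeroModeTrace_eq (v : Fock) (n : ℤ) :
    heisenberg.zeroModeTrace v n = gradeTrace n (heisenberg.zeroMode v) := rfl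

theorem zeroMode_of_mem {h : ℤ} {v : Fock} (hv : v ∈ fockGrade h) :
    heisenberg.zeroMode v = (heisY v).ncoeff (h - 1) := by
  rw [VOAData.zeroMode, sumHomogeneous_of_mem _ hv]
  rfl

theorem coeff_traceSeries_of_mem {h : ℤ} {v : Fock} (hv : v ∈ fockGrade h) (n : ℕ) :
    PowerSeries.coeff n (traceSeries v) = gradeTrace n ((heisY v).ncoeff (h - 1)) := by
  rw [coeff_traceSeries, ← zeroMode_of_mem hv]

/-- The series `q^k / (1 - q^k)`. -/
def lambert (k : ℕ) : PowerSeries ℂ := PowerSeries.mk fun n => if k ∣ n ∧ n ≠ 0 then 1 else 0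

/-- The hypotheses say `(1 - q^k) f = q^k g`, and `lambert k` satisfies the same equation with `g =
1`; cancel `1 - q^k`. -/
theorem eq_lambert_mul {k : ℕ} (hk : 0 < k) {f g : ℕ → ℂ} (h0 : ∀ d < k, f d = 0)
    (hstep : ∀ d, f (d + k) = f d + g d) :
    PowerSeries.mk f = lambert k * PowerSeries.mk g := by
  have hmk : ∀ f g : PowerSeries ℂ, (∀ d < k, PowerSeries.coeff d f = 0) →
      (∀ d, PowerSeries.coeff (d + k) f = PowerSeries.coeff d f + PowerSeries.coeff d g) →
      (1 - PowerSeries.X ^ k) * f = PowerSeries.X ^ k * g := fun f g h0 hstep => by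
    ext n
    rw [sub_mul, one_mul, map_sub, PowerSeries.coeff_X_pow_mul', PowerSeries.coeff_X_pow_mul']
    split_ifs with h
    · have := hstep (n - k)
      rw [Nat.sub_add_cancel h] at this
      rw [this]
      ring
    · rw [h0 n (by omega), sub_zero]
  have h1 := hmk (PowerSeries.mk f) (PowerSeries.mk g) (by simpa using h0) (by simpa using hstep)
  have h2 := hmk (lambert k) 1 (fun d hd => by
    rw [lambert, PowerSeries.coeff_mk, if_neg]
    rintro ⟨h, h'⟩
    exact absurd (Nat.le_of_dvd (by omega) h) (by omega)) fun d => by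
      rw [lambert, PowerSeries.coeff_mk, PowerSeries.coeff_mk, PowerSeries.coeff_one]
      simp only [Nat.dvd_add_self_right]
      by_cases hd : d = 0
      · subst hd
        simp [hk.ne']
      · simp [hd, hk.ne']
  have hne : (1 - PowerSeries.X ^ k : PowerSeries ℂ) ≠ 0 := fun h => by
    have := congrArg PowerSeries.constantCoeff h
    simp [hk.ne'] at this
  apply mul_left_cancel₀ hne
  rw [h1, ← mul_assoc, h2, mul_one]

theorem coeff_lambert_mul_of_lt {k d : ℕ} (h : d < k) (f : PowerSeries ℂ) :
    PowerSeries.coeff d (lambert k * f) = 0 := by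
  rw [PowerSeries.coeff_mul]
  refine Finset.sum_eq_zero fun ij hij => ?_
  have hij := Finset.HasAntidiagonal.mem_antidiagonal.mp hij
  rw [lambert, PowerSeries.coeff_mk, if_neg, zero_mul]
  rintro ⟨h1, h2⟩
  exact absurd (Nat.le_of_dvd (by omega) h1) (by omega)

/-! ## The recursion formula -/

/-- The operator `v ↦ ∑_{i ≥ 0} binom(k, i) a_i v`. -/
def chooseMode (k : ℤ) : Module.End ℂ Fock :=
  locallyFiniteSum (fun i : ℕ => ((Ring.choose k i : ℤ) : ℂ) • heisMode i) fun x => by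
    obtain ⟨M, hM⟩ := exists_annihilated x
    refine (Finset.range M).finite_toSet.subset fun i hi => ?_
    rw [Finset.coe_range, Set.mem_Iio]
    by_contra h
    exact hi (by simp only [LinearMap.smul_apply, hM i (show (M : ℤ) ≤ i by omega), smul_zero])

theorem chooseMode_eq_sum (k : ℤ) {x : Fock} {M : ℕ} (hM : Annihilated M x) :
    chooseMode k x = ∑ i ∈ Finset.range M, ((Ring.choose k i : ℤ) : ℂ) • heisMode i x := by
  refine finsum_eq_sum_of_support_subset _ fun i hi => ?_
  rw [Finset.coe_range, Set.mem_Iio]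
  by_contra h
  exact hi (by simp only [LinearMap.smul_apply, hM i (show (M : ℤ) ≤ i by omega), smul_zero])

theorem chooseMode_eq_sum_sqMode (k : ℤ) {x : Fock} {M : ℕ} (hM : Annihilated M x) :
    chooseMode k x = ∑ l ∈ Finset.range M, ((k : ℂ) ^ l / (l.factorial : ℂ)) • sqMode l x := by
  rw [chooseMode_eq_sum k hM, sum_choose_smul_heisMode k hM]

/-! ### Cyclicity, commutators and Lambert series -/

section Homogeneous

variable {h : ℤ} {v : Fock} (hv : v ∈ fockGrade h)

include hv

theorem gradeTrace_commutator (k : ℤ) (d : ℕ) :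
    gradeTrace d (heisMode k * (heisY v).ncoeff (h - 1 - k)) =
      gradeTrace d ((heisY v).ncoeff (h - 1 - k) * heisMode k) +
        PowerSeries.coeff d (traceSeries (chooseMode k v)) := by
  obtain ⟨M, hM⟩ := exists_annihilated v
  have h1 : heisMode k * (heisY v).ncoeff (h - 1 - k) =
      (heisY v).ncoeff (h - 1 - k) * heisMode k + ∑ i ∈ Finset.range M,
        ((Ring.choose k i : ℤ) : ℂ) • (heisY (heisMode i v)).ncoeff (h - i - 1) := by
    refine LinearMap.ext fun x => ?_
    have := heisMode_commutator_heisY k v (h - 1 - k) x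
    rw [finsum_commTerm_eq_sum k v _ x hM, sub_eq_iff_eq_add'] at this
    rw [Module.End.mul_apply, this, LinearMap.add_apply, Module.End.mul_apply, LinearMap.sum_apply]
    congr 1
    refine Finset.sum_congr rfl fun i _ => ?_
    rw [commTerm, LinearMap.smul_apply]
    congr 3
    ring_nf
  rw [h1, map_add, chooseMode_eq_sum k hM, map_sum, map_sum, map_sum]
  congr 1
  refine Finset.sum_congr rfl fun i _ => ?_
  rw [map_smul, map_smul, PowerSeries.coeff_smul,
    coeff_traceSeries_of_mem (heisMode_mem_fockGrade i hv)]

theorem gradeTrace_cyclic (k : ℤ) (d : ℤ) :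
    gradeTrace d (heisMode k * (heisY v).ncoeff (h - 1 - k)) =
      gradeTrace (d + k) ((heisY v).ncoeff (h - 1 - k) * heisMode k) := by
  refine gradeTrace_mul_comm (fun x hx => ?_) fun x hx => ?_
  · simpa using heisMode_mem_fockGrade k hx
  · have := heisY_mem_fockGrade hv (h - 1 - k) hx
    rwa [show d + h - (h - 1 - k) - 1 = d + k by ring] at this

/-- `Tr_{d+k}(v a_k) = Tr_d(a_k v)` by cyclicity, and this is `Tr_d(v a_k)` plus the trace of the
commutator. This recursion in `d`, with zero initial values, sums to the factor `q^k / (1 - q^k)`.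
-/
theorem gradeTrace_mul_heisMode_pos {k : ℕ} (hk : 0 < k) (d : ℕ) :
    gradeTrace d ((heisY v).ncoeff (h - 1 - k) * heisMode k) =
      PowerSeries.coeff d (lambert k * traceSeries (chooseMode k v)) := by
  have := eq_lambert_mul hk (f := fun d => gradeTrace d ((heisY v).ncoeff (h - 1 - k) * heisMode k))
    (g := fun d => PowerSeries.coeff d (traceSeries (chooseMode k v))) (fun d hd => by
      have := gradeTrace_cyclic hv k (d - k)
      rw [sub_add_cancel, gradeTrace_of_neg (by omega)] at this
      exact this.symm) fun d => by
      rw [← gradeTrace_commutator hv k d, gradeTrace_cyclic hv]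
      push_cast
      rfl
  have h2 := congrArg (PowerSeries.coeff d) this
  rw [PowerSeries.coeff_mk] at h2
  rw [h2]
  congr 2
  ext n
  exact PowerSeries.coeff_mk _ _

/-- The same argument with `a_{-k}` on the left: the commutator now enters with the opposite sign.
-/
theorem gradeTrace_heisMode_neg_mul {k : ℕ} (hk : 0 < k) (d : ℕ) :
    gradeTrace d (heisMode (-k) * (heisY v).ncoeff (h - 1 - -k)) =
      -PowerSeries.coeff d (lambert k * traceSeries (chooseMode (-k) v)) := by
  have := eq_lambert_mul hk
    (f := fun d => gradeTrace d (heisMode (-k) * (heisY v).ncoeff (h - 1 - -k)))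
    (g := fun d => -PowerSeries.coeff d (traceSeries (chooseMode (-k) v))) (fun d hd => by
      rw [gradeTrace_cyclic hv (-k) d, gradeTrace_of_neg (by omega)]) fun d => by
      rw [gradeTrace_commutator hv (-k) d, add_neg_cancel_right, gradeTrace_cyclic hv]
      push_cast
      rw [add_neg_cancel_right]
  have h2 := congrArg (PowerSeries.coeff d) this
  rw [PowerSeries.coeff_mk] at h2
  have h3 : (PowerSeries.mk fun d => -PowerSeries.coeff d (traceSeries (chooseMode (-k) v))) =
      -traceSeries (chooseMode (-k) v) := by
    ext n
    simp
  rw [h2, h3, mul_neg, map_neg]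

/-- Take traces in the associator formula for the zero mode of `a_{-m} v` and index all terms by the
absolute value `k + 1` of the Heisenberg mode. The associator coefficients become values of `binom(x
- 1, m - 1)` at `x = k + 1` and `x = -(k + 1)`. -/
theorem coeff_traceSeries_X_mul_of_mem (m : ℕ+) (d : ℕ) :
    PowerSeries.coeff d (traceSeries (X m * v)) = ∑ k ∈ Finset.range d, PowerSeries.coeff d
      (lambert (k + 1) * (((Ring.choose (-((k + 1 : ℕ) : ℤ) - 1) (m - 1 : ℕ) : ℤ) : ℂ) •
        traceSeries (chooseMode (k + 1 : ℕ) v) -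
        ((Ring.choose (((k + 1 : ℕ) : ℤ) - 1) (m - 1 : ℕ) : ℤ) : ℂ) •
          traceSeries (chooseMode (-(k + 1 : ℕ)) v))) := by
  have hm := m.pos
  have hmem : X m * v ∈ fockGrade (m + h) := (X_mem_fockGrade m).mul hv
  -- On `V_d` all terms with `i > d` vanish, because they pass through negative degree.
  have h1 : PowerSeries.coeff d (traceSeries (X m * v)) = ∑ i ∈ Finset.range (d + 1), assocCoeff m i *
      (gradeTrace d (heisMode (-(m + i : ℕ)) * (heisY v).ncoeff (h - 1 - -(m + i : ℕ))) -
        (-1) ^ (m : ℕ) * gradeTrace d ((heisY v).ncoeff (h - 1 - i) * heisMode i)) := by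
    rw [coeff_traceSeries_of_mem hmem, gradeTrace_congr (A' := ∑ i ∈ Finset.range (d + 1),
      assocCoeff m i • (heisMode (-(m + i : ℕ)) * (heisY v).ncoeff (h - 1 - -(m + i : ℕ)) -
        (-1 : ℂ) ^ (m : ℕ) • ((heisY v).ncoeff (h - 1 - i) * heisMode i))), map_sum]
    · refine Finset.sum_congr rfl fun i _ => ?_
      rw [map_smul, map_sub, map_smul, smul_eq_mul, smul_eq_mul]
    · intro x hx
      rw [heisY_X_mul, ncoeff_heisNormalProduct_eq_sum m (heisY v) _ x (K := d + 1), LinearMap.sum_apply]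
      · refine Finset.sum_congr rfl fun i _ => ?_
        rw [heisAssocTerm_apply, LinearMap.smul_apply, LinearMap.sub_apply, LinearMap.smul_apply,
          Module.End.mul_apply, Module.End.mul_apply, show -((m : ℕ) : ℤ) - i = -((m + i : ℕ) : ℤ) by
            push_cast; ring, show ((m : ℕ) : ℤ) + h - 1 + i = h - 1 - -((m + i : ℕ) : ℤ) by
            push_cast; ring, show ((m : ℕ) : ℤ) + h - 1 - m - i = h - 1 - i by ring]
      · intro i hi
        rw [heisAssocTerm_apply, fockGrade_eq_bot (by omega) (heisMode_mem_fockGrade i hx),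
          fockGrade_eq_bot (by omega) (heisY_mem_fockGrade hv (m + h - 1 + i) hx)]
        simp
  have h2 : ∑ i ∈ Finset.range (d + 1), assocCoeff m i *
      gradeTrace d (heisMode (-(m + i : ℕ)) * (heisY v).ncoeff (h - 1 - -(m + i : ℕ))) =
      -∑ k ∈ Finset.range d, ((Ring.choose (((k + 1 : ℕ) : ℤ) - 1) (m - 1 : ℕ) : ℤ) : ℂ) *
        PowerSeries.coeff d (lambert (k + 1) * traceSeries (chooseMode (-(k + 1 : ℕ)) v)) := by
    rw [← Finset.sum_neg_distrib]
    -- The mode `-(m + i)` corresponds to `k + 1 = m + i`. Unmatched indices give zero: `lambert (k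
    -- + 1)` starts in degree `k + 1`, and the binomial coefficient vanishes for `k < m - 1`.
    refine Finset.sum_bij_ne_zero (fun i _ _ => m + i - 1) ?_ ?_ ?_ ?_
    · intro i _ hne
      rw [Finset.mem_range]
      by_contra hlt
      rw [gradeTrace_heisMode_neg_mul hv (by omega), coeff_lambert_mul_of_lt (by omega)] at hne
      simp at hne
    · intro i _ _ j _ _ hij
      omega
    · intro k hk hne
      rw [Finset.mem_range] at hk
      have hmk : (m : ℕ) - 1 ≤ k := by
        by_contra hlt
        rw [show ((k + 1 : ℕ) : ℤ) - 1 = (k : ℤ) by push_cast; ring, Ring.choose_natCast,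
          Nat.choose_eq_zero_of_lt (by omega)] at hne
        simp at hne
      refine ⟨k + 1 - m, Finset.mem_range.mpr (by omega), ?_, by omega⟩
      rw [gradeTrace_heisMode_neg_mul hv (by omega), assocCoeff_eq]
      rw [show (m : ℕ) + (k + 1 - m) = k + 1 by omega]
      rw [show ((k + 1 : ℕ) : ℤ) - 1 = (k : ℤ) by push_cast; ring, Ring.choose_natCast] at hne
      rw [show k + 1 - 1 = k by omega, show k + 1 - (m : ℕ) = k - (m - 1) by omega,
        Nat.choose_symm hmk, mul_neg]
      exact_mod_cast hne
    · intro i _ _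
      rw [gradeTrace_heisMode_neg_mul hv (by omega), assocCoeff_eq,
        show ((m + i - 1 + 1 : ℕ) : ℤ) - 1 = ((m + i - 1 : ℕ) : ℤ) by push_cast; ring,
        Ring.choose_natCast, mul_neg, show (m : ℕ) + i - 1 + 1 = m + i by omega,
        ← Nat.choose_symm (show i ≤ (m : ℕ) + i - 1 by omega),
        show (m : ℕ) + i - 1 - i = m - 1 by omega]
      push_cast
      rfl
  have h3 : ∑ i ∈ Finset.range (d + 1), assocCoeff m i *
      ((-1) ^ (m : ℕ) * gradeTrace d ((heisY v).ncoeff (h - 1 - i) * heisMode i)) =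
      -∑ k ∈ Finset.range d, ((Ring.choose (-((k + 1 : ℕ) : ℤ) - 1) (m - 1 : ℕ) : ℤ) : ℂ) *
        PowerSeries.coeff d (lambert (k + 1) * traceSeries (chooseMode (k + 1 : ℕ) v)) := by
    rw [Finset.sum_range_succ', Nat.cast_zero, heisMode_zero, mul_zero, map_zero, mul_zero, mul_zero,
      add_zero, ← Finset.sum_neg_distrib]
    refine Finset.sum_congr rfl fun k _ => ?_
    rw [gradeTrace_mul_heisMode_pos hv (Nat.succ_pos k), assocCoeff_eq,
      show -((k + 1 : ℕ) : ℤ) - 1 = -((k + 2 : ℕ) : ℤ) by push_cast; ring, Ring.choose_neg,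
      show ((k + 2 : ℕ) : ℤ) + ((m - 1 : ℕ) : ℤ) - 1 = ((k + m : ℕ) : ℤ) by omega,
      Ring.choose_natCast, Units.smul_def, Int.coe_negOnePow_natCast, smul_eq_mul,
      show (m : ℕ) + (k + 1) - 1 = k + m by omega]
    obtain ⟨m', hm'⟩ : ∃ m', (m : ℕ) = m' + 1 := ⟨m - 1, by omega⟩
    rw [hm', ← Nat.choose_symm (show m' + 1 - 1 ≤ k + (m' + 1) by omega),
      show k + (m' + 1) - (m' + 1 - 1) = k + 1 by omega, add_tsub_cancel_right, pow_succ]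
    push_cast
    ring
  rw [h1]
  simp only [mul_sub, Finset.sum_sub_distrib]
  rw [h2, h3]
  simp only [map_sub, mul_smul_comm, PowerSeries.coeff_smul, smul_eq_mul,
    Finset.sum_sub_distrib]
  ring

end Homogeneous

theorem coeff_traceSeries_X_mul (m : ℕ+) (v : Fock) (d : ℕ) :
    PowerSeries.coeff d (traceSeries (X m * v)) = ∑ k ∈ Finset.range d, PowerSeries.coeff d
      (lambert (k + 1) * (((Ring.choose (-((k + 1 : ℕ) : ℤ) - 1) (m - 1 : ℕ) : ℤ) : ℂ) •
        traceSeries (chooseMode (k + 1 : ℕ) v) -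
        ((Ring.choose (((k + 1 : ℕ) : ℤ) - 1) (m - 1 : ℕ) : ℤ) : ℂ) •
          traceSeries (chooseMode (-(k + 1 : ℕ)) v))) := by
  rw [← support_sum_monomial_coeff v]
  generalize v.support = s
  induction s using Finset.induction_on with
  | empty => simp
  | insert e s he ih =>
    rw [Finset.sum_insert he]
    have h := coeff_traceSeries_X_mul_of_mem
      (isWeightedHomogeneous_monomial (fun i : ℕ+ => ((i : ℕ) : ℤ)) e (coeff e v) rfl) m d
    simp only [mul_add, map_add, smul_add] at h ih ⊢
    rw [h, ih, ← Finset.sum_add_distrib]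
    refine Finset.sum_congr rfl fun k _ => ?_
    rw [← map_add]
    congr 1
    simp only [PowerSeries.smul_eq_C_mul]
    ring_nf

/-! ### Zhu's recursion and Eisenstein series -/

theorem sqMode_zero : sqMode 0 = 0 := by
  refine LinearMap.ext fun x => ?_
  obtain ⟨p, rfl⟩ := sqFock_surjective x
  rw [← sqFock_heisMode, heisMode_zero]
  simp

/-- The `q`-expansion of the Eisenstein series `E_k`. -/
def eisensteinSeries (k : ℕ) : PowerSeries ℂ :=
  if Even k then
    PowerSeries.C (-((bernoulli k : ℚ) : ℂ) / (k.factorial : ℂ)) +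
      PowerSeries.C (2 / ((k - 1).factorial : ℂ)) *
        PowerSeries.mk fun n => (ArithmeticFunction.sigma (k - 1) n : ℂ)
  else 0

/-- Lambert's identity `∑ k^j q^k / (1 - q^k) = ∑ σ_j(n) q^n`; up to degree `N` the first `N`
summands suffice. -/
theorem coeff_sum_pow_smul_lambert (j : ℕ) {n N : ℕ} (h : n ≤ N) :
    PowerSeries.coeff n (∑ k ∈ Finset.range N, ((k + 1 : ℕ) : ℂ) ^ j • lambert (k + 1)) =
      (ArithmeticFunction.sigma j n : ℂ) := by
  rw [map_sum, ArithmeticFunction.sigma_apply]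
  simp only [PowerSeries.coeff_smul, lambert, PowerSeries.coeff_mk, smul_eq_mul, mul_ite, mul_one,
    mul_zero]
  rw [← Finset.sum_filter]
  push_cast
  refine Finset.sum_bij (fun k _ => k + 1) ?_ ?_ ?_ ?_
  · intro k hk
    exact Nat.mem_divisors.mpr (Finset.mem_filter.mp hk).2
  · intro k _ l _ hkl
    omega
  · intro d hd
    have hd' := Nat.mem_divisors.mp hd
    have h1 := Nat.le_of_dvd (Nat.pos_of_ne_zero hd'.2) hd'.1
    have h2 := Nat.pos_of_mem_divisors hd
    exact ⟨d - 1, Finset.mem_filter.mpr ⟨Finset.mem_range.mpr (by omega), by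
      rwa [Nat.sub_add_cancel h2]⟩, Nat.sub_add_cancel h2⟩
  · intro k _
    push_cast
    rfl

/-- For fixed `k` the sum over `m` collapses to `(∓k)^n / n!`, and `chooseMode (±k)` expands as `∑
(±k)^l / l! · a[l]`. The two contributions combine with the sign `(-1)^n - (-1)^l`, and summation
over `k` produces `σ_{n+l}`. -/
theorem coeff_traceSeries_creation (n : ℕ) (v : Fock) {M : ℕ} (hM : Annihilated M v) (d : ℕ) :
    PowerSeries.coeff d (traceSeries (∑ m ∈ Finset.range (n + 1),
      modeCoeff (-(n + 1 : ℤ)) (-(m + 1 : ℤ)) • (X m.succPNat * v))) =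
    PowerSeries.coeff d (∑ l ∈ Finset.range M,
      ((((-1 : ℂ) ^ n - (-1) ^ l) / ((n.factorial : ℂ) * (l.factorial : ℂ))) •
        PowerSeries.mk fun N => (ArithmeticFunction.sigma (n + l) N : ℂ)) *
          traceSeries (sqMode l v)) := by
  have h1 : ∀ k : ℕ, ∑ m ∈ Finset.range (n + 1), modeCoeff (-(n + 1 : ℤ)) (-(m + 1 : ℤ)) •
      (lambert (k + 1) * (((Ring.choose (-((k + 1 : ℕ) : ℤ) - 1) m : ℤ) : ℂ) •
        traceSeries (chooseMode (k + 1 : ℕ) v) -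
        ((Ring.choose (((k + 1 : ℕ) : ℤ) - 1) m : ℤ) : ℂ) •
          traceSeries (chooseMode (-(k + 1 : ℕ)) v))) =
      ∑ l ∈ Finset.range M, ((((-1 : ℂ) ^ n - (-1) ^ l) / ((n.factorial : ℂ) * (l.factorial : ℂ))) •
        (((k + 1 : ℕ) : ℂ) ^ (n + l) • lambert (k + 1))) * traceSeries (sqMode l v) := fun k => by
    have e1 := sum_modeCoeff_mul_choose (-((k + 1 : ℕ) : ℤ)) n
    have e2 := sum_modeCoeff_mul_choose ((k + 1 : ℕ) : ℤ) n
    have e3 : ∑ m ∈ Finset.range (n + 1), modeCoeff (-(n + 1 : ℤ)) (-(m + 1 : ℤ)) •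
        (lambert (k + 1) * (((Ring.choose (-((k + 1 : ℕ) : ℤ) - 1) m : ℤ) : ℂ) •
          traceSeries (chooseMode (k + 1 : ℕ) v) -
          ((Ring.choose (((k + 1 : ℕ) : ℤ) - 1) m : ℤ) : ℂ) •
            traceSeries (chooseMode (-(k + 1 : ℕ)) v))) =
        (((-((k + 1 : ℕ) : ℤ) : ℤ) : ℂ) ^ n / (n.factorial : ℂ)) •
          (lambert (k + 1) * traceSeries (chooseMode (k + 1 : ℕ) v)) -
        ((((k + 1 : ℕ) : ℤ) : ℂ) ^ n / (n.factorial : ℂ)) •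
          (lambert (k + 1) * traceSeries (chooseMode (-(k + 1 : ℕ)) v)) := by
      rw [← e1, ← e2, Finset.sum_smul, Finset.sum_smul, ← Finset.sum_sub_distrib]
      refine Finset.sum_congr rfl fun m _ => ?_
      rw [mul_sub, mul_smul_comm, mul_smul_comm, smul_sub, smul_smul, smul_smul]
    rw [e3, chooseMode_eq_sum_sqMode _ hM, chooseMode_eq_sum_sqMode _ hM, map_sum, map_sum,
      Finset.mul_sum, Finset.mul_sum, Finset.smul_sum, Finset.smul_sum, ← Finset.sum_sub_distrib]
    refine Finset.sum_congr rfl fun l _ => ?_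
    rw [map_smul, map_smul, mul_smul_comm, mul_smul_comm, smul_smul, smul_smul, ← sub_smul, smul_smul,
      smul_mul_assoc]
    congr 1
    push_cast
    rw [neg_eq_neg_one_mul, mul_pow, mul_pow, pow_add]
    field_simp
  simp only [map_sum, map_smul, smul_eq_mul, coeff_traceSeries_X_mul]
  simp only [Nat.succPNat_coe, Nat.succ_eq_add_one, add_tsub_cancel_right, Finset.mul_sum]
  rw [Finset.sum_comm]
  have h2 : ∀ k : ℕ, ∑ m ∈ Finset.range (n + 1), modeCoeff (-(n + 1 : ℤ)) (-(m + 1 : ℤ)) *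
      PowerSeries.coeff d (lambert (k + 1) *
        (((Ring.choose (-((k + 1 : ℕ) : ℤ) - 1) m : ℤ) : ℂ) •
        traceSeries (chooseMode (k + 1 : ℕ) v) -
        ((Ring.choose (((k + 1 : ℕ) : ℤ) - 1) m : ℤ) : ℂ) •
          traceSeries (chooseMode (-(k + 1 : ℕ)) v))) =
      PowerSeries.coeff d (∑ l ∈ Finset.range M,
        ((((-1 : ℂ) ^ n - (-1) ^ l) / ((n.factorial : ℂ) * (l.factorial : ℂ))) •
          (((k + 1 : ℕ) : ℂ) ^ (n + l) • lambert (k + 1))) * traceSeries (sqMode l v)) := fun k => by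
    rw [← h1 k]
    simp only [map_sum, PowerSeries.coeff_smul, smul_eq_mul]
  rw [Finset.sum_congr rfl fun k _ => h2 k]
  simp only [map_sum]
  rw [Finset.sum_comm]
  refine Finset.sum_congr rfl fun l _ => ?_
  rw [← map_sum, ← Finset.sum_mul, ← Finset.smul_sum, smul_mul_assoc, smul_mul_assoc,
    PowerSeries.coeff_smul, PowerSeries.coeff_smul, PowerSeries.coeff_mul, PowerSeries.coeff_mul]
  congr 1
  refine Finset.sum_congr rfl fun ij hij => ?_
  have hij := Finset.HasAntidiagonal.mem_antidiagonal.mp hij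
  rw [coeff_sum_pow_smul_lambert (n + l) (show ij.1 ≤ d by omega), PowerSeries.coeff_mk]

/-- The annihilation part of `a[-n-1] v`. -/
theorem sum_modeCoeff_smul_heisMode (n : ℕ) (v : Fock) {M : ℕ} (hM : Annihilated M v) :
    ∑ i ∈ Finset.Ico 1 (M : ℤ), modeCoeff (-(n + 1 : ℤ)) i • heisMode i v =
      ∑ l ∈ Finset.Ico 1 M, ((-1) ^ (n + 1) * ((n + l).choose l : ℂ) *
        ((bernoulli (n + 1 + l) : ℚ) : ℂ) / ((n + 1 + l).factorial : ℂ)) • sqMode l v := by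
  have h1 : ∀ i ∈ Finset.Ico 1 (M : ℤ), heisMode i v =
      ∑ l ∈ Finset.Ico 1 M, (expSubOne ^ i).coeff l • sqMode l v := fun i hi => by
    rw [Finset.mem_Ico] at hi
    rw [heisMode_eq_sum_sqMode hM i]
    refine Eq.trans ?_ (Finset.sum_map (Finset.Ico 1 M) Nat.castEmbedding
      fun l : ℤ => (expSubOne ^ i).coeff l • sqMode l v)
    refine Finset.sum_subset (fun l hl => ?_) fun l hl hl' => ?_
    · rw [Finset.mem_Ico] at hl
      exact Finset.mem_map.mpr ⟨l.toNat, Finset.mem_Ico.mpr (by omega), by simp; omega⟩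
    · obtain ⟨l, hl2, rfl⟩ := Finset.mem_map.mp hl
      rw [Finset.mem_Ico] at hl2
      rw [Finset.mem_Ico] at hl'
      rw [vanishBelow_expSubOne_zpow i _ (by simp at hl' ⊢; omega), zero_smul]
  rw [Finset.sum_congr rfl fun i hi => by rw [h1 i hi, Finset.smul_sum], Finset.sum_comm]
  refine Finset.sum_congr rfl fun l hl => ?_
  rw [Finset.mem_Ico] at hl
  rw [← sum_modeCoeff_mul_coeff n l (by omega) (s := Finset.Ico 1 (M : ℤ)) (fun i hi => by
    rw [Finset.mem_Icc] at hi; rw [Finset.mem_Ico]; omega) fun i hi => (Finset.mem_Ico.mp hi).1,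
    Finset.sum_smul]
  exact Finset.sum_congr rfl fun i _ => smul_smul _ _ _

/-- Zhu's recursion formula for the Heisenberg vector. -/
theorem traceSeries_sqMode_neg (n : ℕ) (v : Fock) {M : ℕ} (hM : Annihilated M v) :
    traceSeries (sqMode (-(n + 1 : ℤ)) v) = ∑ l ∈ Finset.Ico 1 M,
      ((-1 : ℂ) ^ (l + 1) * ((n + l).choose l : ℂ)) • (eisensteinSeries (n + 1 + l) *
        traceSeries (sqMode l v)) := by
  have hsplit : sqMode (-(n + 1 : ℤ)) v = ∑ m ∈ Finset.range (n + 1),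
      modeCoeff (-(n + 1 : ℤ)) (-(m + 1 : ℤ)) • (X m.succPNat * v) +
      ∑ i ∈ Finset.Ico 1 (M : ℤ), modeCoeff (-(n + 1 : ℤ)) i • heisMode i v := by
    rw [sqMode_eq_sum (M := (M : ℤ) + 1) (hM.mono (by omega)) le_rfl,
      ← Finset.Ico_union_Ico_eq_Ico (b := 0) (by omega) (by omega),
      Finset.sum_union (Finset.Ico_disjoint_Ico_consecutive _ _ _)]
    congr 1
    · refine Finset.sum_nbij' (fun i => (-i - 1).toNat) (fun m => -((m : ℤ) + 1)) ?_ ?_ ?_ ?_ ?_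
      · intro i hi
        rw [Finset.mem_Ico] at hi
        rw [Finset.mem_range]
        omega
      · intro m hm
        rw [Finset.mem_range] at hm
        rw [Finset.mem_Ico]
        omega
      · intro i hi
        rw [Finset.mem_Ico] at hi
        omega
      · intro m hm
        omega
      · intro i hi
        rw [Finset.mem_Ico] at hi
        obtain ⟨m, rfl⟩ : ∃ m : ℕ, i = -((m : ℤ) + 1) := ⟨(-i - 1).toNat, by omega⟩
        rw [show (-(-((m : ℤ) + 1)) - 1).toNat = m by omega, ← heisMode_neg, Nat.succPNat_coe]
        push_cast
        rfl
    · symm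
      refine Finset.sum_subset (fun i hi => ?_) fun i hi hi' => ?_
      · rw [Finset.mem_Ico] at hi ⊢
        omega
      · rw [Finset.mem_Ico] at hi hi'
        rcases eq_or_ne i 0 with rfl | h0
        · rw [heisMode_zero, LinearMap.zero_apply, smul_zero]
        · rw [hM i (by omega), smul_zero]
  rw [hsplit, map_add, sum_modeCoeff_smul_heisMode n v hM]
  ext d
  rw [map_add, coeff_traceSeries_creation n v hM, ← map_add]
  congr 1
  rcases Nat.eq_zero_or_pos M with rfl | hMpos
  · simp
  -- The term `l = 0` drops out because `a[0] = 0`; in particular no Eisenstein series with `l = 0`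
  -- occurs.
  rw [Finset.range_eq_Ico, Finset.sum_eq_sum_Ico_succ_bot hMpos, Nat.cast_zero, sqMode_zero,
    LinearMap.zero_apply, map_zero, mul_zero, zero_add, map_sum, ← Finset.sum_add_distrib]
  refine Finset.sum_congr rfl fun l hl => ?_
  rw [Finset.mem_Ico] at hl
  rw [map_smul, ← smul_mul_assoc, PowerSeries.smul_eq_C_mul (traceSeries _), ← add_mul]
  congr 1
  rw [eisensteinSeries]
  have hch : ((n + l).choose l : ℂ) * (n.factorial * l.factorial) = ((n + l).factorial : ℂ) := by
    rw [← mul_assoc]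
    exact_mod_cast Nat.add_choose_mul_factorial_mul_factorial n l
  have hn : (n.factorial : ℂ) ≠ 0 := by exact_mod_cast n.factorial_ne_zero
  have hl' : (l.factorial : ℂ) ≠ 0 := by exact_mod_cast l.factorial_ne_zero
  have hnl : ((n + l).factorial : ℂ) ≠ 0 := by exact_mod_cast (n + l).factorial_ne_zero
  rw [show n + 1 + l - 1 = n + l by omega]
  split_ifs with heven
  · have hpar : (-1 : ℂ) ^ n = (-1) ^ (l + 1) := by
      have : Even (n + (l + 1)) := by rwa [show n + (l + 1) = n + 1 + l by ring]
      rw [← mul_left_inj' (pow_ne_zero (l + 1) (neg_ne_zero.mpr (one_ne_zero (α := ℂ)))), ← pow_add,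
        ← pow_add, this.neg_one_pow, (Even.add_self (l + 1)).neg_one_pow]
    simp only [PowerSeries.smul_eq_C_mul]
    rw [mul_add, ← mul_assoc, ← map_mul, ← map_mul, add_comm]
    congr 2
    · rw [pow_succ, hpar]
      ring
    · congr 1
      have hc : ((n + l).choose l : ℂ) ≠ 0 := left_ne_zero_of_mul (hch.trans_ne hnl)
      rw [hpar, pow_succ, ← hch]
      field_simp
      ring
  · have hb : bernoulli (n + 1 + l) = 0 :=
      bernoulli_eq_zero_of_odd (Nat.not_even_iff_odd.mp heven) (by
        by_contra hlt
        exact heven (by rw [show n + 1 + l = 2 by omega]; exact even_two))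
    have hpar : (-1 : ℂ) ^ n = (-1) ^ l := by
      have : Even (n + l) := by
        rw [show n + 1 + l = (n + l) + 1 by ring, Nat.even_add_one, not_not] at heven
        exact heven
      rw [← mul_left_inj' (pow_ne_zero l (neg_ne_zero.mpr (one_ne_zero (α := ℂ)))), ← pow_add,
        ← pow_add, this.neg_one_pow, (Even.add_self l).neg_one_pow]
    rw [hb, hpar]
    simp

/-! ## Evaluation of power series -/

/-- Absolute convergence of a power series at `z`. -/
def AbsConv (z : ℂ) (f : PowerSeries ℂ) : Prop :=
  Summable fun n : ℕ => ‖PowerSeries.coeff n f * z ^ n‖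

/-- The sum of a power series at `z`. -/
def evalAt (z : ℂ) (f : PowerSeries ℂ) : ℂ := ∑' n : ℕ, PowerSeries.coeff n f * z ^ n

section Eval

variable {z : ℂ} {f g : PowerSeries ℂ}

theorem AbsConv.summable (hf : AbsConv z f) : Summable fun n : ℕ => PowerSeries.coeff n f * z ^ n :=
  Summable.of_norm hf

theorem AbsConv.add (hf : AbsConv z f) (hg : AbsConv z g) : AbsConv z (f + g) := by
  refine Summable.of_nonneg_of_le (fun _ => norm_nonneg _) (fun n => ?_) (Summable.add hf hg)
  rw [map_add, add_mul]
  exact norm_add_le _ _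

theorem AbsConv.smul (c : ℂ) (hf : AbsConv z f) : AbsConv z (c • f) := by
  refine (Summable.mul_left ‖c‖ hf).congr fun n => ?_
  rw [PowerSeries.coeff_smul, smul_eq_mul, mul_assoc, norm_mul c]

theorem absConv_zero : AbsConv z 0 := by
  simp [AbsConv]

theorem AbsConv.sum {ι : Type*} {s : Finset ι} {F : ι → PowerSeries ℂ}
    (h : ∀ i ∈ s, AbsConv z (F i)) : AbsConv z (∑ i ∈ s, F i) :=
  Finset.sum_induction F (AbsConv z) (fun _ _ => AbsConv.add) absConv_zero h

theorem coeff_mul_mul_pow (z : ℂ) (f g : PowerSeries ℂ) (n : ℕ) :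
    PowerSeries.coeff n (f * g) * z ^ n = ∑ ij ∈ Finset.HasAntidiagonal.antidiagonal n,
      (PowerSeries.coeff ij.1 f * z ^ ij.1) * (PowerSeries.coeff ij.2 g * z ^ ij.2) := by
  rw [PowerSeries.coeff_mul, Finset.sum_mul]
  refine Finset.sum_congr rfl fun ij hij => ?_
  rw [← Finset.HasAntidiagonal.mem_antidiagonal.mp hij, pow_add]
  ring

theorem AbsConv.mul (hf : AbsConv z f) (hg : AbsConv z g) : AbsConv z (f * g) := by
  refine (summable_norm_sum_mul_antidiagonal_of_summable_norm hf hg).congr fun n => ?_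
  rw [coeff_mul_mul_pow]

theorem evalAt_mul (hf : AbsConv z f) (hg : AbsConv z g) :
    evalAt z (f * g) = evalAt z f * evalAt z g := by
  rw [evalAt, evalAt, evalAt, tsum_mul_tsum_eq_tsum_sum_antidiagonal_of_summable_norm hf hg]
  exact tsum_congr fun n => coeff_mul_mul_pow z f g n

theorem evalAt_add (hf : AbsConv z f) (hg : AbsConv z g) :
    evalAt z (f + g) = evalAt z f + evalAt z g := by
  rw [evalAt, evalAt, evalAt, ← hf.summable.tsum_add hg.summable]
  exact tsum_congr fun n => by rw [map_add, add_mul]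

theorem evalAt_smul (c : ℂ) : evalAt z (c • f) = c * evalAt z f := by
  rw [evalAt, evalAt, ← tsum_mul_left]
  exact tsum_congr fun n => by rw [PowerSeries.coeff_smul, smul_eq_mul, mul_assoc]

theorem evalAt_zero : evalAt z 0 = 0 := by
  simp [evalAt]

theorem evalAt_sum {ι : Type*} {s : Finset ι} {F : ι → PowerSeries ℂ}
    (h : ∀ i ∈ s, AbsConv z (F i)) : evalAt z (∑ i ∈ s, F i) = ∑ i ∈ s, evalAt z (F i) := by
  classical
  induction s using Finset.induction_on with
  | empty => simp [evalAt_zero]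
  | insert i s hi ih =>
    rw [Finset.sum_insert hi, Finset.sum_insert hi, evalAt_add (h i (Finset.mem_insert_self i s))
      (AbsConv.sum fun j hj => h j (Finset.mem_insert_of_mem hj)),
      ih fun j hj => h j (Finset.mem_insert_of_mem hj)]

theorem absConv_C (c : ℂ) : AbsConv z (PowerSeries.C c) := by
  refine summable_of_hasFiniteSupport ((Set.finite_singleton 0).subset fun n hn => ?_)
  by_contra h
  exact hn (by simp [PowerSeries.coeff_C, show n ≠ 0 from h])

theorem evalAt_C (c : ℂ) : evalAt z (PowerSeries.C c) = c := by
  rw [evalAt, tsum_eq_single 0 fun n hn => by simp [PowerSeries.coeff_C, hn]]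
  simp

theorem absConv_X_pow (k : ℕ) : AbsConv z (PowerSeries.X ^ k) := by
  refine summable_of_hasFiniteSupport ((Set.finite_singleton k).subset fun n hn => ?_)
  by_contra h
  exact hn (by simp [PowerSeries.coeff_X_pow, show n ≠ k from h])

theorem evalAt_X_pow (k : ℕ) : evalAt z (PowerSeries.X ^ k) = z ^ k := by
  rw [evalAt, tsum_eq_single k fun n hn => by simp [PowerSeries.coeff_X_pow, hn]]
  simp [PowerSeries.coeff_X_pow]

theorem absConv_of_le_pow (hz : ‖z‖ < 1) (k : ℕ) (h : ∀ n, ‖PowerSeries.coeff n f‖ ≤ (n : ℝ) ^ k) :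
    AbsConv z f := by
  refine Summable.of_nonneg_of_le (fun _ => norm_nonneg _) (fun n => ?_)
    (summable_norm_pow_mul_geometric_of_norm_lt_one k hz)
  rw [norm_mul, norm_mul, norm_pow (n : ℂ), Complex.norm_natCast]
  exact mul_le_mul_of_nonneg_right (h n) (norm_nonneg _)

end Eval

/-! ## Eisenstein series -/

theorem absConv_sigma {z : ℂ} (hz : ‖z‖ < 1) (k : ℕ) :
    AbsConv z (PowerSeries.mk fun n => (ArithmeticFunction.sigma k n : ℂ)) :=
  absConv_of_le_pow hz (k + 1) fun n => by
    rw [PowerSeries.coeff_mk, Complex.norm_natCast]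
    exact_mod_cast ArithmeticFunction.sigma_le_pow_succ k n

theorem absConv_eisensteinSeries {z : ℂ} (hz : ‖z‖ < 1) (k : ℕ) : AbsConv z (eisensteinSeries k) := by
  rw [eisensteinSeries]
  split_ifs
  · exact (absConv_C _).add ((absConv_C _).mul (absConv_sigma hz _))
  · exact absConv_zero

/-- The nome `q = e^{2 π i τ}`. -/
def nome (τ : UpperHalfPlane) : ℂ := Complex.exp (2 * Real.pi * Complex.I * τ)

theorem norm_nome_lt_one (τ : UpperHalfPlane) : ‖nome τ‖ < 1 :=
  UpperHalfPlane.norm_exp_two_pi_I_lt_one τ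

theorem evalAt_eisensteinSeries (k : ℕ) (τ : UpperHalfPlane) :
    evalAt (nome τ) (eisensteinSeries k) = eisenstein k τ := by
  rw [eisensteinSeries, eisenstein]
  split_ifs
  · have hs := absConv_sigma (norm_nome_lt_one τ) (k - 1)
    rw [evalAt_add (absConv_C _) ((absConv_C _).mul hs), evalAt_mul (absConv_C _) hs, evalAt_C, evalAt_C]
    congr 2
    rw [evalAt, hs.summable.tsum_eq_zero_add, ← tsum_pnat_eq_tsum_succ
      (f := fun n => PowerSeries.coeff n (PowerSeries.mk fun n =>
        (ArithmeticFunction.sigma (k - 1) n : ℂ)) * nome τ ^ n)]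
    simp only [PowerSeries.coeff_mk, ArithmeticFunction.map_zero, Nat.cast_zero, zero_mul, zero_add]
    refine tsum_congr fun n => ?_
    rw [nome, ← Complex.exp_nat_mul]
    congr 2
    ring
  · exact evalAt_zero

/-! ## The graded dimension -/

open scoped Classical in
/-- The exponents of weight `r` supported on `{1, …, N}`. -/
def boundedExps (N r : ℕ) : Finset (ℕ+ →₀ ℕ) :=
  {e ∈ expsOfWeight r | ∀ i : ℕ+, N < i → e i = 0}

theorem mem_boundedExps {N r : ℕ} {e : ℕ+ →₀ ℕ} :
    e ∈ boundedExps N r ↔ expWeight e = r ∧ ∀ i : ℕ+, N < i → e i = 0 := by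
  classical
  rw [boundedExps, Finset.mem_filter, mem_expsOfWeight]

theorem boundedExps_of_le {N r : ℕ} (h : r ≤ N) : boundedExps N r = expsOfWeight r := by
  ext e
  rw [mem_boundedExps, mem_expsOfWeight, and_iff_left_iff_imp]
  intro he i hi
  have := mul_le_expWeight e i
  by_contra h0
  have := Nat.mul_le_mul_right (i : ℕ) (Nat.one_le_iff_ne_zero.mpr h0)
  omega

/-- The generating series of `card (boundedExps N r)`. -/
def boundedSeries (N : ℕ) : PowerSeries ℂ := PowerSeries.mk fun r => ((boundedExps N r).card : ℂ)

theorem boundedSeries_zero : boundedSeries 0 = 1 := by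
  ext r
  rw [boundedSeries, PowerSeries.coeff_mk, PowerSeries.coeff_one]
  have h : ∀ e, e ∈ boundedExps 0 r ↔ e = 0 ∧ r = 0 := fun e => by
    rw [mem_boundedExps]
    constructor
    · rintro ⟨h1, h2⟩
      have : e = 0 := Finsupp.ext fun i => h2 i i.pos
      subst this
      exact ⟨rfl, by rw [← h1]; simp [expWeight]⟩
    · rintro ⟨rfl, rfl⟩
      exact ⟨by simp [expWeight], fun _ _ => rfl⟩
  split_ifs with hr
  · rw [show boundedExps 0 r = {0} by ext e; rw [h, Finset.mem_singleton, and_iff_left hr],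
      Finset.card_singleton, Nat.cast_one]
  · rw [Finset.card_eq_zero.mpr (Finset.eq_empty_of_forall_notMem fun e he => hr ((h e).mp he).2),
      Nat.cast_zero]

/-- A partition into parts at most `N + 1` either avoids the part `N + 1`, or loses one copy of it.
-/
theorem boundedSeries_succ (N : ℕ) :
    boundedSeries (N + 1) = boundedSeries N + PowerSeries.X ^ (N + 1) * boundedSeries (N + 1) := by
  classical
  ext r
  set i : ℕ+ := N.succPNat with hi
  have hiN : (i : ℕ) = N + 1 := Nat.succPNat_coe N
  rw [map_add, PowerSeries.coeff_X_pow_mul']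
  simp only [boundedSeries, PowerSeries.coeff_mk]
  rw [← Finset.card_filter_add_card_filter_not (s := boundedExps (N + 1) r) fun e => e i = 0]
  have h1 : (boundedExps (N + 1) r).filter (fun e => e i = 0) = boundedExps N r := by
    ext e
    rw [Finset.mem_filter, mem_boundedExps, mem_boundedExps, and_assoc]
    refine and_congr_right fun _ => ⟨fun h j hj => ?_, fun h => ⟨fun j hj => h j (by omega), h i (by omega)⟩⟩
    rcases eq_or_ne (j : ℕ) (N + 1) with hj' | hj'
    · rw [show j = i from PNat.eq (hj'.trans hiN.symm)]
      exact h.2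
    · exact h.1 j (by omega)
  have hw : ∀ f, expWeight (Finsupp.single i 1 + f) = N + 1 + expWeight f := fun f => by
    rw [expWeight_add, expWeight_single, one_mul, hiN]
  rw [h1, Nat.cast_add]
  congr 1
  split_ifs with h
  · norm_cast
    refine Finset.card_bij' (fun e _ => e - Finsupp.single i 1) (fun f _ => Finsupp.single i 1 + f)
      ?_ ?_ ?_ ?_
    · intro e he
      rw [Finset.mem_filter, mem_boundedExps] at he
      have hle : Finsupp.single i 1 ≤ e := by
        rw [Finsupp.single_le_iff]
        exact Nat.one_le_iff_ne_zero.mpr he.2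
      have := hw (e - Finsupp.single i 1)
      rw [add_tsub_cancel_of_le hle, he.1.1] at this
      refine mem_boundedExps.mpr ⟨by omega, fun j hj => ?_⟩
      rw [Finsupp.tsub_apply, he.1.2 j hj, zero_tsub]
    · intro f hf
      rw [mem_boundedExps] at hf
      refine Finset.mem_filter.mpr ⟨mem_boundedExps.mpr ⟨by rw [hw, hf.1]; omega, fun j hj => ?_⟩, ?_⟩
      · have : i ≠ j := fun h => by rw [← h] at hj; omega
        rw [Finsupp.add_apply, Finsupp.single_eq_of_ne this.symm, hf.2 j hj]
      · simp
    · intro e he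
      rw [Finset.mem_filter] at he
      refine add_tsub_cancel_of_le ?_
      rw [Finsupp.single_le_iff]
      exact Nat.one_le_iff_ne_zero.mpr he.2
    · intro f _
      exact add_tsub_cancel_left _ _
  · rw [Finset.card_eq_zero.mpr, Nat.cast_zero]
    refine Finset.eq_empty_of_forall_notMem fun e he => h ?_
    rw [Finset.mem_filter, mem_boundedExps] at he
    have h2 := mul_le_expWeight e i
    have h3 := Nat.mul_le_mul_right (i : ℕ) (Nat.one_le_iff_ne_zero.mpr he.2)
    omega

/-- The recursion gives `boundedSeries (N + 1)` as `boundedSeries N` plus its product with a Lambert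
series, and so propagates convergence without dividing by `1 - z^(N+1)`. -/
theorem absConv_boundedSeries {z : ℂ} (hz : ‖z‖ < 1) (N : ℕ) : AbsConv z (boundedSeries N) := by
  induction N with
  | zero =>
    rw [boundedSeries_zero, ← map_one PowerSeries.C]
    exact absConv_C 1
  | succ N ih =>
    have h := eq_lambert_mul (Nat.succ_pos N)
      (f := fun d => PowerSeries.coeff d (boundedSeries (N + 1) - boundedSeries N))
      (g := fun d => PowerSeries.coeff d (boundedSeries N)) (fun d hd => by
        rw [boundedSeries_succ, add_sub_cancel_left, PowerSeries.coeff_X_pow_mul', if_neg (by omega)])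
      fun d => by
        rw [← map_add, sub_add_cancel]
        conv_lhs => rw [boundedSeries_succ, add_sub_cancel_left]
        rw [PowerSeries.coeff_X_pow_mul', if_pos (by omega), Nat.add_sub_cancel]
    have h2 : ∀ f : PowerSeries ℂ, (PowerSeries.mk fun d => PowerSeries.coeff d f) = f := fun f => by
      ext n
      simp
    rw [h2, h2, sub_eq_iff_eq_add] at h
    rw [h]
    refine AbsConv.add (AbsConv.mul (absConv_of_le_pow hz 0 fun n => ?_) ih) ih
    rw [lambert, PowerSeries.coeff_mk]
    split_ifs <;> simp

theorem one_sub_pow_ne_zero {z : ℂ} (hz : ‖z‖ < 1) (n : ℕ) : 1 - z ^ (n + 1) ≠ 0 := fun h => by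
  have h1 : ‖z ^ (n + 1)‖ < 1 := by
    rw [norm_pow]
    exact pow_lt_one₀ (norm_nonneg _) hz n.succ_ne_zero
  rw [← sub_eq_zero.mp h, norm_one] at h1
  exact lt_irrefl _ h1

theorem evalAt_boundedSeries {z : ℂ} (hz : ‖z‖ < 1) (N : ℕ) :
    evalAt z (boundedSeries N) = (∏ n ∈ Finset.range N, (1 - z ^ (n + 1)))⁻¹ := by
  induction N with
  | zero => rw [boundedSeries_zero, ← map_one PowerSeries.C, evalAt_C, Finset.prod_range_zero, inv_one]
  | succ N ih =>
    have h := congrArg (evalAt z) (boundedSeries_succ N)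
    rw [evalAt_add (absConv_boundedSeries hz N) ((absConv_X_pow _).mul (absConv_boundedSeries hz _)),
      evalAt_mul (absConv_X_pow _) (absConv_boundedSeries hz _), evalAt_X_pow, ih] at h
    rw [Finset.prod_range_succ, mul_inv, ← div_eq_mul_inv, eq_div_iff (one_sub_pow_ne_zero hz N)]
    linear_combination h

theorem tprod_one_sub_pow_ne_zero {z : ℂ} (hz : ‖z‖ < 1) : ∏' n : ℕ, (1 - z ^ (n + 1)) ≠ 0 := by
  refine tprod_one_add_ne_zero_of_summable (f := fun n : ℕ => -z ^ (n + 1)) (fun n => ?_) ?_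
  · rw [← sub_eq_add_neg]
    exact one_sub_pow_ne_zero hz n
  · simp only [norm_neg, norm_pow]
    exact (summable_nat_add_iff 1).mpr (summable_geometric_of_lt_one (norm_nonneg _) hz)

theorem tendsto_evalAt_boundedSeries {z : ℂ} (hz : ‖z‖ < 1) :
    Tendsto (fun N => evalAt z (boundedSeries N)) atTop (nhds (∏' n : ℕ, (1 - z ^ (n + 1)))⁻¹) := by
  simp only [evalAt_boundedSeries hz]
  exact (ModularForm.multipliable_one_sub_pow hz).hasProd.tendsto_prod_nat.inv₀
    (tprod_one_sub_pow_ne_zero hz)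

/-- The generating series of the dimensions of the `V_n`. -/
def dimSeries : PowerSeries ℂ := PowerSeries.mk fun r => ((expsOfWeight r).card : ℂ)

theorem coeff_boundedSeries_of_le {N r : ℕ} (h : r ≤ N) :
    PowerSeries.coeff r (boundedSeries N) = PowerSeries.coeff r dimSeries := by
  rw [boundedSeries, dimSeries, PowerSeries.coeff_mk, PowerSeries.coeff_mk, boundedExps_of_le h]

theorem norm_coeff_boundedSeries_le (N r : ℕ) :
    ‖PowerSeries.coeff r (boundedSeries N)‖ ≤ ‖PowerSeries.coeff r dimSeries‖ := by
  rw [boundedSeries, dimSeries, PowerSeries.coeff_mk, PowerSeries.coeff_mk, Complex.norm_natCast,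
    Complex.norm_natCast]
  exact_mod_cast Finset.card_le_card fun e he =>
    mem_expsOfWeight.mpr (mem_boundedExps.mp he).1

/-- The `n`-th partial sum of absolute values is at most the value of `boundedSeries n` at `‖z‖`.
These values converge to the infinite product, so they are bounded. -/
theorem absConv_dimSeries {z : ℂ} (hz : ‖z‖ < 1) : AbsConv z dimSeries := by
  have hρ : ‖((‖z‖ : ℝ) : ℂ)‖ < 1 := by simpa using hz
  obtain ⟨K, hK⟩ := (tendsto_evalAt_boundedSeries hρ).norm.bddAbove_range
  refine summable_of_sum_range_le (c := K) (fun _ => norm_nonneg _) fun n => ?_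
  refine le_trans ?_ (hK ⟨n, rfl⟩)
  have h1 : ∀ r : ℕ, PowerSeries.coeff r (boundedSeries n) * ((‖z‖ : ℝ) : ℂ) ^ r =
      ((‖PowerSeries.coeff r (boundedSeries n) * z ^ r‖ : ℝ) : ℂ) := fun r => by
    rw [boundedSeries, PowerSeries.coeff_mk, norm_mul, Complex.norm_natCast, norm_pow]
    push_cast
    rfl
  have h2 : evalAt ((‖z‖ : ℝ) : ℂ) (boundedSeries n) =
      ((∑' r : ℕ, ‖PowerSeries.coeff r (boundedSeries n) * z ^ r‖ : ℝ) : ℂ) := by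
    rw [evalAt, Complex.ofReal_tsum]
    exact tsum_congr h1
  change _ ≤ ‖evalAt _ _‖
  rw [h2, Complex.norm_real, Real.norm_of_nonneg (tsum_nonneg fun _ => norm_nonneg _)]
  refine le_trans (le_of_eq ?_)
    ((absConv_boundedSeries hz n).sum_le_tsum (Finset.range n) fun _ _ => norm_nonneg _)
  refine Finset.sum_congr rfl fun r hr => ?_
  rw [coeff_boundedSeries_of_le (Finset.mem_range.mp hr).le]

/-- Coefficients of `boundedSeries N` stabilize and are dominated by those of `dimSeries`, so the
limit in `N` may be taken termwise. -/
theorem evalAt_dimSeries {z : ℂ} (hz : ‖z‖ < 1) :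
    evalAt z dimSeries = (∏' n : ℕ, (1 - z ^ (n + 1)))⁻¹ := by
  refine tendsto_nhds_unique ?_ (tendsto_evalAt_boundedSeries hz)
  refine tendsto_tsum_of_dominated_convergence (absConv_dimSeries hz) (fun r => ?_)
    (Eventually.of_forall fun N r => ?_)
  · exact tendsto_const_nhds.congr' ((eventually_ge_atTop r).mono fun N hN => by
      dsimp only
      rw [coeff_boundedSeries_of_le hN])
  · rw [norm_mul, norm_mul]
    exact mul_le_mul_of_nonneg_right (norm_coeff_boundedSeries_le N r) (norm_nonneg _)

theorem finrank_fockGrade (n : ℕ) : Module.finrank ℂ (fockGrade n) = (expsOfWeight n).card := by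
  have hli : LinearIndependent ℂ fun e : expsOfWeight n => (monomial (e : ℕ+ →₀ ℕ) 1 : Fock) := by
    have := (basisMonomials ℕ+ ℂ).linearIndependent.comp (fun e : expsOfWeight n => (e : ℕ+ →₀ ℕ))
      Subtype.val_injective
    rwa [coe_basisMonomials] at this
  have hspan : fockGrade n = Submodule.span ℂ
      (Set.range fun e : expsOfWeight n => (monomial (e : ℕ+ →₀ ℕ) 1 : Fock)) := by
    refine le_antisymm (fun p hp => ?_) (Submodule.span_le.mpr ?_)
    · rw [← support_sum_monomial_coeff p]
      refine Submodule.sum_mem _ fun e he => ?_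
      rw [← mul_one (coeff e p), ← smul_eq_mul, ← smul_monomial]
      have := hp (mem_support_iff.mp he)
      rw [← coe_expWeight, Nat.cast_inj] at this
      exact Submodule.smul_mem _ _ (Submodule.subset_span ⟨⟨e, mem_expsOfWeight.mpr this⟩, rfl⟩)
    · rintro _ ⟨e, rfl⟩
      refine isWeightedHomogeneous_monomial _ _ _ ?_
      rw [← coe_expWeight, mem_expsOfWeight.mp e.2]
  rw [hspan, finrank_span_eq_card hli, Fintype.card_coe]

theorem traceSeries_one : traceSeries 1 = dimSeries := by
  ext n
  rw [coeff_traceSeries_of_mem one_mem_fockGrade, dimSeries, PowerSeries.coeff_mk,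
    gradeTrace_congr (A' := LinearMap.id) fun x _ => by
      rw [heisY_one, ncoeff_idField, if_pos (by norm_num)]; rfl, ← finrank_fockGrade]
  have : fockProj n ∘ₗ LinearMap.id ∘ₗ (fockGrade n).subtype = LinearMap.id := by
    ext1 x
    exact fockProj_of_mem x.2
  change LinearMap.trace ℂ (fockGrade n) (fockProj n ∘ₗ LinearMap.id ∘ₗ (fockGrade n).subtype) = _
  rw [this]
  exact LinearMap.trace_id ℂ _

/-! ## One-point functions -/

theorem heisMode_monomial (l : ℕ+) (e : ℕ+ →₀ ℕ) : heisMode l (monomial e 1) =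
    (((l : ℕ) : ℂ) * e l) • (monomial (e - Finsupp.single l 1) 1 : Fock) := by
  rw [heisMode_pos, pderiv_monomial, smul_monomial, smul_monomial, one_mul, smul_eq_mul, smul_eq_mul,
    mul_one]

theorem expWeight_tsub_le (e f : ℕ+ →₀ ℕ) : expWeight (e - f) ≤ expWeight e := by
  have h : e - f + (e - (e - f)) = e := add_tsub_cancel_of_le tsub_le_self
  have := expWeight_add (e - f) (e - (e - f))
  rw [h] at this
  omega

theorem exists_eq_single_add {e : ℕ+ →₀ ℕ} (he : e ≠ 0) :
    ∃ m f, e = Finsupp.single m 1 + f := by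
  obtain ⟨m, hm⟩ := Finsupp.ne_iff.mp he
  exact ⟨m, e - Finsupp.single m 1, (add_tsub_cancel_of_le
    (Finsupp.single_le_iff.mpr (Nat.one_le_iff_ne_zero.mpr hm))).symm⟩

/-- On square bracket Fock vectors `a[l]` acts as `l ∂/∂x_l`, so Zhu's recursion becomes Wick's: the
mode `a[-m]` is contracted with each remaining mode. -/
theorem traceSeries_sqFock_single_add (m : ℕ+) (e : ℕ+ →₀ ℕ) :
    traceSeries (sqFock (monomial (Finsupp.single m 1 + e) 1)) = ∑ l ∈ e.support,
      ((-1 : ℂ) ^ ((l : ℕ) + 1) * (((m + l - 1 : ℕ).factorial : ℂ) /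
        (((m - 1 : ℕ).factorial : ℂ) * ((l - 1 : ℕ).factorial : ℂ))) * e l) •
      (eisensteinSeries (m + l) *
        traceSeries (sqFock (monomial (e - Finsupp.single l 1) 1))) := by
  obtain ⟨M₀, hM₀⟩ := exists_annihilated (sqFock (monomial e 1))
  -- `M` must bound the annihilating modes and also exceed every index in the support of `e`.
  set M : ℕ := max M₀ (e.support.sup (fun l : ℕ+ => (l : ℕ)) + 1) with hM
  obtain ⟨n, hn⟩ : ∃ n, (m : ℕ) = n + 1 := ⟨m - 1, by have := m.pos; omega⟩
  rw [monomial_single_add, sqFock_X_mul, hn, Nat.cast_add, Nat.cast_one, traceSeries_sqMode_neg n _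
    (hM₀.mono (show (M₀ : ℤ) ≤ M by omega))]
  have hterm : ∀ l : ℕ+, traceSeries (sqMode (l : ℕ) (sqFock (monomial e 1))) =
      (((l : ℕ) : ℂ) * e l) • traceSeries (sqFock (monomial (e - Finsupp.single l 1) 1)) := fun l => by
    rw [← sqFock_heisMode, heisMode_monomial, map_smul, map_smul]
  rw [← Finset.sum_subset (s₁ := e.support.map ⟨PNat.val, PNat.coe_injective⟩) (fun l hl => ?_)
    fun l hl hl' => ?_, Finset.sum_map]
  · refine Finset.sum_congr rfl fun l _ => ?_
    simp only [Function.Embedding.coeFn_mk]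
    rw [hterm, mul_smul_comm, smul_smul]
    obtain ⟨k, hk⟩ : ∃ k, (l : ℕ) = k + 1 := ⟨l - 1, by have := l.pos; omega⟩
    have hch : ((n + (k + 1)).choose (k + 1) : ℂ) * n.factorial * (k + 1).factorial =
        ((n + (k + 1)).factorial : ℂ) := by
      exact_mod_cast Nat.add_choose_mul_factorial_mul_factorial n (k + 1)
    have hn0 : (n.factorial : ℂ) ≠ 0 := by exact_mod_cast n.factorial_ne_zero
    have hk0 : (k.factorial : ℂ) ≠ 0 := by exact_mod_cast k.factorial_ne_zero
    congr 1
    change _ * ((n + (l : ℕ)).choose l : ℂ) * (((l : ℕ) : ℂ) * _) = _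
    rw [hk, show n + 1 + (k + 1) - 1 = n + (k + 1) by omega, ← hch, Nat.factorial_succ k,
      Nat.add_sub_cancel, Nat.add_sub_cancel]
    push_cast
    field_simp
  · obtain ⟨l, hl2, rfl⟩ := Finset.mem_map.mp hl
    have := Finset.le_sup (f := fun l : ℕ+ => (l : ℕ)) hl2
    have := l.pos
    change (l : ℕ) ∈ _
    rw [Finset.mem_Ico]
    omega
  · have hl1 := (Finset.mem_Ico.mp hl).1
    have h0 : e ⟨l, hl1⟩ = 0 := by
      by_contra h
      exact hl' (Finset.mem_map.mpr ⟨⟨l, hl1⟩, Finsupp.mem_support_iff.mpr h, rfl⟩)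
    have := hterm ⟨l, hl1⟩
    rw [h0, Nat.cast_zero, mul_zero, zero_smul, PNat.mk_coe] at this
    rw [this, mul_zero, smul_zero]

/-- Zhu's recursion expresses each trace through convergent Eisenstein series and traces of smaller
weight, down to the graded dimension; surjectivity of `sqFock` then covers all states. -/
theorem absConv_traceSeries {z : ℂ} (hz : ‖z‖ < 1) (v : Fock) : AbsConv z (traceSeries v) := by
  have hmon : ∀ d, ∀ e, expWeight e < d → AbsConv z (traceSeries (sqFock (monomial e 1))) := by
    intro d
    induction d with
    | zero => exact fun e he => absurd he (Nat.not_lt_zero _)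
    | succ d ih =>
      intro e he
      rcases eq_or_ne e 0 with rfl | h0
      · change AbsConv z (traceSeries (sqFock 1))
        rw [sqFock_one, traceSeries_one]
        exact absConv_dimSeries hz
      · obtain ⟨m, f, rfl⟩ := exists_eq_single_add h0
        rw [traceSeries_sqFock_single_add]
        refine AbsConv.sum fun l _ => ((absConv_eisensteinSeries hz _).mul (ih _ ?_)).smul _
        have h1 := expWeight_tsub_le f (Finsupp.single l 1)
        have h2 := m.pos
        rw [expWeight_add, expWeight_single] at he
        omega
  obtain ⟨p, rfl⟩ := sqFock_surjective v
  rw [← support_sum_monomial_coeff p, map_sum, map_sum]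
  refine AbsConv.sum fun e _ => ?_
  rw [← mul_one (coeff e p), ← smul_eq_mul, ← smul_monomial, map_smul, map_smul]
  exact (hmon _ e (Nat.lt_succ_self _)).smul _

theorem onePointTerm_natCast (v : Fock) (τ : UpperHalfPlane) (n : ℕ) :
    heisenberg.onePointTerm v τ n = PowerSeries.coeff n (traceSeries v) * nome τ ^ n *
      Complex.exp (-(2 * Real.pi * Complex.I * (τ : ℂ) / 24)) := by
  rw [VOAData.onePointTerm, zeroModeTrace_eq, coeff_traceSeries, nome, ← Complex.exp_nat_mul, mul_assoc (gradeTrace _ _),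
    ← Complex.exp_add]
  congr 2
  change 2 * (Real.pi : ℂ) * Complex.I * (τ : ℂ) * ((((n : ℕ) : ℤ) : ℂ) - 1 / 24) = _
  push_cast
  ring

theorem support_onePointTerm (v : Fock) (τ : UpperHalfPlane) {n : ℤ}
    (hn : n ∉ Set.range (Nat.cast : ℕ → ℤ)) : heisenberg.onePointTerm v τ n = 0 := by
  rw [VOAData.onePointTerm, zeroModeTrace_eq, gradeTrace_of_neg, zero_mul]
  by_contra h
  exact hn ⟨n.toNat, by omega⟩

theorem summable_onePointTerm (v : Fock) (τ : UpperHalfPlane) :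
    Summable (heisenberg.onePointTerm v τ) := by
  rw [← Function.Injective.summable_iff (Nat.cast_injective (R := ℤ))
    fun n hn => support_onePointTerm v τ hn]
  exact ((absConv_traceSeries (norm_nome_lt_one τ) v).summable.mul_right _).congr fun n =>
    (onePointTerm_natCast v τ n).symm

theorem onePoint_eq (v : Fock) (τ : UpperHalfPlane) :
    heisenberg.onePoint v τ = evalAt (nome τ) (traceSeries v) *
      Complex.exp (-(2 * Real.pi * Complex.I * (τ : ℂ) / 24)) := by
  rw [VOAData.onePoint, ← Function.Injective.tsum_eq (Nat.cast_injective (R := ℤ)) fun n hn => by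
    by_contra h
    exact hn (support_onePointTerm v τ h), evalAt, ← tsum_mul_right]
  exact tsum_congr fun n => onePointTerm_natCast v τ n

/-- The one-point function as a linear functional. -/
def onePointLinear (τ : UpperHalfPlane) : Fock →ₗ[ℂ] ℂ where
  toFun v := heisenberg.onePoint v τ
  map_add' v w := by
    have h := absConv_traceSeries (norm_nome_lt_one τ)
    rw [onePoint_eq, onePoint_eq, onePoint_eq, map_add, evalAt_add (h v) (h w), add_mul]
  map_smul' c v := by
    rw [onePoint_eq, onePoint_eq, map_smul, evalAt_smul, RingHom.id_apply, smul_eq_mul, mul_assoc]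

/-- The one-point function of `a[-i_1] ⋯ a[-i_k] 𝟏`, normalized by the partition function
`1 / η(τ)`. -/
def torusAmplitude (τ : UpperHalfPlane) (e : ℕ+ →₀ ℕ) : ℂ :=
  ModularForm.eta τ * onePointLinear τ (sqFock (monomial e 1))

theorem torusAmplitude_zero (τ : UpperHalfPlane) : torusAmplitude τ 0 = 1 := by
  have hq := norm_nome_lt_one τ
  have h1 : onePointLinear τ (sqFock (monomial 0 1)) = heisenberg.onePoint (sqFock 1) τ := rfl
  have h2 : ModularForm.eta τ = Complex.exp (2 * Real.pi * Complex.I * (τ : ℂ) / 24) *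
      ∏' n : ℕ, (1 - nome τ ^ (n + 1)) := by
    rw [ModularForm.eta]
    simp only [ModularForm.eta_q_eq_pow]
    rw [Function.Periodic.qParam]
    norm_num [nome]
  rw [torusAmplitude, h1, onePoint_eq, sqFock_one, traceSeries_one, evalAt_dimSeries hq, h2,
    Complex.exp_neg]
  have := tprod_one_sub_pow_ne_zero hq
  have := Complex.exp_ne_zero (2 * Real.pi * Complex.I * (τ : ℂ) / 24)
  field_simp

theorem torusAmplitude_single_add (τ : UpperHalfPlane) (m : ℕ+) (e : ℕ+ →₀ ℕ) :
    torusAmplitude τ (Finsupp.single m 1 + e) =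
      ∑ l ∈ e.support, matC m l τ * e l * torusAmplitude τ (e - Finsupp.single l 1) := by
  have hc : ∀ v, onePointLinear τ v = evalAt (nome τ) (traceSeries v) *
      Complex.exp (-(2 * Real.pi * Complex.I * (τ : ℂ) / 24)) := fun v => onePoint_eq v τ
  have hq := norm_nome_lt_one τ
  simp only [torusAmplitude, hc]
  rw [traceSeries_sqFock_single_add, evalAt_sum fun l _ =>
    ((absConv_eisensteinSeries hq _).mul (absConv_traceSeries hq _)).smul _, Finset.sum_mul,
    Finset.mul_sum]
  refine Finset.sum_congr rfl fun l _ => ?_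
  rw [evalAt_smul, evalAt_mul (absConv_eisensteinSeries hq _) (absConv_traceSeries hq _),
    evalAt_eisensteinSeries, matC]
  ring

/-! ## Sums over Fock space exponents -/

/-- The recursion satisfied by the amplitudes of a free boson with contractions `c`. -/
structure IsAmplitude (c : ℕ+ → ℕ+ → ℂ) (F : (ℕ+ →₀ ℕ) → ℂ) : Prop where
  zero : F 0 = 1
  single_add : ∀ m e, F (Finsupp.single m 1 + e) =
    ∑ l ∈ e.support, c m l * e l * F (e - Finsupp.single l 1)

/-- The generating series `∑_e ε^{wt e} φ(e) / fockNorm e`. -/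
def weightSum (φ : (ℕ+ →₀ ℕ) → ℂ) : PowerSeries ℂ :=
  PowerSeries.mk fun r => ∑ e ∈ expsOfWeight r, φ e / fockNorm e

theorem weightSum_add (φ ψ : (ℕ+ →₀ ℕ) → ℂ) :
    weightSum (fun e => φ e + ψ e) = weightSum φ + weightSum ψ := by
  ext r
  simp only [weightSum, map_add, PowerSeries.coeff_mk, add_div, Finset.sum_add_distrib]

theorem weightSum_const_mul (c : ℂ) (φ : (ℕ+ →₀ ℕ) → ℂ) :
    weightSum (fun e => c * φ e) = PowerSeries.C c * weightSum φ := by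
  ext r
  simp only [weightSum, PowerSeries.coeff_C_mul, PowerSeries.coeff_mk, mul_div_assoc, Finset.mul_sum]

/-- The derivation `X d/dX` of the ring of power series. -/
def euler : Derivation ℂ (PowerSeries ℂ) (PowerSeries ℂ) :=
  (PowerSeries.X : PowerSeries ℂ) • PowerSeries.derivative ℂ

theorem euler_apply (f : PowerSeries ℂ) : euler f = PowerSeries.X * PowerSeries.derivative ℂ f := rfl

theorem coeff_euler (f : PowerSeries ℂ) (n : ℕ) :
    PowerSeries.coeff n (euler f) = n * PowerSeries.coeff n f := by
  rw [euler_apply]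
  cases n with
  | zero => simp
  | succ n =>
    rw [PowerSeries.coeff_succ_X_mul, PowerSeries.coeff_derivative]
    push_cast
    ring

theorem euler_weightSum (φ : (ℕ+ →₀ ℕ) → ℂ) :
    euler (weightSum φ) = weightSum fun e => (expWeight e : ℂ) * φ e := by
  ext r
  rw [coeff_euler]
  simp only [weightSum, PowerSeries.coeff_mk, Finset.mul_sum]
  refine Finset.sum_congr rfl fun e he => ?_
  rw [mem_expsOfWeight.mp he, mul_div_assoc]

/-- Pairs `(e, j)` with `j` in the support of `e` correspond to pairs `(j, e - δ_j)`. The norm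
changes by `-j e_j`, so the factor `e_j` cancels and `-1/j` remains. -/
theorem coeff_weightSum_sum_support (φ : ℕ+ → (ℕ+ →₀ ℕ) → ℂ) (r : ℕ) :
    PowerSeries.coeff r (weightSum fun e => ∑ j ∈ e.support, e j * φ j (e - Finsupp.single j 1)) =
      -∑ j ∈ Finset.range r, (1 / ((j : ℂ) + 1)) *
        PowerSeries.coeff (r - (j + 1)) (weightSum (φ j.succPNat)) := by
  simp only [weightSum, PowerSeries.coeff_mk, Finset.sum_div, Finset.mul_sum]
  rw [Finset.sum_sigma', Finset.sum_sigma', ← Finset.sum_neg_distrib]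
  have hsub : ∀ (e : ℕ+ →₀ ℕ) (j : ℕ+), j ∈ e.support →
      Finsupp.single j 1 + (e - Finsupp.single j 1) = e := fun e j hj => by
    refine add_tsub_cancel_of_le ?_
    rw [Finsupp.single_le_iff]
    exact Nat.one_le_iff_ne_zero.mpr (Finsupp.mem_support_iff.mp hj)
  refine Finset.sum_bij' (fun x _ => ⟨(x.2 : ℕ) - 1, x.1 - Finsupp.single x.2 1⟩)
    (fun y _ => ⟨Finsupp.single y.1.succPNat 1 + y.2, y.1.succPNat⟩) ?_ ?_ ?_ ?_ ?_
  · rintro ⟨e, j⟩ hx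
    obtain ⟨he, hj⟩ := Finset.mem_sigma.mp hx
    rw [mem_expsOfWeight] at he
    have h1 := expWeight_add (Finsupp.single j 1) (e - Finsupp.single j 1)
    rw [hsub e j hj, expWeight_single] at h1
    have h2 := j.pos
    simp only at he
    rw [Finset.mem_sigma, Finset.mem_range, mem_expsOfWeight]
    simp only
    omega
  · rintro ⟨j, e⟩ hy
    obtain ⟨hj, he⟩ := Finset.mem_sigma.mp hy
    rw [mem_expsOfWeight] at he
    rw [Finset.mem_range] at hj
    simp only at he hj
    rw [Finset.mem_sigma, mem_expsOfWeight]
    simp only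
    rw [expWeight_add, expWeight_single, Nat.succPNat_coe]
    exact ⟨by omega, by simp⟩
  · rintro ⟨e, j⟩ hx
    obtain ⟨he, hj⟩ := Finset.mem_sigma.mp hx
    have h2 : ((j : ℕ) - 1).succPNat = j := by
      have := j.pos
      exact PNat.eq (by rw [Nat.succPNat_coe]; omega)
    simp only at hj ⊢
    rw [h2, hsub e j hj]
  · rintro ⟨j, e⟩ hy
    simp only [add_tsub_cancel_left, Nat.succPNat_coe, Nat.succ_eq_add_one, Nat.add_sub_cancel]
  · rintro ⟨e, j⟩ hx
    obtain ⟨he, hj⟩ := Finset.mem_sigma.mp hx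
    have h2 : ((j : ℕ) - 1).succPNat = j := by
      have := j.pos
      exact PNat.eq (by rw [Nat.succPNat_coe]; omega)
    have h3 : (((j : ℕ) - 1 : ℕ) : ℂ) + 1 = (j : ℕ) := by
      exact_mod_cast Nat.sub_add_cancel j.pos
    simp only at hj ⊢
    rw [h2, h3]
    obtain ⟨f, hf⟩ : ∃ f, f = e - Finsupp.single j 1 := ⟨_, rfl⟩
    have he' := hsub e j hj
    rw [← hf] at he' ⊢
    rw [← he', fockNorm_single_add, Finsupp.add_apply, Finsupp.single_eq_same]
    have hj0 : ((j : ℕ) : ℂ) ≠ 0 := by exact_mod_cast j.ne_zero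
    have hf0 : ((f j : ℂ) + 1) ≠ 0 := by exact_mod_cast Nat.succ_ne_zero (f j)
    have hN := fockNorm_ne_zero f
    push_cast
    rw [add_comm (1 : ℂ)]
    field_simp

/-- Congruence of power series modulo `X ^ N`. -/
theorem X_pow_dvd_sub_iff {N : ℕ} {f g : PowerSeries ℂ} : PowerSeries.X ^ N ∣ f - g ↔
    ∀ d < N, PowerSeries.coeff d f = PowerSeries.coeff d g := by
  rw [PowerSeries.X_pow_dvd_iff]
  simp only [map_sub, sub_eq_zero]

theorem weightSum_sum_support_congr (φ : ℕ+ → (ℕ+ →₀ ℕ) → ℂ) (N : ℕ) :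
    PowerSeries.X ^ (N + 1) ∣
      (weightSum fun e => ∑ j ∈ e.support, e j * φ j (e - Finsupp.single j 1)) -
      -∑ j : Fin N, PowerSeries.C (1 / ((j : ℂ) + 1)) * PowerSeries.X ^ ((j : ℕ) + 1) *
        weightSum (φ (j : ℕ).succPNat) := by
  rw [X_pow_dvd_sub_iff]
  intro r hr
  rw [coeff_weightSum_sum_support, map_neg, map_sum, Fin.sum_univ_eq_sum_range (fun j : ℕ =>
    PowerSeries.coeff r (PowerSeries.C (1 / ((j : ℂ) + 1)) * PowerSeries.X ^ (j + 1) *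
      weightSum (φ j.succPNat)))]
  congr 1
  have hterm : ∀ j : ℕ, PowerSeries.coeff r (PowerSeries.C (1 / ((j : ℂ) + 1)) *
      PowerSeries.X ^ (j + 1) * weightSum (φ j.succPNat)) = if j + 1 ≤ r then (1 / ((j : ℂ) + 1)) *
        PowerSeries.coeff (r - (j + 1)) (weightSum (φ j.succPNat)) else 0 := fun j => by
    rw [mul_assoc, PowerSeries.coeff_C_mul, PowerSeries.coeff_X_pow_mul', mul_ite, mul_zero]
  simp only [hterm]
  rw [← Finset.sum_subset (Finset.range_mono (show r ≤ N by omega)) fun j _ hj => by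
    rw [Finset.mem_range] at hj
    rw [if_neg (by omega)]]
  refine Finset.sum_congr rfl fun j hj => ?_
  rw [Finset.mem_range] at hj
  rw [if_pos (by omega)]

theorem expWeight_eq_sum (e : ℕ+ →₀ ℕ) : expWeight e = ∑ j ∈ e.support, e j * (j : ℕ) := by
  rw [expWeight, Finsupp.weight_apply, Finsupp.sum]
  simp only [smul_eq_mul]

/-! ### Linear relations between shifted sums -/

section Amplitude

variable {c₁ c₂ : ℕ+ → ℕ+ → ℂ} {F₁ F₂ : (ℕ+ →₀ ℕ) → ℂ}

theorem single_add_tsub {e : ℕ+ →₀ ℕ} {j : ℕ+} (hj : j ∈ e.support) :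
    Finsupp.single j 1 + (e - Finsupp.single j 1) = e := by
  refine add_tsub_cancel_of_le ?_
  rw [Finsupp.single_le_iff]
  exact Nat.one_le_iff_ne_zero.mpr (Finsupp.mem_support_iff.mp hj)

/-- Wick's recursion for the mode `j`: it is contracted either with the inserted mode `l` or with a
mode of `e`. Both sums are extended to `insert l e.support`, whether or not `l` already occurs in
`e`. -/
theorem IsAmplitude.single_add_single_add {c : ℕ+ → ℕ+ → ℂ} {F : (ℕ+ →₀ ℕ) → ℂ}
    (hF : IsAmplitude c F) (j l : ℕ+) (e : ℕ+ →₀ ℕ) :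
    F (Finsupp.single j 1 + (Finsupp.single l 1 + e)) = c j l * F e +
      ∑ i ∈ e.support, e i * (c j i * F (Finsupp.single l 1 + (e - Finsupp.single i 1))) := by
  rw [hF.single_add, Finset.sum_subset (s₂ := insert l e.support) (fun i hi => ?_) fun i _ hi => ?_,
    Finset.sum_subset (s₁ := e.support) (s₂ := insert l e.support) (Finset.subset_insert _ _)
      fun i _ hi => ?_]
  · have h1 : c j l * F e = ∑ i ∈ insert l e.support, if i = l then c j l * F e else 0 := by
      rw [Finset.sum_ite_eq', if_pos (Finset.mem_insert_self _ _)]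
    rw [h1, ← Finset.sum_add_distrib]
    refine Finset.sum_congr rfl fun i hi => ?_
    by_cases hil : i = l
    · subst hil
      rw [if_pos rfl, add_tsub_cancel_left, Finsupp.add_apply, Finsupp.single_eq_same]
      by_cases he : e i = 0
      · rw [he]
        simp
      · rw [single_add_tsub (Finsupp.mem_support_iff.mpr he)]
        push_cast
        ring
    · have hie : i ∈ e.support := Finset.mem_of_mem_insert_of_ne hi hil
      rw [if_neg hil, zero_add, Finsupp.add_apply, Finsupp.single_eq_of_ne hil, zero_add,
        add_tsub_assoc_of_le]
      · ring
      · rw [Finsupp.single_le_iff]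
        exact Nat.one_le_iff_ne_zero.mpr (Finsupp.mem_support_iff.mp hie)
  · rw [Finsupp.notMem_support_iff.mp hi]
    simp
  · by_cases hil : i = l
    · exact Finset.mem_insert.mpr (.inl hil)
    · refine Finset.mem_insert_of_mem (Finsupp.mem_support_iff.mpr fun h => ?_)
      rw [Finsupp.mem_support_iff, Finsupp.add_apply, Finsupp.single_eq_of_ne hil, h] at hi
      exact hi rfl
  · rw [Finsupp.notMem_support_iff.mp hi]
    simp

/-- The series `∑_e ε^{wt e} F₁(e + k) F₂(e + l) / fockNorm e`. -/
def shiftSum (F₁ F₂ : (ℕ+ →₀ ℕ) → ℂ) (k l : ℕ+) : PowerSeries ℂ :=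
  weightSum fun e => F₁ (Finsupp.single k 1 + e) * F₂ (Finsupp.single l 1 + e)

/-- The series `∑_e ε^{wt e} F₁(e) F₂(e + j + l) / fockNorm e`. -/
def doubleShiftSum (F₁ F₂ : (ℕ+ →₀ ℕ) → ℂ) (j l : ℕ+) : PowerSeries ℂ :=
  weightSum fun e => F₁ e * F₂ (Finsupp.single j 1 + (Finsupp.single l 1 + e))

/-- The weight is `∑ j e_j`; this factor `j` cancels the `1/j` from the norm. -/
theorem euler_weightSum_congr (F₁ F₂ : (ℕ+ →₀ ℕ) → ℂ) (N : ℕ) : PowerSeries.X ^ (N + 1) ∣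
    euler (weightSum fun e => F₁ e * F₂ e) -
      -∑ j : Fin N, PowerSeries.X ^ ((j : ℕ) + 1) *
        shiftSum F₁ F₂ (j : ℕ).succPNat (j : ℕ).succPNat := by
  have h := weightSum_sum_support_congr (fun j e => ((j : ℕ) : ℂ) *
    (F₁ (Finsupp.single j 1 + e) * F₂ (Finsupp.single j 1 + e))) N
  rw [euler_weightSum]
  convert h using 1
  congr 2
  · funext e
    rw [expWeight_eq_sum, Nat.cast_sum, Finset.sum_mul]
    refine Finset.sum_congr rfl fun j hj => ?_
    rw [single_add_tsub hj]
    push_cast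
    ring
  · refine Finset.sum_congr rfl fun j _ => ?_
    have : ((j : ℂ) + 1) ≠ 0 := by exact_mod_cast Nat.succ_ne_zero (j : ℕ)
    rw [weightSum_const_mul, mul_mul_mul_comm, ← map_mul, Nat.succPNat_coe, Nat.succ_eq_add_one,
      Nat.cast_add, Nat.cast_one, one_div_mul_cancel this, map_one, one_mul]
    rfl

/-- Contract the mode `k` on the first torus with `a[-j]` and remove that mode from the sum; it
survives as an additional insertion on the second torus. -/
theorem shiftSum_congr (h₁ : IsAmplitude c₁ F₁) (k l : ℕ+) (N : ℕ) : PowerSeries.X ^ (N + 1) ∣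
    shiftSum F₁ F₂ k l - -∑ j : Fin N, PowerSeries.C (c₁ k (j : ℕ).succPNat / ((j : ℂ) + 1)) *
      PowerSeries.X ^ ((j : ℕ) + 1) * doubleShiftSum F₁ F₂ (j : ℕ).succPNat l := by
  have h := weightSum_sum_support_congr (fun j e => c₁ k j *
    (F₁ e * F₂ (Finsupp.single j 1 + (Finsupp.single l 1 + e)))) N
  convert h using 1
  congr 2
  · rw [shiftSum]
    congr 1
    funext e
    rw [h₁.single_add, Finset.sum_mul]
    refine Finset.sum_congr rfl fun j hj => ?_
    rw [add_left_comm, single_add_tsub hj]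
    ring
  · refine Finset.sum_congr rfl fun j _ => ?_
    rw [weightSum_const_mul, mul_mul_mul_comm, mul_assoc, ← mul_assoc, mul_right_comm, ← map_mul,
      mul_comm (PowerSeries.C _), div_eq_mul_one_div, mul_comm (c₁ _ _), mul_comm, doubleShiftSum]
    ring

/-- Contract the inserted mode `j` on the second torus: with `l` it reproduces the unshifted sum,
and with a summed mode `i` it leaves `i` inserted on the first torus. -/
theorem doubleShiftSum_congr (h₂ : IsAmplitude c₂ F₂) (j l : ℕ+) (N : ℕ) : PowerSeries.X ^ (N + 1) ∣
    doubleShiftSum F₁ F₂ j l - (PowerSeries.C (c₂ j l) * (weightSum fun e => F₁ e * F₂ e) -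
      ∑ i : Fin N, PowerSeries.C (c₂ j (i : ℕ).succPNat / ((i : ℂ) + 1)) *
      PowerSeries.X ^ ((i : ℕ) + 1) * shiftSum F₁ F₂ (i : ℕ).succPNat l) := by
  have h := weightSum_sum_support_congr (fun i e => c₂ j i *
    (F₁ (Finsupp.single i 1 + e) * F₂ (Finsupp.single l 1 + e))) N
  have h2 : doubleShiftSum F₁ F₂ j l = PowerSeries.C (c₂ j l) * (weightSum fun e => F₁ e * F₂ e) +
      weightSum fun e => ∑ i ∈ e.support, e i * (c₂ j i *
        (F₁ (Finsupp.single i 1 + (e - Finsupp.single i 1)) *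
          F₂ (Finsupp.single l 1 + (e - Finsupp.single i 1)))) := by
    rw [← weightSum_const_mul, ← weightSum_add, doubleShiftSum]
    congr 1
    funext e
    rw [h₂.single_add_single_add, mul_add, Finset.mul_sum]
    congr 1
    · ring
    · refine Finset.sum_congr rfl fun i hi => ?_
      rw [single_add_tsub hi]
      ring
  rw [h2, sub_eq_add_neg (PowerSeries.C (c₂ j l) * _), add_sub_add_left_eq_sub]
  convert h using 1
  congr 2
  refine Finset.sum_congr rfl fun i _ => ?_
  rw [weightSum_const_mul, div_eq_mul_one_div, map_mul, shiftSum]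
  ring

end Amplitude

/-! ## Traces of powers of matrices -/

section Matrix

variable {R n : Type*} [CommRing R] [Fintype n]

theorem map_derivation_mul [Algebra ℂ R] (D : Derivation ℂ R R) (M N : Matrix n n R) :
    (M * N).map D = M.map D * N + M * N.map D := by
  ext i j
  simp only [Matrix.map_apply, Matrix.mul_apply, Matrix.add_apply, map_sum, Derivation.leibniz,
    smul_eq_mul, Finset.sum_add_distrib]
  rw [add_comm]
  congr 1
  exact Finset.sum_congr rfl fun _ _ => mul_comm _ _

theorem trace_pow_mul_map_derivation_pow [Algebra ℂ R] [DecidableEq n] (D : Derivation ℂ R R) (T : Matrix n n R) (k m : ℕ) :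
    (T ^ k * (T ^ (m + 1)).map D).trace = (m + 1 : ℂ) • (T ^ (k + m) * T.map D).trace := by
  induction m generalizing k with
  | zero => simp
  | succ m ih =>
    rw [pow_succ T (m + 1), map_derivation_mul, mul_add, Matrix.trace_add, ← mul_assoc,
      Matrix.trace_mul_comm, ← mul_assoc, ← pow_succ', ih, ← mul_assoc, ← pow_add,
      show k + 1 + m = k + (m + 1) by ring]
    push_cast
    simp only [add_smul, one_smul]

theorem derivation_trace_pow [Algebra ℂ R] [DecidableEq n] (D : Derivation ℂ R R) (T : Matrix n n R) (m : ℕ) :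
    D (T ^ (m + 1)).trace = (m + 1 : ℂ) • (T ^ m * T.map D).trace := by
  have := trace_pow_mul_map_derivation_pow D T 0 m
  rw [pow_zero, one_mul, zero_add] at this
  rw [← this, Matrix.trace, Matrix.trace, map_sum]
  rfl

theorem mul_pow_mul_eq [DecidableEq n] (A₁ A₂ : Matrix n n R) (m : ℕ) :
    A₁ * (A₂ * A₁) ^ m = (A₁ * A₂) ^ m * A₁ := by
  induction m with
  | zero => simp
  | succ m ih => rw [pow_succ, ← mul_assoc, ih, pow_succ]; simp only [mul_assoc]

/-- The product rule gives four terms. The two with `w` at an end have the asserted trace by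
cyclicity; the two equal terms with `w` between `A₁` and `A₂` are reduced to it by transposition,
where symmetry of both matrices enters. -/
theorem trace_pow_mul_map_derivation [Algebra ℂ R] [DecidableEq n] (D : Derivation ℂ R R) {A₁ A₂ : Matrix n n R} {w : n → R}
    (h₁ : A₁.transpose = A₁) (h₂ : A₂.transpose = A₂)
    (hD₁ : A₁.map D = Matrix.diagonal w * A₁ + A₁ * Matrix.diagonal w)
    (hD₂ : A₂.map D = Matrix.diagonal w * A₂ + A₂ * Matrix.diagonal w) (m : ℕ) :
    ((A₁ * A₂) ^ m * (A₁ * A₂).map D).trace =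
      4 * (Matrix.diagonal w * (A₁ * A₂) ^ (m + 1)).trace := by
  set W := Matrix.diagonal w with hW
  set T := A₁ * A₂ with hT
  have e1 : (T ^ m * (W * T)).trace = (W * T ^ (m + 1)).trace := by
    rw [← mul_assoc, Matrix.trace_mul_comm, ← mul_assoc, ← pow_succ', Matrix.trace_mul_comm]
  have e2 : (T ^ m * (T * W)).trace = (W * T ^ (m + 1)).trace := by
    rw [← mul_assoc, ← pow_succ, Matrix.trace_mul_comm]
  have e3 : (T ^ m * (A₁ * W * A₂)).trace = (W * T ^ (m + 1)).trace := by
    have ht : (A₂ * T ^ m * A₁).transpose = T ^ (m + 1) := by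
      rw [Matrix.transpose_mul, Matrix.transpose_mul, Matrix.transpose_pow, hT, Matrix.transpose_mul,
        h₁, h₂, ← mul_assoc, mul_pow_mul_eq, pow_succ, mul_assoc]
    rw [Matrix.trace_mul_comm, ← ht, ← Matrix.trace_transpose (W * _), Matrix.transpose_mul,
      Matrix.transpose_transpose, hW, Matrix.diagonal_transpose, ← hW, Matrix.trace_mul_comm _ W]
    rw [mul_assoc, mul_assoc, Matrix.trace_mul_comm]
    simp only [mul_assoc]
  have hmap : T.map D = W * T + A₁ * W * A₂ + (A₁ * W * A₂ + T * W) := by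
    rw [hT, map_derivation_mul, hD₁, hD₂]
    noncomm_ring
  rw [hmap, mul_add, mul_add, mul_add, Matrix.trace_add, Matrix.trace_add, Matrix.trace_add, e1, e2, e3]
  ring

/-- Eliminating `κ` gives `h = -gT + Th` with `T = A₁ A₂`; iterating this yields a geometric series,
finite because `T` is nilpotent. -/
theorem eq_neg_sum_pow [DecidableEq n] {A₁ A₂ h κ : Matrix n n R} {g : R} (h₁ : h = -(A₁ * κ))
    (h₂ : κ = g • A₂ - A₂ * h) {N : ℕ} (hN : (A₁ * A₂) ^ N = 0) :
    h = -(g • ∑ i ∈ Finset.range N, (A₁ * A₂) ^ (i + 1)) := by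
  have hrec : h = -(g • (A₁ * A₂)) + A₁ * A₂ * h := by
    rw [h₂] at h₁
    nth_rewrite 1 [h₁]
    rw [mul_sub, Matrix.mul_smul, neg_sub, mul_assoc]
    abel
  have key : ∀ M, h = -(g • ∑ i ∈ Finset.range M, (A₁ * A₂) ^ (i + 1)) + (A₁ * A₂) ^ M * h := by
    intro M
    induction M with
    | zero => simp
    | succ M ih =>
      nth_rewrite 1 [ih]
      nth_rewrite 1 [hrec]
      rw [Finset.sum_range_succ, mul_add, smul_add, neg_add, add_assoc, mul_neg, Matrix.mul_smul,
        ← pow_succ, ← mul_assoc, ← pow_succ]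
  have := key N
  rwa [hN, zero_mul, add_zero] at this

end Matrix

/-! ## Truncation of infinite matrices -/

/-- Power series modulo `X ^ (N + 1)`. -/
def TruncRing (N : ℕ) : Type :=
  PowerSeries ℂ ⧸ Ideal.span {(PowerSeries.X : PowerSeries ℂ) ^ (N + 1)}

instance (N : ℕ) : CommRing (TruncRing N) :=
  inferInstanceAs (CommRing (PowerSeries ℂ ⧸ Ideal.span {(PowerSeries.X : PowerSeries ℂ) ^ (N + 1)}))

/-- Reduction modulo `X ^ (N + 1)`. -/
def truncHom (N : ℕ) : PowerSeries ℂ →+* TruncRing N :=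
  Ideal.Quotient.mk (Ideal.span {(PowerSeries.X : PowerSeries ℂ) ^ (N + 1)})

theorem truncHom_eq_iff_dvd {N : ℕ} {f g : PowerSeries ℂ} :
    truncHom N f = truncHom N g ↔ PowerSeries.X ^ (N + 1) ∣ f - g :=
  Ideal.Quotient.eq.trans Ideal.mem_span_singleton

theorem truncHom_eq_iff {N : ℕ} {f g : PowerSeries ℂ} : truncHom N f = truncHom N g ↔
    ∀ d ≤ N, PowerSeries.coeff d f = PowerSeries.coeff d g := by
  rw [truncHom_eq_iff_dvd, X_pow_dvd_sub_iff]
  simp only [Nat.lt_succ_iff]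

theorem finsum_pnat_eq_sum {f : ℕ+ → ℂ} {N : ℕ} (h : ∀ j : ℕ+, N < j → f j = 0) :
    ∑ᶠ j, f j = ∑ i : Fin N, f (i : ℕ).succPNat := by
  rw [finsum_eq_sum_of_support_subset (s := Finset.univ.map ⟨fun i : Fin N => (i : ℕ).succPNat,
    fun i j hij => Fin.ext (Nat.succPNat_injective hij)⟩), Finset.sum_map]
  · rfl
  · intro j hj
    have hjN : (j : ℕ) ≤ N := by
      by_contra hlt
      exact hj (h j (by omega))
    have := j.pos
    refine Finset.mem_coe.mpr (Finset.mem_map.mpr ⟨⟨j - 1, by omega⟩, Finset.mem_univ _, ?_⟩)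
    exact PNat.eq (by
      change Nat.succ _ = _
      change (j : ℕ) - 1 + 1 = j
      omega)

namespace InfMatrix

/-- The upper left `N × N` block of an infinite matrix. -/
def block (N : ℕ) (M : InfMatrix) : Matrix (Fin N) (Fin N) (PowerSeries ℂ) :=
  Matrix.of fun i j => M (i : ℕ).succPNat (j : ℕ).succPNat

/-- The block of an infinite matrix, modulo `X ^ (N + 1)`. -/
def truncBlock (N : ℕ) (M : InfMatrix) : Matrix (Fin N) (Fin N) (TruncRing N) :=
  (block N M).map (truncHom N)

/-- Intermediate indices beyond `N` contribute only in degrees above `N`, so modulo `X ^ (N + 1)`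
the finite block computes the infinite product. -/
theorem truncBlock_mul {N : ℕ} {M M' : InfMatrix}
    (h : ∀ k j l : ℕ+, N < j → ∀ d ≤ N, PowerSeries.coeff d (M k j * M' j l) = 0) :
    truncBlock N (mul M M') = truncBlock N M * truncBlock N M' := by
  rw [truncBlock, truncBlock, truncBlock, ← Matrix.map_mul]
  ext i l
  rw [Matrix.map_apply, Matrix.map_apply, truncHom_eq_iff]
  intro d hd
  rw [Matrix.mul_apply, map_sum]
  change PowerSeries.coeff d (mul M M' _ _) = _
  rw [mul, PowerSeries.coeff_mk, finsum_pnat_eq_sum fun j hj => h _ j _ hj d hd]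
  rfl

theorem coeff_trace_eq {N : ℕ} {M : InfMatrix}
    (h : ∀ k : ℕ+, N < k → ∀ d ≤ N, PowerSeries.coeff d (M k k) = 0) :
    truncHom N (trace M) = (truncBlock N M).trace := by
  have : (truncBlock N M).trace = truncHom N (block N M).trace := by
    rw [truncBlock, Matrix.trace, Matrix.trace, map_sum]
    rfl
  rw [this, truncHom_eq_iff]
  intro d hd
  rw [trace, PowerSeries.coeff_mk, finsum_pnat_eq_sum fun k hk => h k hk d hd, Matrix.trace, map_sum]
  rfl

/-- The entries `M k l` have order at least `k + l + m`. -/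
def OrderGE (m : ℕ) (M : InfMatrix) : Prop :=
  ∀ (k l : ℕ+) (d : ℕ), d < k + l + m → PowerSeries.coeff d (M k l) = 0

theorem OrderGE.coeff_mul {m m' : ℕ} {M M' : InfMatrix} (h : OrderGE m M) (h' : OrderGE m' M')
    (k j l : ℕ+) {d : ℕ} (hd : d < k + j + m + (j + l + m')) :
    PowerSeries.coeff d (M k j * M' j l) = 0 := by
  rw [PowerSeries.coeff_mul]
  refine Finset.sum_eq_zero fun ij hij => ?_
  have := Finset.HasAntidiagonal.mem_antidiagonal.mp hij
  rcases lt_or_ge ij.1 (k + j + m) with h1 | h1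
  · rw [h k j _ h1, zero_mul]
  · rw [h' j l _ (by omega), mul_zero]

/-- The intermediate index `j ≥ 1` occurs in both factors, which accounts for the additional `2`.
Powers thus have growing order, making traces and logarithms finite in each degree and truncated
blocks nilpotent. -/
theorem OrderGE.mul {m m' : ℕ} {M M' : InfMatrix} (h : OrderGE m M) (h' : OrderGE m' M') :
    OrderGE (m + m' + 2) (mul M M') := fun k l d hd => by
  rw [InfMatrix.mul, PowerSeries.coeff_mk]
  refine (finsum_congr fun j => ?_).trans finsum_zero
  have := j.pos
  exact h.coeff_mul h' k j l (by omega)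

theorem one_mul (M : InfMatrix) : mul one M = M := by
  funext k l
  ext d
  rw [mul, PowerSeries.coeff_mk, finsum_eq_single _ k fun j hj => by
    rw [one, if_neg hj.symm, zero_mul, map_zero], one, if_pos rfl, _root_.one_mul]

theorem orderGE_pow {P : InfMatrix} (h : OrderGE 2 P) (n : ℕ) : OrderGE (2 * n + 2) (pow P (n + 1)) := by
  induction n with
  | zero => rwa [pow, pow, one_mul]
  | succ n ih =>
    have := ih.mul h
    intro k l d hd
    exact this k l d (by omega)

theorem truncBlock_pow {P : InfMatrix} (h : OrderGE 2 P) (N n : ℕ) :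
    truncBlock N (pow P (n + 1)) = truncBlock N P ^ (n + 1) := by
  induction n with
  | zero => rw [pow, pow, one_mul, pow_one]
  | succ n ih =>
    rw [pow, truncBlock_mul, ih, ← pow_succ]
    intro k j l hj d hd
    exact (orderGE_pow h n).coeff_mul h k j l (by omega)

theorem truncBlock_pow_eq_zero {P : InfMatrix} (h : OrderGE 2 P) (N : ℕ) :
    truncBlock N P ^ (N + 1) = 0 := by
  rw [← truncBlock_pow h]
  ext i j
  rw [truncBlock, Matrix.map_apply, Matrix.zero_apply, ← map_zero (truncHom N), truncHom_eq_iff]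
  intro d hd
  rw [map_zero]
  exact orderGE_pow h N _ _ d (by omega)

theorem truncHom_logDetOneSub {P : InfMatrix} (h : OrderGE 2 P) (N : ℕ) :
    truncHom N (logDetOneSub P) = -∑ i : Fin N,
      truncHom N (PowerSeries.C (1 / ((i : ℂ) + 1))) * (truncBlock N P ^ ((i : ℕ) + 1)).trace := by
  have htr : ∀ n : ℕ, truncHom N (trace (pow P (n + 1))) = (truncBlock N P ^ (n + 1)).trace := fun n => by
    rw [← truncBlock_pow h, coeff_trace_eq]
    intro k hk d hd
    exact orderGE_pow h n k k d (by omega)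
  simp only [← htr, ← map_mul, ← map_sum, ← map_neg]
  rw [truncHom_eq_iff]
  intro d hd
  rw [logDetOneSub, PowerSeries.coeff_mk, map_neg, map_sum, finsum_pnat_eq_sum fun n hn => ?_]
  · congr 1
    refine Finset.sum_congr rfl fun i _ => ?_
    rw [PowerSeries.coeff_C_mul, Nat.succPNat_coe, Nat.succ_eq_add_one]
    push_cast
    rfl
  · obtain ⟨m, hm⟩ : ∃ m, (n : ℕ) = m + 1 := ⟨n - 1, by have := n.pos; omega⟩
    rw [hm, trace, PowerSeries.coeff_mk]
    rw [(finsum_congr fun k => orderGE_pow h m k k d (by omega)).trans finsum_zero, mul_zero]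

theorem constantCoeff_logDetOneSub {P : InfMatrix} (h : OrderGE 2 P) :
    PowerSeries.constantCoeff (logDetOneSub P) = 0 := by
  have := truncHom_logDetOneSub h 0
  rw [Finset.univ_eq_empty, Finset.sum_empty, neg_zero, ← map_zero (truncHom 0), truncHom_eq_iff] at this
  simpa using this 0 le_rfl

end InfMatrix

/-! ## The inverse square root -/

theorem binomialSeries_neg_half_sq_mul :
    (PowerSeries.binomialSeries ℂ (-1 / 2 : ℚ)) * PowerSeries.binomialSeries ℂ (-1 / 2 : ℚ) *
      (1 + PowerSeries.X) = 1 := by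
  have h : PowerSeries.binomialSeries ℂ ((1 : ℕ) : ℚ) = 1 + PowerSeries.X := by
    rw [PowerSeries.binomialSeries_nat, pow_one]
  rw [← h, ← PowerSeries.binomialSeries_add, ← PowerSeries.binomialSeries_add]
  norm_num

theorem invSqrt_mul_invSqrt_mul {E : PowerSeries ℂ} (hE : PowerSeries.constantCoeff E = 1) :
    invSqrt E * invSqrt E * E = 1 := by
  have hs : PowerSeries.HasSubst (E - 1) := PowerSeries.HasSubst.of_constantCoeff_zero' (by simp [hE])
  have h := congrArg (PowerSeries.subst (E - 1)) binomialSeries_neg_half_sq_mul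
  have h1 : PowerSeries.subst (E - 1) (1 : PowerSeries ℂ) = 1 := by
    rw [← PowerSeries.coe_substAlgHom hs, map_one]
  rw [PowerSeries.subst_mul hs, PowerSeries.subst_mul hs, PowerSeries.subst_add hs, h1,
    PowerSeries.subst_X hs, add_sub_cancel] at h
  exact h

theorem constantCoeff_invSqrt {E : PowerSeries ℂ} (hE : PowerSeries.constantCoeff E = 1) :
    PowerSeries.constantCoeff (invSqrt E) = 1 := by
  have h0 : PowerSeries.constantCoeff (E - 1) = 0 := by simp [hE]
  have hs : PowerSeries.HasSubst (E - 1) := PowerSeries.HasSubst.of_constantCoeff_zero' h0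
  have h := PowerSeries.constantCoeff_subst_eq_zero h0
    (PowerSeries.binomialSeries ℂ (-1 / 2 : ℚ) - 1) (by simp)
  have h1 : PowerSeries.subst (E - 1) (1 : PowerSeries ℂ) = 1 := by
    rw [← PowerSeries.coe_substAlgHom hs, map_one]
  rw [← PowerSeries.coe_substAlgHom hs, map_sub, PowerSeries.coe_substAlgHom, h1] at h
  have h2 : PowerSeries.constantCoeff (invSqrt E - 1) = 0 := h
  rwa [map_sub, map_one, sub_eq_zero] at h2

/-- A solution of `X g' = -½ X ℓ' g` with constant term `1` is `exp(ℓ)^{-1/2}`. -/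
theorem eq_invSqrt_exp {g ℓ : PowerSeries ℂ} (hg : PowerSeries.constantCoeff g = 1)
    (hℓ : PowerSeries.constantCoeff ℓ = 0)
    (h : euler g = PowerSeries.C (-1 / 2) * (g * euler ℓ)) :
    g = invSqrt ((PowerSeries.exp ℂ).subst ℓ) := by
  have hs : PowerSeries.HasSubst ℓ := PowerSeries.HasSubst.of_constantCoeff_zero' hℓ
  set E := (PowerSeries.exp ℂ).subst ℓ with hE
  have hE1 : PowerSeries.constantCoeff E = 1 := by
    have h0 := PowerSeries.constantCoeff_subst_eq_zero hℓ (PowerSeries.exp ℂ - 1) (by simp)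
    have h1 : PowerSeries.subst ℓ (1 : PowerSeries ℂ) = 1 := by
      rw [← PowerSeries.coe_substAlgHom hs, map_one]
    rw [← PowerSeries.coe_substAlgHom hs, map_sub, PowerSeries.coe_substAlgHom, h1] at h0
    have h2 : PowerSeries.constantCoeff (E - 1) = 0 := h0
    rwa [map_sub, map_one, sub_eq_zero] at h2
  have hEd : euler E = E * euler ℓ := by
    rw [euler_apply, euler_apply, hE, PowerSeries.derivative_subst hs, PowerSeries.derivative_exp]
    ring
  have hC : (PowerSeries.C (-1 / 2 : ℂ) : PowerSeries ℂ) + PowerSeries.C (-1 / 2) = -1 := by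
    rw [← map_add, ← map_one PowerSeries.C, ← map_neg]
    norm_num
  -- The differential equations for `g` and `E = exp ℓ` make `g² E` constant, so it is `1`.
  have hd : euler (g * g * E) = 0 := by
    rw [Derivation.leibniz, Derivation.leibniz, hEd, h]
    simp only [smul_eq_mul]
    linear_combination g * g * E * euler ℓ * hC
  have h1 : g * g * E = 1 := by
    ext n
    rcases eq_or_ne n 0 with rfl | hn
    · simp [hg, hE1]
    · have := congrArg (PowerSeries.coeff n) hd
      rw [coeff_euler, map_zero] at this
      rw [PowerSeries.coeff_one, if_neg hn]
      exact (mul_eq_zero.mp this).resolve_left (by exact_mod_cast hn)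
  have h2 := invSqrt_mul_invSqrt_mul hE1
  -- Two square roots of `1/E` agree up to sign, and the constant terms exclude the minus sign.
  have h3 : (g - invSqrt E) * ((g + invSqrt E) * E) = 0 := by linear_combination h1 - h2
  rcases mul_eq_zero.mp h3 with h4 | h4
  · exact sub_eq_zero.mp h4
  · have := congrArg PowerSeries.constantCoeff h4
    rw [map_mul, map_add, hg, hE1, constantCoeff_invSqrt hE1, map_zero] at this
    norm_num at this

/-! ## The matrices `A_a` -/

theorem eisenstein_of_odd {k : ℕ} (h : ¬Even k) (τ : UpperHalfPlane) : eisenstein k τ = 0 := if_neg h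

/-- The sign `(-1)^(l+1)` is symmetric when `k + l` is even, and otherwise the Eisenstein series
vanishes. -/
theorem matC_symm (τ : UpperHalfPlane) (k l : ℕ+) : matC k l τ = matC l k τ := by
  rw [matC, matC, add_comm (l : ℕ) k, mul_comm ((l - 1 : ℕ).factorial : ℂ)]
  by_cases h : Even ((k : ℕ) + l)
  · congr 2
    rcases Nat.even_or_odd k with hk | hk
    · have hl := (Nat.even_add.mp h).mp hk
      rw [pow_succ, pow_succ, hk.neg_one_pow, hl.neg_one_pow]
    · have hl : Odd (l : ℕ) := by
        rw [← Nat.not_even_iff_odd] at hk ⊢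
        exact fun h' => hk ((Nat.even_add.mp h).mpr h')
      rw [pow_succ, pow_succ, hk.neg_one_pow, hl.neg_one_pow]
  · rw [eisenstein_of_odd h, mul_zero, mul_zero]

/-- The coefficient `1 / √(k l)`. -/
def invSqrtMul (k l : ℕ+) : ℂ := 1 / ((Real.sqrt ((k : ℝ) * (l : ℝ)) : ℝ) : ℂ)

theorem invSqrtMul_comm (k l : ℕ+) : invSqrtMul k l = invSqrtMul l k := by
  rw [invSqrtMul, invSqrtMul, mul_comm]

theorem invSqrtMul_self (k : ℕ+) : invSqrtMul k k = 1 / ((k : ℕ) : ℂ) := by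
  rw [invSqrtMul, Real.sqrt_mul_self (by positivity)]
  simp

/-- The symmetric normalization `1/√(kl)` supplies the factor `1/j` that the norm contributes to
each sum over intermediate modes. -/
theorem invSqrtMul_mul (k j l : ℕ+) :
    invSqrtMul k j * invSqrtMul j l = invSqrtMul k l * (1 / ((j : ℕ) : ℂ)) := by
  rw [← invSqrtMul_self]
  simp only [invSqrtMul]
  rw [Real.sqrt_mul (by positivity), Real.sqrt_mul (by positivity), Real.sqrt_mul (by positivity),
    Real.sqrt_mul (by positivity)]
  push_cast
  simp only [one_div, mul_inv]
  ring

theorem matA_eq (τ : UpperHalfPlane) (k l : ℕ+) : matA τ k l =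
    PowerSeries.monomial ((k : ℕ) + l) (invSqrtMul k l * matC k l τ) := rfl

theorem matA_eq_C_mul (τ : UpperHalfPlane) (k l : ℕ+) : matA τ k l =
    PowerSeries.C (invSqrtMul k l * matC k l τ) * PowerSeries.X ^ ((k : ℕ) + l) := by
  rw [matA_eq, PowerSeries.monomial_eq_mk, ← PowerSeries.smul_eq_C_mul]
  ext d
  simp [PowerSeries.coeff_X_pow]

theorem matA_symm (τ : UpperHalfPlane) (k l : ℕ+) : matA τ k l = matA τ l k := by
  rw [matA_eq, matA_eq, matC_symm, invSqrtMul_comm, add_comm (k : ℕ)]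

theorem euler_matA (τ : UpperHalfPlane) (k l : ℕ+) :
    euler (matA τ k l) = PowerSeries.C (((k : ℕ) : ℂ) + ((l : ℕ) : ℂ)) * matA τ k l := by
  ext d
  rw [coeff_euler, PowerSeries.coeff_C_mul, matA_eq, PowerSeries.coeff_monomial]
  split_ifs with h
  · rw [h]
    push_cast
    rfl
  · rw [mul_zero, mul_zero]

theorem orderGE_matA (τ : UpperHalfPlane) : InfMatrix.OrderGE 0 (matA τ) := fun k l d hd => by
  rw [matA_eq, PowerSeries.coeff_monomial, if_neg (by omega)]

/-! ## The genus two partition function -/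

theorem isAmplitude_torusAmplitude (τ : UpperHalfPlane) :
    IsAmplitude (fun k l => matC k l τ) (torusAmplitude τ) :=
  ⟨torusAmplitude_zero τ, torusAmplitude_single_add τ⟩

/-- The substitution `ε = s ^ 2`. -/
def expandTwo : PowerSeries ℂ →ₐ[ℂ] PowerSeries ℂ := PowerSeries.expand 2 two_ne_zero

theorem truncHom_expandTwo {N : ℕ} {f g : PowerSeries ℂ} (h : PowerSeries.X ^ (N + 1) ∣ f - g) :
    truncHom N (expandTwo f) = truncHom N (expandTwo g) := by
  rw [X_pow_dvd_sub_iff] at h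
  rw [truncHom_eq_iff]
  intro d hd
  rw [expandTwo, PowerSeries.coeff_expand, PowerSeries.coeff_expand]
  split_ifs
  · exact h _ (by omega)
  · rfl

theorem euler_expandTwo (f : PowerSeries ℂ) : euler (expandTwo f) = 2 * expandTwo (euler f) := by
  ext d
  rw [coeff_euler, two_mul, map_add, expandTwo, PowerSeries.coeff_expand, PowerSeries.coeff_expand]
  split_ifs with h
  · obtain ⟨m, rfl⟩ := h
    rw [Nat.mul_div_cancel_left _ two_pos, coeff_euler]
    push_cast
    ring
  · simp

theorem truncHom_euler {N : ℕ} {f g : PowerSeries ℂ} (h : truncHom N f = truncHom N g) :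
    truncHom N (euler f) = truncHom N (euler g) := by
  rw [truncHom_eq_iff] at h ⊢
  intro d hd
  rw [coeff_euler, coeff_euler, h d hd]

theorem expandTwo_term (c : ℂ) (j : ℕ) (f : PowerSeries ℂ) :
    expandTwo (PowerSeries.C c * PowerSeries.X ^ (j + 1) * f) =
      PowerSeries.C c * PowerSeries.X ^ (2 * (j + 1)) * expandTwo f := by
  rw [map_mul, map_mul, map_pow, expandTwo, PowerSeries.expand_C, PowerSeries.expand_X, pow_mul]

theorem mul_pow_mul_pow_rearrange {R : Type*} [CommRing R] {a b c d : R} (h : a * b = c * d)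
    (x f : R) (i j l : ℕ) : a * x ^ (i + 1 + (l + 1)) * (b * x ^ (2 * (j + 1)) * f) =
      c * x ^ (i + 1 + (j + 1)) * (d * x ^ (j + 1 + (l + 1)) * f) := by
  linear_combination x ^ (i + 1 + (l + 1)) * x ^ (2 * (j + 1)) * f * h

/-! ### Block matrices and the differential equation for the partition function -/

section Blocks

variable (τ₁ τ₂ : UpperHalfPlane)

/-- The generating series of products of normalized amplitudes. -/
def amplitudeSeries : PowerSeries ℂ := weightSum fun e => torusAmplitude τ₁ e * torusAmplitude τ₂ e

/-- The rescaled block of the matrix of `shiftSum`s. -/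
def shiftBlock (N : ℕ) : Matrix (Fin N) (Fin N) (TruncRing N) := Matrix.of fun i l =>
  truncHom N (PowerSeries.C (invSqrtMul (i : ℕ).succPNat (l : ℕ).succPNat) *
    PowerSeries.X ^ ((i : ℕ) + 1 + (l + 1)) *
    expandTwo (shiftSum (torusAmplitude τ₁) (torusAmplitude τ₂) (i : ℕ).succPNat (l : ℕ).succPNat))

/-- The rescaled block of the matrix of `doubleShiftSum`s. -/
def doubleShiftBlock (N : ℕ) : Matrix (Fin N) (Fin N) (TruncRing N) := Matrix.of fun i l =>
  truncHom N (PowerSeries.C (invSqrtMul (i : ℕ).succPNat (l : ℕ).succPNat) *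
    PowerSeries.X ^ ((i : ℕ) + 1 + (l + 1)) *
    expandTwo (doubleShiftSum (torusAmplitude τ₁) (torusAmplitude τ₂)
      (i : ℕ).succPNat (l : ℕ).succPNat))

theorem truncBlock_matA_apply (τ : UpperHalfPlane) {N : ℕ} (i l : Fin N) :
    InfMatrix.truncBlock N (matA τ) i l = truncHom N (PowerSeries.C
      (invSqrtMul (i : ℕ).succPNat (l : ℕ).succPNat *
        matC (i : ℕ).succPNat (l : ℕ).succPNat τ) * PowerSeries.X ^ ((i : ℕ) + 1 + (l + 1))) :=
  congrArg (truncHom N) (matA_eq_C_mul τ _ _)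

theorem C_invSqrtMul_mul (k j l : ℕ) (c : ℂ) :
    (PowerSeries.C (invSqrtMul k.succPNat l.succPNat) : PowerSeries ℂ) *
      PowerSeries.C (c / ((j : ℂ) + 1)) =
    PowerSeries.C (invSqrtMul k.succPNat j.succPNat * c) *
      PowerSeries.C (invSqrtMul j.succPNat l.succPNat) := by
  have h := invSqrtMul_mul k.succPNat j.succPNat l.succPNat
  rw [Nat.succPNat_coe, Nat.succ_eq_add_one, Nat.cast_add, Nat.cast_one] at h
  rw [← map_mul, ← map_mul]
  congr 1
  linear_combination -c * h

theorem shiftBlock_eq (N : ℕ) : shiftBlock τ₁ τ₂ N =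
    -(InfMatrix.truncBlock N (matA τ₁) * doubleShiftBlock τ₁ τ₂ N) := by
  ext i l
  have h := truncHom_expandTwo (shiftSum_congr (F₂ := torusAmplitude τ₂)
    (isAmplitude_torusAmplitude τ₁) (i : ℕ).succPNat (l : ℕ).succPNat N)
  rw [Matrix.neg_apply, Matrix.mul_apply]
  simp only [truncBlock_matA_apply, shiftBlock, doubleShiftBlock, Matrix.of_apply]
  rw [map_mul (truncHom N) (_ * _), h]
  simp only [← map_mul (truncHom N), ← map_sum (truncHom N), ← map_neg (truncHom N)]
  congr 1
  rw [map_neg, map_sum, mul_neg, Finset.mul_sum]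
  refine congrArg Neg.neg (Finset.sum_congr rfl fun j _ => ?_)
  rw [expandTwo_term]
  exact mul_pow_mul_pow_rearrange (C_invSqrtMul_mul i j l _) _ _ _ _ _

theorem doubleShiftBlock_eq (N : ℕ) : doubleShiftBlock τ₁ τ₂ N =
    truncHom N (expandTwo (amplitudeSeries τ₁ τ₂)) • InfMatrix.truncBlock N (matA τ₂) -
      InfMatrix.truncBlock N (matA τ₂) * shiftBlock τ₁ τ₂ N := by
  ext i l
  have h := truncHom_expandTwo (doubleShiftSum_congr (F₁ := torusAmplitude τ₁)
    (isAmplitude_torusAmplitude τ₂) (i : ℕ).succPNat (l : ℕ).succPNat N)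
  rw [Matrix.sub_apply, Matrix.smul_apply, Matrix.mul_apply]
  simp only [truncBlock_matA_apply, shiftBlock, doubleShiftBlock, Matrix.of_apply, smul_eq_mul]
  rw [map_mul (truncHom N) (_ * _) (expandTwo (doubleShiftSum _ _ _ _)), h]
  simp only [← map_mul (truncHom N), ← map_sum (truncHom N), ← map_sub (truncHom N)]
  congr 1
  rw [map_sub, map_sum, mul_sub, Finset.mul_sum]
  refine congrArg₂ (· - ·) ?_ (Finset.sum_congr rfl fun j _ => ?_)
  · rw [map_mul, amplitudeSeries, map_mul PowerSeries.C]
    have : expandTwo (PowerSeries.C (matC (i : ℕ).succPNat (l : ℕ).succPNat τ₂)) =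
      PowerSeries.C (matC (i : ℕ).succPNat (l : ℕ).succPNat τ₂) := PowerSeries.expand_C _ _ _
    rw [this]
    ring
  · rw [expandTwo_term]
    exact mul_pow_mul_pow_rearrange (C_invSqrtMul_mul i j l _) _ _ _ _ _

/-- The diagonal matrix of weights. -/
def weightMatrix (N : ℕ) : Matrix (Fin N) (Fin N) (PowerSeries ℂ) :=
  Matrix.diagonal fun i => PowerSeries.C ((i : ℂ) + 1)

/-- The substitution `ε = s^2` doubles the Euler operator, and the weight `k` cancels the diagonal
scaling `1/√(k k)` of `shiftBlock`. -/
theorem truncHom_euler_amplitudeSeries (N : ℕ) :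
    truncHom N (euler (expandTwo (amplitudeSeries τ₁ τ₂))) =
      -2 * ((weightMatrix N).map (truncHom N) * shiftBlock τ₁ τ₂ N).trace := by
  have h := truncHom_expandTwo (euler_weightSum_congr (torusAmplitude τ₁) (torusAmplitude τ₂) N)
  rw [euler_expandTwo, map_mul, amplitudeSeries, h, weightMatrix, Matrix.diagonal_map (map_zero _),
    Matrix.trace]
  simp only [Matrix.diag_apply, Matrix.diagonal_mul, shiftBlock, Matrix.of_apply]
  rw [map_neg, map_neg, mul_neg, neg_mul, map_ofNat]
  congr 2
  simp only [← map_mul (truncHom N), ← map_sum (truncHom N)]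
  congr 1
  rw [map_sum]
  refine Finset.sum_congr rfl fun j _ => ?_
  have hj : ((j : ℂ) + 1) ≠ 0 := by exact_mod_cast Nat.succ_ne_zero (j : ℕ)
  have hC : (PowerSeries.C ((j : ℂ) + 1) : PowerSeries ℂ) *
      PowerSeries.C (invSqrtMul (j : ℕ).succPNat (j : ℕ).succPNat) = 1 := by
    rw [← map_mul, invSqrtMul_self, Nat.succPNat_coe, Nat.succ_eq_add_one, Nat.cast_add, Nat.cast_one,
      mul_one_div_cancel hj, map_one]
  have hX := expandTwo_term 1 j (shiftSum (torusAmplitude τ₁) (torusAmplitude τ₂) (j : ℕ).succPNat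
    (j : ℕ).succPNat)
  rw [map_one, one_mul, one_mul] at hX
  rw [hX]
  linear_combination -PowerSeries.X ^ (2 * ((j : ℕ) + 1)) *
    expandTwo (shiftSum (torusAmplitude τ₁) (torusAmplitude τ₂) (j : ℕ).succPNat
      (j : ℕ).succPNat) * hC

theorem block_matA_transpose (τ : UpperHalfPlane) (N : ℕ) :
    (InfMatrix.block N (matA τ)).transpose = InfMatrix.block N (matA τ) := by
  ext1 i j
  exact matA_symm τ _ _

theorem block_matA_map_euler (τ : UpperHalfPlane) (N : ℕ) :
    (InfMatrix.block N (matA τ)).map euler =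
      weightMatrix N * InfMatrix.block N (matA τ) + InfMatrix.block N (matA τ) * weightMatrix N := by
  ext1 i j
  rw [Matrix.map_apply, Matrix.add_apply, weightMatrix, Matrix.diagonal_mul, Matrix.mul_diagonal]
  change euler (matA τ _ _) = _
  rw [euler_matA, Nat.succPNat_coe, Nat.succPNat_coe, map_add]
  push_cast
  change _ = _ * matA τ _ _ + matA τ _ _ * _
  ring

theorem orderGE_mul_matA : InfMatrix.OrderGE 2 (InfMatrix.mul (matA τ₁) (matA τ₂)) :=
  (orderGE_matA τ₁).mul (orderGE_matA τ₂)

theorem truncBlock_mul_matA (N : ℕ) : InfMatrix.truncBlock N (InfMatrix.mul (matA τ₁) (matA τ₂)) =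
    InfMatrix.truncBlock N (matA τ₁) * InfMatrix.truncBlock N (matA τ₂) :=
  InfMatrix.truncBlock_mul fun k j l _ _ _ =>
    (orderGE_matA τ₁).coeff_mul (orderGE_matA τ₂) k j l (by omega)

/-- The Euler operator acts on each `A_a` by `WA + AW`, with `W` the diagonal matrix of weights.
Differentiation is carried out over the full power series ring, and reduction modulo `X ^ (N + 1)`
comes last. -/
theorem truncHom_euler_logDetOneSub (N : ℕ) :
    truncHom N (euler (InfMatrix.logDetOneSub (InfMatrix.mul (matA τ₁) (matA τ₂)))) =
      -4 * ∑ i : Fin N, ((weightMatrix N).map (truncHom N) *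
        (InfMatrix.truncBlock N (matA τ₁) * InfMatrix.truncBlock N (matA τ₂)) ^ ((i : ℕ) + 1)).trace := by
  set T := InfMatrix.block N (matA τ₁) * InfMatrix.block N (matA τ₂) with hT
  have hTmap : InfMatrix.truncBlock N (matA τ₁) * InfMatrix.truncBlock N (matA τ₂) =
      T.map (truncHom N) := (Matrix.map_mul ..).symm
  have htr : ∀ M : Matrix (Fin N) (Fin N) (PowerSeries ℂ),
      (M.map (truncHom N)).trace = truncHom N M.trace := fun M => by
    rw [Matrix.trace, Matrix.trace, map_sum]
    rfl
  have h1 := InfMatrix.truncHom_logDetOneSub (orderGE_mul_matA τ₁ τ₂) N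
  rw [truncBlock_mul_matA, hTmap] at h1
  rw [hTmap]
  simp only [← Matrix.map_pow, ← Matrix.map_mul, htr, ← map_mul (truncHom N), ← map_sum (truncHom N),
    ← map_neg (truncHom N)] at h1 ⊢
  rw [truncHom_euler h1, show (-4 : TruncRing N) = truncHom N (-4) by rw [map_neg, map_ofNat], ← map_mul]
  congr 1
  rw [map_neg, map_sum, neg_mul, Finset.mul_sum]
  congr 1
  refine Finset.sum_congr rfl fun i _ => ?_
  have hi : ((i : ℂ) + 1) ≠ 0 := by exact_mod_cast Nat.succ_ne_zero (i : ℕ)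
  rw [← PowerSeries.smul_eq_C_mul, Derivation.map_smul, derivation_trace_pow, smul_smul,
    one_div_mul_cancel hi, one_smul]
  exact trace_pow_mul_map_derivation euler (block_matA_transpose τ₁ N) (block_matA_transpose τ₂ N)
    (block_matA_map_euler τ₁ N) (block_matA_map_euler τ₂ N) i

theorem euler_expandTwo_amplitudeSeries : euler (expandTwo (amplitudeSeries τ₁ τ₂)) =
    PowerSeries.C (-1 / 2) * (expandTwo (amplitudeSeries τ₁ τ₂) *
      euler (InfMatrix.logDetOneSub (InfMatrix.mul (matA τ₁) (matA τ₂)))) := by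
  have key : ∀ N, truncHom N (euler (expandTwo (amplitudeSeries τ₁ τ₂))) =
      truncHom N (PowerSeries.C (-1 / 2) * (expandTwo (amplitudeSeries τ₁ τ₂) *
        euler (InfMatrix.logDetOneSub (InfMatrix.mul (matA τ₁) (matA τ₂))))) := fun N => by
    have hnil : (InfMatrix.truncBlock N (matA τ₁) * InfMatrix.truncBlock N (matA τ₂)) ^ (N + 1) = 0 := by
      rw [← truncBlock_mul_matA]
      exact InfMatrix.truncBlock_pow_eq_zero (orderGE_mul_matA τ₁ τ₂) N
    have hh := eq_neg_sum_pow (shiftBlock_eq τ₁ τ₂ N) (doubleShiftBlock_eq τ₁ τ₂ N) hnil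
    -- Dropping the zero power `N + 1` leaves the same `N` powers as in the truncated logarithm.
    rw [Finset.sum_range_succ, hnil, add_zero] at hh
    have hC : truncHom N (PowerSeries.C (-1 / 2)) * 2 = -1 := by
      rw [← map_ofNat (truncHom N), ← map_mul, ← map_ofNat PowerSeries.C, ← map_mul, ← map_one (truncHom N),
        ← map_neg, ← map_one PowerSeries.C, ← map_neg]
      norm_num
    rw [truncHom_euler_amplitudeSeries, hh, map_mul, map_mul, truncHom_euler_logDetOneSub,
      Matrix.mul_neg, Matrix.mul_smul, Matrix.trace_neg, Matrix.trace_smul, Finset.mul_sum,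
      Matrix.trace_sum, Fin.sum_univ_eq_sum_range (fun i => ((weightMatrix N).map (truncHom N) *
        (InfMatrix.truncBlock N (matA τ₁) * InfMatrix.truncBlock N (matA τ₂)) ^ (i + 1)).trace),
      smul_eq_mul]
    linear_combination 2 * truncHom N (expandTwo (amplitudeSeries τ₁ τ₂)) * (∑ i ∈ Finset.range N,
      ((weightMatrix N).map (truncHom N) *
        (InfMatrix.truncBlock N (matA τ₁) * InfMatrix.truncBlock N (matA τ₂)) ^ (i + 1)).trace) * hC
  ext d
  exact truncHom_eq_iff.mp (key d) d le_rfl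

theorem constantCoeff_expandTwo_amplitudeSeries :
    PowerSeries.constantCoeff (expandTwo (amplitudeSeries τ₁ τ₂)) = 1 := by
  have h : expsOfWeight 0 = {0} := by
    ext e
    rw [mem_expsOfWeight, Finset.mem_singleton]
    constructor
    · intro h
      by_contra h0
      obtain ⟨m, f, rfl⟩ := exists_eq_single_add h0
      have := m.pos
      rw [expWeight_add, expWeight_single] at h
      omega
    · rintro rfl
      simp [expWeight]
  rw [expandTwo, PowerSeries.constantCoeff_expand, amplitudeSeries, weightSum,
    ← PowerSeries.coeff_zero_eq_constantCoeff_apply, PowerSeries.coeff_mk, h, Finset.sum_singleton,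
    torusAmplitude_zero, torusAmplitude_zero]
  simp [fockNorm]

theorem expandTwo_amplitudeSeries : expandTwo (amplitudeSeries τ₁ τ₂) =
    invSqrt (InfMatrix.detOneSub (InfMatrix.mul (matA τ₁) (matA τ₂))) :=
  eq_invSqrt_exp (constantCoeff_expandTwo_amplitudeSeries τ₁ τ₂)
    (InfMatrix.constantCoeff_logDetOneSub (orderGE_mul_matA τ₁ τ₂))
    (euler_expandTwo_amplitudeSeries τ₁ τ₂)

end Blocks

end GenusTwoBoson

end

open GenusTwoBoson in
/-- Let `B` be the Li–Zamolodchikov metric of the square bracket Heisenberg vertex operator algebra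
and, for each `r`, let `u r` be a basis of the space `V_[r]` with dual basis `ubar r` with respect
to `B`. All genus one one-point functions converge, and the genus two partition function is
`1 / (η(τ₁) η(τ₂)) · det(I - A₁ A₂)^{-1/2}`, as formal power series in `ε`. Both sides are written as
power series in `s = ε^{1/2}`: the left side is expanded by `ε = s ^ 2`. -/
theorem mainTheorem4
    (B : LinearMap.BilinForm ℂ Fock) (hB : heisenberg.IsSqLiZMetric B)
    {ι : ℕ → Type*} [∀ r, Fintype (ι r)] [∀ r, DecidableEq (ι r)]
    (u : ∀ r, Module.Basis (ι r) ℂ (heisenberg.sqWeightSpace r))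
    (ubar : ∀ r, ι r → heisenberg.sqWeightSpace r)
    (hdual : ∀ r i j, B (ubar r i) (u r j) = if i = j then 1 else 0) :
    (∀ (v : Fock) (τ : UpperHalfPlane), Summable (heisenberg.onePointTerm v τ)) ∧
    ∀ τ₁ τ₂ : UpperHalfPlane,
      PowerSeries.expand 2 two_ne_zero
          (heisenberg.genusTwoPartition (fun r i => u r i) ubar τ₁ τ₂) =
        PowerSeries.C (1 / (ModularForm.eta τ₁ * ModularForm.eta τ₂)) *
          invSqrt (InfMatrix.detOneSub (InfMatrix.mul (matA τ₁) (matA τ₂))) := by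
  refine ⟨fun v τ => summable_onePointTerm v τ, fun τ₁ τ₂ => ?_⟩
  have hη₁ : ModularForm.eta τ₁ ≠ 0 := ModularForm.eta_ne_zero τ₁.im_pos
  have hη₂ : ModularForm.eta τ₂ ≠ 0 := ModularForm.eta_ne_zero τ₂.im_pos
  -- Passing to Fock vectors and writing each one-point function as its normalized amplitude divided
  -- by `η` reduces the partition function to `amplitudeSeries`.
  have h : heisenberg.genusTwoPartition (fun r i => u r i) ubar τ₁ τ₂ =
      PowerSeries.C (1 / (ModularForm.eta τ₁ * ModularForm.eta τ₂)) * amplitudeSeries τ₁ τ₂ := by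
    ext r
    rw [VOAData.genusTwoPartition, PowerSeries.coeff_mk, PowerSeries.coeff_C_mul, amplitudeSeries,
      weightSum, PowerSeries.coeff_mk, Finset.mul_sum]
    refine (sum_dualBasis_eq hB (u r) (ubar r) (hdual r) (onePointLinear τ₁)
      (onePointLinear τ₂)).trans (Finset.sum_congr rfl fun e _ => ?_)
    rw [torusAmplitude, torusAmplitude]
    field_simp
  rw [h, map_mul, PowerSeries.expand_C, ← expandTwo_amplitudeSeries]
  rfl
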